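/- Equip $\mathbb R^7$ (the imaginary octonions) with its cross product $\times$, extended $\mathbb C$-bilinearly to $\mathbb C^7$; let $G_2^{\mathbb C}\subset GL(7,\mathbb C)$ be the group of linear automorphisms of $(\mathbb C^7,\times)$, and let $S^6\subset\mathbb R^7$ carry the almost complex structure $J_pv=p\times v$. Let $S^2=\mathbb C\cup\{\infty\}$ be the Riemann sphere. A smooth map $f:S^2\to S^6$ is an almost complex curve if its differential is complex linear, i.e. $\partial_yf=f\times\partial_xf$ in every local complex coordinate $z=x+iy$; it is linearly full if its image lies in no proper linear subspace of $\mathbb R^7$. The directrix curve of $f$ is the holomorphic element $\psi_0:S^2\to\mathbb CP^6$ of the harmonic sequence of $[f]:S^2\to\mathbb CP^6$: starting from $g=f$, one repeatedly replaces the local section $g$ by the component of $\partial g/\partial\bar z$ that is Hermitian-orthogonal to $g$ (the line spanned being extended over the isolated zeros) until the line spanned is holomorphic. Theorem. Let $f,\tilde f:S^2\to S^6$ be linearly full almost complex curves. Then each of them has a unique directrix curve; denote these by $\psi_0,\tilde\psi_0:S^2\to\mathbb CP^6$. There is $[A]\in PGL(7,\mathbb C)$ with $\tilde\psi_0(p)=[A]\,\psi_0(p)$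 for all $p\in S^2$ if and only if there is $g\in G_2^{\mathbb C}$ with $\tilde\psi_0(p)=g\,\psi_0(p)$ for all $p\in S^2$. -/

import Mathlib

open scoped ContDiff LinearAlgebra.Projectivization MatrixGroups Matrix Topology

noncomputable section

/-- The cross product of `R⁷` (imaginary octonions) in a canonical basis `e₁, …, e₇`:
`e₁e₂ = e₃`, `e₁e₄ = e₅`, `e₂e₄ = e₆`, `e₃e₄ = e₇`, `e₁e₇ = e₆`, `e₂e₅ = e₇`, `e₃e₆ = e₅`
and cyclic permutations of each. For `R = ℂ` it is the `ℂ`-bilinear extension of the one for `ℝ`.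
The coordinates are numbered from `0` to `6`. -/
def cross7 {R : Type*} [CommRing R] (u v : Fin 7 → R) : Fin 7 → R :=
  ![(u 1 * v 2 - u 2 * v 1) + (u 3 * v 4 - u 4 * v 3) + (u 6 * v 5 - u 5 * v 6),
    (u 2 * v 0 - u 0 * v 2) + (u 3 * v 5 - u 5 * v 3) + (u 4 * v 6 - u 6 * v 4),
    (u 0 * v 1 - u 1 * v 0) + (u 3 * v 6 - u 6 * v 3) + (u 5 * v 4 - u 4 * v 5),
    (u 4 * v 0 - u 0 * v 4) + (u 5 * v 1 - u 1 * v 5) + (u 6 * v 2 - u 2 * v 6),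
    (u 0 * v 3 - u 3 * v 0) + (u 2 * v 5 - u 5 * v 2) + (u 6 * v 1 - u 1 * v 6),
    (u 0 * v 6 - u 6 * v 0) + (u 1 * v 3 - u 3 * v 1) + (u 4 * v 2 - u 2 * v 4),
    (u 1 * v 4 - u 4 * v 1) + (u 2 * v 3 - u 3 * v 2) + (u 5 * v 0 - u 0 * v 5)]

/-- The complex Lie group `G₂^ℂ`: the linear automorphisms of `(ℂ⁷, ×)`. -/
def G2C : Subgroup (GL (Fin 7) ℂ) where
  carrier := {g | ∀ u v : Fin 7 → ℂ, g • cross7 u v = cross7 (g • u) (g • v)}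
  one_mem' := fun u v => by simp
  mul_mem' := fun {a b} ha hb u v => by
    simp only [Set.mem_ofPred_eq] at ha hb
    rw [mul_smul, mul_smul, mul_smul, hb, ha]
  inv_mem' := fun {a} ha u v => by
    simp only [Set.mem_ofPred_eq] at ha
    rw [inv_smul_eq_iff, ha, smul_inv_smul, smul_inv_smul]

/-- The 2-sphere as a Riemann surface: the Riemann sphere `ℂ ∪ {∞}`. -/
abbrev RiemannSphere : Type := OnePoint ℂ

open Classical in
/-- The two standard holomorphic parametrizations of the Riemann sphere, `z ↦ z` (index `false`)
and `w ↦ 1 / w` with `0 ↦ ∞` (index `true`). Their inverses form a holomorphic atlas. -/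
def sphereParam : Bool → ℂ → RiemannSphere
  | false, z => (z : OnePoint ℂ)
  | true, w => if w = 0 then OnePoint.infty else ((w⁻¹ : ℂ) : OnePoint ℂ)

/-- The unit sphere `S⁶` of `ℝ⁷`. -/
abbrev SixSphere : Type := Metric.sphere (0 : EuclideanSpace ℝ (Fin 7)) 1

/-- The complex projective space `ℂP⁶`. -/
abbrev CP6 : Type := ℙ ℂ (Fin 7 → ℂ)

/-- A map `f : S² → S⁶` in the local coordinate `c`, as a map `ℂ → ℝ⁷`. -/
def localExpr (f : RiemannSphere → SixSphere) (c : Bool) (z : ℂ) : Fin 7 → ℝ :=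
  WithLp.ofLp (f (sphereParam c z)).1

/-- `f : S² → S⁶` is an almost complex curve: it is smooth and its differential is complex linear
for the almost complex structure `J_p v = p × v` (for `v ∈ T_p S⁶`) of the nearly Kähler `S⁶`. -/
def IsAlmostComplexCurve (f : RiemannSphere → SixSphere) : Prop :=
  ∀ c : Bool, ContDiff ℝ ∞ (localExpr f c) ∧
    ∀ z v : ℂ, fderiv ℝ (localExpr f c) z (Complex.I * v) =
      cross7 (localExpr f c z) (fderiv ℝ (localExpr f c) z v)

/-- `f : S² → S⁶` is linearly full: its image lies in no proper linear subspace of `ℝ⁷`, that is,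
in no totally geodesic sphere of smaller dimension. -/
def IsLinearlyFull (f : RiemannSphere → SixSphere) : Prop :=
  ∀ W : Submodule ℝ (EuclideanSpace ℝ (Fin 7)),
    (∀ p, (f p : EuclideanSpace ℝ (Fin 7)) ∈ W) → W = ⊤

/-- `∂g/∂z̄ = (∂g/∂x + i ∂g/∂y) / 2`. -/
def dbar (g : ℂ → Fin 7 → ℂ) (z : ℂ) : Fin 7 → ℂ :=
  (1 / 2 : ℂ) • (fderiv ℝ g z 1 + Complex.I • fderiv ℝ g z Complex.I)

/-- For a local section `g` of the line bundle spanned by `g`, the component of `∂g/∂z̄` that is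
orthogonal to `g` for the standard Hermitian product of `ℂ⁷`. -/
def dbarTransform (g : ℂ → Fin 7 → ℂ) (z : ℂ) : Fin 7 → ℂ :=
  dbar g z - ((star (g z) ⬝ᵥ dbar g z) / (star (g z) ⬝ᵥ g z)) • g z

/-- In the local coordinate `c`, the local section of the `k`-th line bundle of the descending
harmonic sequence of `[f] : S² → ℂP⁶`, obtained from `f` by `k` steps `g ↦ (∂g/∂z̄)^⊥`. -/
def descendingSection (f : RiemannSphere → SixSphere) (c : Bool) (k : ℕ) : ℂ → Fin 7 → ℂ :=
  dbarTransform^[k] (fun z i => (localExpr f c z i : ℂ))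

/-- `ψ : S² → ℂP⁶` is holomorphic: in the local coordinates it has, near every point, a
holomorphic nowhere vanishing lift to `ℂ⁷`. -/
def IsHolomorphicCurve (ψ : RiemannSphere → CP6) : Prop :=
  ∀ (c : Bool) (z₀ : ℂ), ∃ h : ℂ → Fin 7 → ℂ, AnalyticAt ℂ h z₀ ∧
    ∀ᶠ z in 𝓝 z₀, ∃ hz : h z ≠ 0, ψ (sphereParam c z) = Projectivization.mk ℂ (h z) hz

/-- `ψ` is the element `k` steps below `[f]` in the harmonic sequence of `[f]`: away from a finite
set `W` of singular points the sections of all the steps up to the `k`-th are nonzero, and the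
`k`-th one spans `ψ`. -/
def IsDescendingElement (f : RiemannSphere → SixSphere) (k : ℕ) (ψ : RiemannSphere → CP6) : Prop :=
  ∃ W : Set RiemannSphere, W.Finite ∧
    ∀ (c : Bool) (z : ℂ), sphereParam c z ∉ W →
      (∀ j < k, descendingSection f c j z ≠ 0) ∧
      ∃ hz : descendingSection f c k z ≠ 0,
        ψ (sphereParam c z) = Projectivization.mk ℂ (descendingSection f c k z) hz

/-- `ψ` is the directrix curve of `f`: the holomorphic element of the harmonic sequence of `[f]`
(at the singular points its value is fixed by continuity). -/
def IsDirectrixCurve (f : RiemannSphere → SixSphere) (ψ : RiemannSphere → CP6) : Prop :=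
  IsHolomorphicCurve ψ ∧ ∃ k : ℕ, IsDescendingElement f k ψ

/-- Projective equivalence of maps into `ℂP⁶`. -/
def ProjectivelyEquivalent (ψ ψ' : RiemannSphere → CP6) : Prop :=
  ∃ A : PGL(7, ℂ), ∀ p, ψ' p = A • ψ p

/-- `G₂^ℂ`-equivalence of maps into `ℂP⁶`. -/
def G2CEquivalent (ψ ψ' : RiemannSphere → CP6) : Prop :=
  ∃ g ∈ G2C, ∀ p, ψ' p = g • ψ p

end

/-! Let F be the complexified curve in a local coordinate, a, b, c its first three derivatives in
z̄, e = |a|², h = a × b, and k = e times the part of b Hermitian-orthogonal to a. The map F × ·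
splits ℂ⁷ into ℂF and two conjugate isotropic eigenspaces, for i and -i. The vectors a, b, k lie in
the -i eigenspace and h in the i eigenspace. All structure equations come from differentiating F × a
= -i a and from the double product identity `cross7_cross7_self`.

Existence and uniqueness of the directrix. The conjugate of h satisfies an equation ∂̄u =
(smooth)·u, and log |h|² has a Laplacian bounded below. Strong unique continuation then shows that h
vanishes identically or has only zeros of finite order (`h_dichotomy`). In the first case span(F, a,
ā) is constant along the curve, which contradicts fullness (`exists_orthogonal_of_h_eq_zero`). The
sextic differential c · h is antiholomorphic and tends to zero at infinity on the sphere, so it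
vanishes (`sextic_eq_zero`). This closes the structure equations: off the zeros of h the descending
sequence is F, a, k/e, (i/2) h, 0. Hence the directrix is the third element, spanned by h; h/|h|² is
a holomorphic lift of it, and the finite order of the zeros lets the line extend across them
(`exists_isLocalSpan`).

Rigidity. The lift Φ = h/|h|² satisfies Φ × Φ' = 0, because ∂h = i k and h × k = 0, and its
derivatives up to order six span ℂ⁷ (`lift_full`). Such a curve nearly determines the cross product.
Writing Fⱼ for the derivatives, one gets Fᵢ · Fⱼ = 0 for i + j ≤ 5, and F₁ × F₂ = ρ F₀ with ρ² = F₀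
· F₆ ≠ 0. Let A carry one directrix to another. The condition Φ × Φ' = 0 depends only on the line
spanned, so AΦ satisfies it too. Isotropy of AΦ makes F₀ an eigenvector of AᵀA; its eigenvalue is
constant by continuity, so A is conformal. After rescaling, A preserves the quadratic form and, with
the right sign, the function ρ. The 3-form obtained as the difference of the pulled back and the
original cross product then kills F₀ ∧ F₁ and F₁ ∧ F₂, and repeated differentiation shows that it is
zero (`alternating_eq_zero`). So a multiple of A lies in G₂^ℂ. The converse holds because g acts on
lines through its class in PGL. -/

/-! ### Algebra of the cross product. -/

section CrossProduct

variable {R : Type*} [CommRing R]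

theorem cross7_add_left (u v w : Fin 7 → R) : cross7 (u + v) w = cross7 u w + cross7 v w := by
  ext i; fin_cases i <;> simp [cross7] <;> ring

theorem cross7_add_right (u v w : Fin 7 → R) : cross7 u (v + w) = cross7 u v + cross7 u w := by
  ext i; fin_cases i <;> simp [cross7] <;> ring

theorem cross7_smul_left (r : R) (v w : Fin 7 → R) : cross7 (r • v) w = r • cross7 v w := by
  ext i; fin_cases i <;> simp [cross7] <;> ring

theorem cross7_smul_right (r : R) (v w : Fin 7 → R) : cross7 v (r • w) = r • cross7 v w := by
  ext i; fin_cases i <;> simp [cross7] <;> ring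

theorem cross7_swap (u v : Fin 7 → R) : cross7 u v = -cross7 v u := by
  ext i; fin_cases i <;> simp [cross7] <;> ring

theorem cross7_self (u : Fin 7 → R) : cross7 u u = 0 := by
  ext i; fin_cases i <;> simp [cross7] <;> ring

theorem cross7_neg_left (v w : Fin 7 → R) : cross7 (-v) w = -cross7 v w := by
  simpa using cross7_smul_left (-1) v w

theorem cross7_neg_right (v w : Fin 7 → R) : cross7 v (-w) = -cross7 v w := by
  simpa using cross7_smul_right (-1) v w

theorem cross7_zero_left (w : Fin 7 → R) : cross7 0 w = 0 := by
  simpa using cross7_smul_left 0 0 w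

theorem cross7_zero_right (w : Fin 7 → R) : cross7 w 0 = 0 := by
  simpa using cross7_smul_right 0 w 0

theorem cross7_sub_left (u v w : Fin 7 → R) : cross7 (u - v) w = cross7 u w - cross7 v w := by
  rw [sub_eq_add_neg, cross7_add_left, cross7_neg_left, sub_eq_add_neg]

theorem cross7_sub_right (u v w : Fin 7 → R) : cross7 u (v - w) = cross7 u v - cross7 u w := by
  rw [sub_eq_add_neg, cross7_add_right, cross7_neg_right, sub_eq_add_neg]

/-- The trilinear form `(u × v, w)` is invariant under cyclic permutations. -/
theorem cross7_dot_rotate (u v w : Fin 7 → R) : cross7 u v ⬝ᵥ w = cross7 v w ⬝ᵥ u := by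
  simp [cross7, dotProduct, Fin.sum_univ_succ]; ring

theorem cross7_dot_swap_right (u v w : Fin 7 → R) : cross7 u v ⬝ᵥ w = -(cross7 u w ⬝ᵥ v) := by
  rw [cross7_dot_rotate, cross7_dot_rotate, cross7_swap, neg_dotProduct]

theorem cross7_dot_left (u v : Fin 7 → R) : cross7 u v ⬝ᵥ u = 0 := by
  rw [cross7_dot_rotate, cross7_dot_rotate, cross7_self, zero_dotProduct]

theorem cross7_dot_right (u v : Fin 7 → R) : cross7 u v ⬝ᵥ v = 0 := by
  rw [cross7_swap, neg_dotProduct, cross7_dot_left, neg_zero]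

/-- Polarization in u of the double product formula `cross7_cross7_self`. It replaces the missing
Jacobi identity in the eigenspace computations below. -/
theorem cross7_cross7_polar (u v w : Fin 7 → R) :
    cross7 u (cross7 v w) + cross7 v (cross7 u w) =
      (u ⬝ᵥ w) • v + (v ⬝ᵥ w) • u - (2 * (u ⬝ᵥ v)) • w := by
  ext i; fin_cases i <;> simp [cross7, dotProduct, Fin.sum_univ_succ] <;> ring

theorem cross7_cross7_self (u v : Fin 7 → R) :
    cross7 u (cross7 u v) = (u ⬝ᵥ v) • u - (u ⬝ᵥ u) • v := by
  ext i; fin_cases i <;> simp [cross7, dotProduct, Fin.sum_univ_succ] <;> ring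

theorem cross7_map {S : Type*} [CommRing S] (φ : R →+* S) (u v : Fin 7 → R) :
    cross7 (fun i => φ (u i)) (fun i => φ (v i)) = fun i => φ (cross7 u v i) := by
  ext i; fin_cases i <;> simp [cross7]

end CrossProduct

theorem star_cross7 (u v : Fin 7 → ℂ) : star (cross7 u v) = cross7 (star u) (star v) :=
  (cross7_map (starRingEnd ℂ) u v).symm

theorem star_dot (u v : Fin 7 → ℂ) : star (u ⬝ᵥ v) = star u ⬝ᵥ star v := by
  simp [dotProduct]

theorem eq_zero_of_dot_star_self {u : Fin 7 → ℂ} (h : u ⬝ᵥ star u = 0) : u = 0 := by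
  open ComplexOrder in exact dotProduct_self_star_eq_zero.mp h

/-! The eigenspaces of `F × ·` for a unit vector `F`. -/
section Eigenspaces

variable {F x y z : Fin 7 → ℂ} {s : ℂ}

theorem dot_eq_zero_of_eigen (hs : s * s = -1) (hx : cross7 F x = s • x) : F ⬝ᵥ x = 0 := by
  have h := cross7_dot_left F x
  rw [hx, smul_dotProduct, smul_eq_mul, dotProduct_comm] at h
  rcases mul_eq_zero.mp h with h | h
  · simp [h] at hs
  · exact h

/-- The map F × · is skew for the dot product, so each of its eigenspaces with nonzero eigenvalue is
isotropic. -/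
theorem dot_eq_zero_of_eigen_eigen (hs : s * s = -1) (hx : cross7 F x = s • x)
    (hy : cross7 F y = s • y) : x ⬝ᵥ y = 0 := by
  have h := cross7_dot_swap_right F x y
  rw [hx, hy, smul_dotProduct, smul_dotProduct, dotProduct_comm y x, smul_eq_mul] at h
  have h2 : s * (x ⬝ᵥ y) = 0 := by linear_combination h / 2
  rcases mul_eq_zero.mp h2 with h | h
  · simp [h] at hs
  · exact h

theorem cross7_eigen_eigen (hs : s * s = -1) (hx : cross7 F x = s • x)
    (hy : cross7 F y = s • y) : cross7 F (cross7 x y) = (-s) • cross7 x y := by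
  have h := cross7_cross7_polar F x y
  rw [hy, cross7_smul_right, dot_eq_zero_of_eigen hs hx, dot_eq_zero_of_eigen hs hy,
    dot_eq_zero_of_eigen_eigen hs hx hy] at h
  simp only [zero_smul, mul_zero, add_zero, sub_zero] at h
  rw [neg_smul]; exact eq_neg_of_add_eq_zero_left h

theorem cross7_eigen_opposite (hs : s * s = -1) (hz : cross7 F z = (-s) • z)
    (hy : cross7 F y = s • y) : cross7 z y = (-(s * (z ⬝ᵥ y))) • F := by
  have hs' : (-s) * (-s) = -1 := by simpa using hs
  have h1 := cross7_cross7_polar F z y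
  have h2 := cross7_cross7_polar F y z
  rw [hy, cross7_smul_right, dot_eq_zero_of_eigen hs hy, dot_eq_zero_of_eigen hs' hz] at h1
  rw [hz, cross7_smul_right, dot_eq_zero_of_eigen hs hy, dot_eq_zero_of_eigen hs' hz,
    cross7_swap y z, cross7_neg_right, dotProduct_comm y z] at h2
  simp only [zero_smul, mul_zero, zero_add, sub_zero] at h1 h2
  have h3 : (2 * s) • cross7 z y = (2 * (z ⬝ᵥ y)) • F := by
    linear_combination (norm := module) h1 + h2
  have h4 : cross7 z y = (-(s / 2)) • ((2 * s) • cross7 z y) := by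
    rw [smul_smul, show -(s / 2) * (2 * s) = 1 by linear_combination -hs, one_smul]
  rw [h4, h3, smul_smul]; congr 1; ring

/-- This is the contraction identity of the SL(3) structure: the product maps Λ² of one eigenspace
to the other, which the dot product pairs with the first. -/
theorem cross7_opposite_cross7 (hs : s * s = -1) (hx : cross7 F x = s • x)
    (hy : cross7 F y = s • y) (hz : cross7 F z = (-s) • z) :
    cross7 z (cross7 x y) = (2 * (z ⬝ᵥ y)) • x - (2 * (z ⬝ᵥ x)) • y := by
  have h1 := cross7_cross7_polar z x y
  rw [cross7_eigen_opposite hs hz hy, cross7_smul_right, cross7_swap x F, hx,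
    dot_eq_zero_of_eigen_eigen hs hx hy] at h1
  have h2 : (s * s) • x = (-1 : ℂ) • x := by rw [hs]
  linear_combination (norm := module) h1 - (z ⬝ᵥ y) • h2

/-- A vector of an eigenspace `T` of `F × ·` vanishes if it is orthogonal to two vectors `x`, `y`
of `T` for the Hermitian product and to `x × y ≠ 0` for the bilinear one. -/
theorem eigen_eq_zero (hFr : star F = F) (hs : s * s = -1) (hs' : star s = -s)
    (hx : cross7 F x = s • x) (hy : cross7 F y = s • y) (hz : cross7 F z = s • z)
    (h0 : cross7 x y ≠ 0) (h1 : star x ⬝ᵥ z = 0) (h2 : star y ⬝ᵥ z = 0)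
    (h3 : cross7 x y ⬝ᵥ z = 0) : z = 0 := by
  have hstar : ∀ {v : Fin 7 → ℂ} {t : ℂ}, star t = -t → cross7 F v = t • v →
      cross7 F (star v) = (-t) • star v := by
    intro v t ht hv
    have := congrArg star hv
    rwa [star_cross7, hFr, star_smul, ht] at this
  have hs2 : (-s) * (-s) = -1 := by simpa using hs
  have hzb := hstar hs' hz
  have hw := cross7_eigen_eigen hs hx hy
  have hwb : cross7 F (star (cross7 x y)) = s • star (cross7 x y) := by
    have := hstar (t := -s) (by rw [star_neg, hs']) hw
    simpa using this
  have e1 : star z ⬝ᵥ y = 0 := by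
    have := congrArg star h2
    rwa [star_dot, star_star, star_zero, dotProduct_comm] at this
  have e2 : star z ⬝ᵥ x = 0 := by
    have := congrArg star h1
    rwa [star_dot, star_star, star_zero, dotProduct_comm] at this
  -- Two uses of the double contraction: the first kills z̄ × (x × y), and the second, multiplying
  -- by the conjugate of x × y, leaves only |x × y|² z̄.
  have k1 : cross7 (star z) (cross7 x y) = 0 := by
    rw [cross7_opposite_cross7 hs hx hy hzb, e1, e2]; simp
  have k2 := cross7_opposite_cross7 hs2 hzb hw (z := star (cross7 x y)) (by simpa using hwb)
  have e3 : star (cross7 x y) ⬝ᵥ star z = 0 := by rw [← star_dot, h3, star_zero]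
  rw [k1, cross7_zero_right, e3, mul_zero, zero_smul, sub_zero] at k2
  rcases smul_eq_zero.mp k2.symm with h | h
  · refine absurd (eq_zero_of_dot_star_self ?_) h0
    rw [dotProduct_comm]; simpa using h
  · simpa using congrArg star h

end Eigenspaces

/-! ### Calculus of the Wirtinger derivatives. -/

section Wirtinger

variable {E F G : Type*} [NormedAddCommGroup E] [NormedSpace ℂ E] [NormedAddCommGroup F]
  [NormedSpace ℂ F] [NormedAddCommGroup G] [NormedSpace ℂ G]

/-- The Wirtinger derivatives: `∂/∂z̄` for `s = i` and `∂/∂z` for `s = -i`. -/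
noncomputable def wirt (s : ℂ) (g : ℂ → E) (z : ℂ) : E :=
  (1 / 2 : ℂ) • (fderiv ℝ g z 1 + s • fderiv ℝ g z Complex.I)

theorem dbar_eq_wirt (g : ℂ → Fin 7 → ℂ) : dbar g = wirt Complex.I g := rfl

variable {s : ℂ} {z : ℂ}

theorem Filter.EventuallyEq.wirt_eq {g h : ℂ → E} (e : g =ᶠ[𝓝 z] h) :
    wirt s g z = wirt s h z := by
  rw [wirt, e.fderiv_eq, wirt]

theorem wirt_const (v : E) : wirt s (fun _ : ℂ => v) z = 0 := by
  simp [wirt]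

theorem wirt_add {g h : ℂ → E} (hg : DifferentiableAt ℝ g z) (hh : DifferentiableAt ℝ h z) :
    wirt s (fun z => g z + h z) z = wirt s g z + wirt s h z := by
  simp only [wirt, fderiv_fun_add hg hh, _root_.add_apply]; module

theorem wirt_sub {g h : ℂ → E} (hg : DifferentiableAt ℝ g z) (hh : DifferentiableAt ℝ h z) :
    wirt s (fun z => g z - h z) z = wirt s g z - wirt s h z := by
  simp only [wirt, fderiv_fun_sub hg hh, _root_.sub_apply]; module

theorem wirt_clm (L : E →L[ℂ] F) {g : ℂ → E} (hg : DifferentiableAt ℝ g z) :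
    wirt s (fun z => L (g z)) z = L (wirt s g z) := by
  have h : HasFDerivAt (fun z => L (g z)) ((L.restrictScalars ℝ).comp (fderiv ℝ g z)) z :=
    (L.restrictScalars ℝ).hasFDerivAt.comp z hg.hasFDerivAt
  simp [wirt, h.fderiv]

theorem wirt_bilin (B : E →L[ℂ] F →L[ℂ] G) {g : ℂ → E} {h : ℂ → F}
    (hg : DifferentiableAt ℝ g z) (hh : DifferentiableAt ℝ h z) :
    wirt s (fun z => B (g z) (h z)) z = B (wirt s g z) (h z) + B (g z) (wirt s h z) := by
  have h : HasFDerivAt (fun z => B (g z) (h z)) _ z :=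
    (B.bilinearRestrictScalars ℝ).hasFDerivAt_of_bilinear hg.hasFDerivAt hh.hasFDerivAt
  simp only [wirt, h.fderiv]
  simp
  module

theorem wirt_smul {g : ℂ → ℂ} {h : ℂ → E}
    (hg : DifferentiableAt ℝ g z) (hh : DifferentiableAt ℝ h z) :
    wirt s (fun z => g z • h z) z = wirt s g z • h z + g z • wirt s h z :=
  wirt_bilin (ContinuousLinearMap.lsmul ℂ ℂ) hg hh

theorem wirt_mul {g : ℂ → ℂ} {h : ℂ → ℂ}
    (hg : DifferentiableAt ℝ g z) (hh : DifferentiableAt ℝ h z) :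
    wirt s (fun z => g z * h z) z = wirt s g z * h z + g z * wirt s h z :=
  wirt_smul hg hh

theorem wirt_const_smul (c : ℂ) {h : ℂ → E} (hh : DifferentiableAt ℝ h z) :
    wirt s (fun z => c • h z) z = c • wirt s h z := by
  rw [wirt_smul (differentiableAt_const c) hh, wirt_const, zero_smul, zero_add]

theorem wirt_neg {h : ℂ → E} : wirt s (fun z => -h z) z = -wirt s h z := by
  simp only [wirt, fderiv_fun_neg, _root_.neg_apply]; module

theorem wirt_star [StarAddMonoid E] [StarModule ℂ E] [NormedStarGroup E] {g : ℂ → E} :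
    wirt s (fun z => star (g z)) z = star (wirt (star s) g z) := by
  have : fderiv ℝ (fun z => star (g z)) z =
      ((starL' ℝ : E ≃L[ℝ] E) : E →L[ℝ] E).comp (fderiv ℝ g z) :=
    (starL' ℝ : E ≃L[ℝ] E).comp_fderiv
  simp [wirt, this, star_smul]

theorem ContDiff.wirt {g : ℂ → E} (hg : ContDiff ℝ ∞ g) : ContDiff ℝ ∞ (wirt s g) := by
  have h := hg.fderiv_right (m := ∞) (by simp)
  have h1 : ∀ v : ℂ, ContDiff ℝ ∞ fun z => fderiv ℝ g z v := fun v => h.clm_apply contDiff_const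
  exact contDiff_const.smul ((h1 1).add (contDiff_const.smul (h1 Complex.I)))

theorem ContDiffAt.wirt {g : ℂ → E} (hg : ContDiffAt ℝ ∞ g z) : ContDiffAt ℝ ∞ (wirt s g) z := by
  have h := hg.fderiv_right (m := ∞) (by simp)
  have h1 : ∀ v : ℂ, ContDiffAt ℝ ∞ (fun z => fderiv ℝ g z v) z :=
    fun v => h.clm_apply contDiffAt_const
  exact contDiffAt_const.smul ((h1 1).add (contDiffAt_const.smul (h1 Complex.I)))

theorem wirt_comm {g : ℂ → E} (hg : ContDiff ℝ ∞ g) (s t : ℂ) :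
    wirt s (wirt t g) z = wirt t (wirt s g) z := by
  have h := hg.fderiv_right (m := ∞) (by simp)
  have hd : DifferentiableAt ℝ (fderiv ℝ g) z := h.contDiffAt.differentiableAt (by simp)
  have h1 : ∀ v : ℂ, HasFDerivAt (fun z => fderiv ℝ g z v)
      ((ContinuousLinearMap.apply ℝ E v).comp (fderiv ℝ (fderiv ℝ g) z)) z := fun v =>
    (ContinuousLinearMap.apply ℝ E v).hasFDerivAt.comp z hd.hasFDerivAt
  have hsym : fderiv ℝ (fderiv ℝ g) z 1 Complex.I = fderiv ℝ (fderiv ℝ g) z Complex.I 1 :=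
    (hg.contDiffAt.isSymmSndFDerivAt (by
      simp only [minSmoothness_of_isRCLikeNormedField]; exact WithTop.coe_le_coe.2 le_top)) 1 Complex.I
  have h2 : ∀ r : ℂ, HasFDerivAt (wirt r g) ((1 / 2 : ℂ) •
      ((ContinuousLinearMap.apply ℝ E (1 : ℂ)).comp (fderiv ℝ (fderiv ℝ g) z) +
        r • ((ContinuousLinearMap.apply ℝ E Complex.I).comp (fderiv ℝ (fderiv ℝ g) z)))) z := by
    intro r
    exact ((h1 1).add ((h1 Complex.I).const_smul r)).const_smul (1 / 2 : ℂ)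
  rw [wirt.eq_def s (_root_.wirt t g), (h2 t).fderiv, wirt.eq_def t (_root_.wirt s g), (h2 s).fderiv]
  simp [hsym]
  module

/-- This is dg = ∂g dz + ∂̄g dz̄, evaluated on v. -/
theorem fderiv_eq_wirt (g : ℂ → E) (z v : ℂ) :
    fderiv ℝ g z v = v • wirt (-Complex.I) g z + star v • wirt Complex.I g z := by
  have h : fderiv ℝ g z v = (v.re : ℂ) • fderiv ℝ g z 1 + (v.im : ℂ) • fderiv ℝ g z Complex.I := by
    have : v = v.re • (1 : ℂ) + v.im • Complex.I := by simp
    conv_lhs => rw [this]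
    rw [map_add, map_smul, map_smul]; rfl
  rw [h, wirt, wirt]
  have hv : v = v.re + v.im * Complex.I := (Complex.re_add_im v).symm
  have hv' : star v = v.re - v.im * Complex.I := by
    apply Complex.ext <;> simp
  rw [hv']; nth_rw 3 [hv]
  match_scalars
  · ring
  · linear_combination (v.im : ℂ) * Complex.I_sq

theorem hasDerivAt_of_wirt_eq_zero {g : ℂ → E} (hg : DifferentiableAt ℝ g z)
    (h : wirt Complex.I g z = 0) : HasDerivAt g (wirt (-Complex.I) g z) z := by
  have h1 := hg.hasFDerivAt
  rw [hasDerivAt_iff_hasFDerivAt]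
  refine hasFDerivAt_of_restrictScalars ℝ h1 ?_
  ext
  simp [fderiv_eq_wirt, h]

theorem HasDerivAt.wirt_eq {g : ℂ → E} {g' : E} (h : HasDerivAt g g' z) :
    wirt s g z = (1 / 2 * (1 + s * Complex.I)) • g' := by
  have h1 := h.hasFDerivAt.restrictScalars ℝ
  rw [wirt, h1.fderiv]
  simp
  module

theorem HasDerivAt.wirt_I_eq {g : ℂ → E} {g' : E} (h : HasDerivAt g g' z) :
    wirt Complex.I g z = 0 := by
  rw [h.wirt_eq, Complex.I_mul_I]; simp

theorem HasDerivAt.wirt_neg_I_eq {g : ℂ → E} {g' : E} (h : HasDerivAt g g' z) :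
    wirt (-Complex.I) g z = g' := by
  rw [h.wirt_eq, neg_mul, Complex.I_mul_I]; norm_num

theorem wirt_I_comp {g : ℂ → E} {φ : ℂ → ℂ} {φ' : ℂ} (hφ : HasDerivAt φ φ' z)
    (hg : DifferentiableAt ℝ g (φ z)) :
    wirt Complex.I (fun z => g (φ z)) z = star φ' • wirt Complex.I g (φ z) := by
  have h := hg.hasFDerivAt.comp z (hφ.hasFDerivAt.restrictScalars ℝ)
  have h2 : fderiv ℝ (fun z => g (φ z)) z = _ := h.fderiv
  rw [wirt, h2]
  simp [fderiv_eq_wirt g]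
  match_scalars
  · linear_combination (φ' / 2) * Complex.I_sq
  · linear_combination (-(starRingEnd ℂ φ') / 2) * Complex.I_sq

end Wirtinger

/-- The cross product as a continuous bilinear map. -/
noncomputable def crossL : (Fin 7 → ℂ) →L[ℂ] (Fin 7 → ℂ) →L[ℂ] (Fin 7 → ℂ) :=
  LinearMap.toContinuousBilinearMap (LinearMap.mk₂ ℂ cross7 cross7_add_left cross7_smul_left
    cross7_add_right cross7_smul_right)

/-- The dot product as a continuous bilinear map. -/
noncomputable def dotL : (Fin 7 → ℂ) →L[ℂ] (Fin 7 → ℂ) →L[ℂ] ℂ :=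
  LinearMap.toContinuousBilinearMap (LinearMap.mk₂ ℂ (· ⬝ᵥ ·) add_dotProduct smul_dotProduct
    dotProduct_add dotProduct_smul)

theorem crossL_apply (u v : Fin 7 → ℂ) : crossL u v = cross7 u v := rfl

theorem dotL_apply (u v : Fin 7 → ℂ) : dotL u v = u ⬝ᵥ v := rfl

section

variable {g h : ℂ → Fin 7 → ℂ} {s z : ℂ}

theorem wirt_cross7 (hg : DifferentiableAt ℝ g z) (hh : DifferentiableAt ℝ h z) :
    wirt s (fun z => cross7 (g z) (h z)) z =
      cross7 (wirt s g z) (h z) + cross7 (g z) (wirt s h z) :=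
  wirt_bilin crossL hg hh

theorem wirt_dot (hg : DifferentiableAt ℝ g z) (hh : DifferentiableAt ℝ h z) :
    wirt s (fun z => g z ⬝ᵥ h z) z = wirt s g z ⬝ᵥ h z + g z ⬝ᵥ wirt s h z :=
  wirt_bilin dotL hg hh

theorem ContDiff.cross7 {n : WithTop ℕ∞} (hg : ContDiff ℝ n g) (hh : ContDiff ℝ n h) :
    ContDiff ℝ n fun z => cross7 (g z) (h z) :=
  (crossL.bilinearRestrictScalars ℝ).isBoundedBilinearMap.contDiff.comp₂ hg hh

theorem ContDiff.dot {n : WithTop ℕ∞} (hg : ContDiff ℝ n g) (hh : ContDiff ℝ n h) :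
    ContDiff ℝ n fun z => g z ⬝ᵥ h z :=
  (dotL.bilinearRestrictScalars ℝ).isBoundedBilinearMap.contDiff.comp₂ hg hh

theorem ContDiff.star_fun {E : Type*} [NormedAddCommGroup E] [NormedSpace ℂ E] [StarAddMonoid E]
    [StarModule ℂ E] [NormedStarGroup E] {n : WithTop ℕ∞} {g : ℂ → E} (hg : ContDiff ℝ n g) :
    ContDiff ℝ n fun z => star (g z) :=
  (starL' ℝ : E ≃L[ℝ] E).contDiff.comp hg

end

/-! ### Strong unique continuation by a three circles argument. -/

section MaximumPrinciple

open Filter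

/-- With a positive second derivative the point would also be a local minimum. The function would
then be locally constant and its second derivative zero. -/
theorem IsLocalMax.second_deriv_nonpos {φ φ' : ℝ → ℝ} {φ'' x : ℝ} (hmax : IsLocalMax φ x)
    (h1 : ∀ᶠ t in 𝓝 x, HasDerivAt φ (φ' t) t) (h2 : HasDerivAt φ' φ'' x) : φ'' ≤ 0 := by
  by_contra! hpos
  have e1 : deriv φ =ᶠ[𝓝 x] φ' := h1.mono fun t ht => ht.deriv
  have e2 : deriv (deriv φ) x = φ'' := e1.deriv_eq.trans h2.deriv
  have hmin : IsLocalMin φ x := isLocalMin_of_deriv_deriv_pos (by rwa [e2]) hmax.deriv_eq_zero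
    h1.self_of_nhds.continuousAt
  have hconst : φ =ᶠ[𝓝 x] fun _ => φ x := by
    filter_upwards [hmax, hmin] with t h h' using le_antisymm h h'
  have : deriv (deriv φ) x = 0 := by
    have h3 : deriv φ =ᶠ[𝓝 x] fun _ => 0 := by
      filter_upwards [hconst.deriv] with t ht
      rw [ht, deriv_const]
    rw [h3.deriv_eq, deriv_const]
  linarith

/-- The second derivative at `0` of `log p(t) + K ((x+t)² + y²) - m log ((x+t)² + y²)` is
nonpositive at a local maximum. -/
theorem log_test_line {p p' : ℝ → ℝ} {p'' x y K m : ℝ} (hp : 0 < p 0) (hr : 0 < x ^ 2 + y ^ 2)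
    (h1 : ∀ t, HasDerivAt p (p' t) t) (h2 : HasDerivAt p' p'' 0)
    (hmax : IsLocalMax (fun t => Real.log (p t) + K * ((x + t) ^ 2 + y ^ 2) -
      m * Real.log ((x + t) ^ 2 + y ^ 2)) 0) :
    (p 0 * p'' - p' 0 ^ 2) / p 0 ^ 2 + 2 * K -
      m * (2 / (x ^ 2 + y ^ 2) - 4 * x ^ 2 / (x ^ 2 + y ^ 2) ^ 2) ≤ 0 := by
  have hpe : ∀ᶠ t in 𝓝 (0 : ℝ), 0 < p t := (h1 0).continuousAt.eventually (lt_mem_nhds hp)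
  have hre : ∀ᶠ t in 𝓝 (0 : ℝ), 0 < (x + t) ^ 2 + y ^ 2 := by
    have : ContinuousAt (fun t : ℝ => (x + t) ^ 2 + y ^ 2) 0 := by fun_prop
    exact this.eventually (lt_mem_nhds (by simpa using hr))
  have hq : ∀ t : ℝ, HasDerivAt (fun t : ℝ => (x + t) ^ 2 + y ^ 2) (2 * (x + t)) t := by
    intro t
    simpa using (((hasDerivAt_id t).const_add x).pow 2).add_const (y ^ 2)
  refine hmax.second_deriv_nonpos
    (φ' := fun t => p' t / p t + K * (2 * (x + t)) - m * (2 * (x + t) / ((x + t) ^ 2 + y ^ 2)))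
    ?_ ?_
  · filter_upwards [hpe, hre] with t ht ht'
    exact (((h1 t).log ht.ne').add ((hq t).const_mul K)).sub (((hq t).log ht'.ne').const_mul m)
  · have hl : HasDerivAt (fun t : ℝ => 2 * (x + t)) 2 0 := by
      simpa using ((hasDerivAt_id (0 : ℝ)).const_add x).const_mul 2
    have h := ((h2.div (h1 0) hp.ne').add (hl.const_mul K)).sub
      ((hl.div (hq 0) (by simpa using hr.ne')).const_mul m)
    refine h.congr_deriv ?_
    simp only [add_zero]
    field_simp
    ring

/-- Three circles: `N` cannot have a local maximum of `log N + K |z|² - m log |z|²` away from the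
origin if `Δ log N > -4 K`. -/
theorem not_isLocalMax_log {N : ℂ → ℝ} (hN : ContDiff ℝ ∞ N) {z₀ z : ℂ} {K m : ℝ}
    (hz : z ≠ z₀) (hpos : 0 < N z)
    (hΔ : -(4 * K) * N z ^ 2 < N z * (fderiv ℝ (fun w => fderiv ℝ N w 1) z 1 +
        fderiv ℝ (fun w => fderiv ℝ N w Complex.I) z Complex.I) -
      ((fderiv ℝ N z 1) ^ 2 + (fderiv ℝ N z Complex.I) ^ 2)) :
    ¬ IsLocalMax (fun w => Real.log (N w) + K * Complex.normSq (w - z₀) -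
      m * Real.log (Complex.normSq (w - z₀))) z := by
  intro hmax
  have hD : ∀ v : ℂ, ContDiff ℝ ∞ fun w => fderiv ℝ N w v := fun v =>
    (hN.fderiv_right (m := ∞) (by simp)).clm_apply contDiff_const
  have line : ∀ (v : ℂ) (t : ℝ), HasDerivAt (fun t : ℝ => z + t * v) v t := by
    intro v t
    simpa using ((Complex.ofRealCLM.hasDerivAt (x := t)).mul_const v).const_add z
  have hcomp : ∀ (v : ℂ) (M : ℂ → ℝ), ContDiff ℝ ∞ M → ∀ t : ℝ,
      HasDerivAt (fun t : ℝ => M (z + t * v)) (fderiv ℝ M (z + t * v) v) t := by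
    intro v M hM t
    exact (hM.differentiable (by simp) _).hasFDerivAt.comp_hasDerivAt t (line v t)
  have hlm : ∀ v : ℂ, IsLocalMax (fun t : ℝ => Real.log (N (z + t * v)) +
      K * Complex.normSq (z + t * v - z₀) - m * Real.log (Complex.normSq (z + t * v - z₀))) 0 := by
    intro v
    have hc : Tendsto (fun t : ℝ => z + t * v) (𝓝 0) (𝓝 z) := by
      simpa using (line v 0).continuousAt.tendsto
    have := hc.eventually hmax
    simpa [IsLocalMax, IsMaxFilter] using this
  set x := (z - z₀).re
  set y := (z - z₀).im
  have hr : 0 < x ^ 2 + y ^ 2 := by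
    have := Complex.normSq_pos.mpr (sub_ne_zero.mpr hz)
    rw [Complex.normSq_apply] at this
    nlinarith
  have n1 : ∀ t : ℝ, Complex.normSq (z + t * 1 - z₀) = (x + t) ^ 2 + y ^ 2 := by
    intro t; simp [Complex.normSq_apply, x, y]; ring
  have n2 : ∀ t : ℝ, Complex.normSq (z + t * Complex.I - z₀) = (y + t) ^ 2 + x ^ 2 := by
    intro t; simp [Complex.normSq_apply, x, y]; ring
  have t1 := log_test_line (p := fun t : ℝ => N (z + t * 1)) (by simpa using hpos) hr
    (hcomp 1 N hN) (hcomp 1 _ (hD 1) 0) (by simpa only [n1] using hlm 1)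
  have t2 := log_test_line (p := fun t : ℝ => N (z + t * Complex.I)) (by simpa using hpos)
    (by rwa [add_comm] at hr) (hcomp Complex.I N hN) (hcomp Complex.I _ (hD Complex.I) 0)
    (by simpa only [n2] using hlm Complex.I)
  simp only [Complex.ofReal_zero, zero_mul, add_zero] at t1 t2
  rw [add_comm (y ^ 2)] at t2
  -- Since log |z|² is harmonic off the origin, the terms with `m` cancel when the two directions
  -- are added. This leaves `m` arbitrary.
  have hh : (2 / (x ^ 2 + y ^ 2) - 4 * x ^ 2 / (x ^ 2 + y ^ 2) ^ 2) +
      (2 / (x ^ 2 + y ^ 2) - 4 * y ^ 2 / (x ^ 2 + y ^ 2) ^ 2) = 0 := by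
    field_simp; ring
  have hsum : (N z * (fderiv ℝ (fun w => fderiv ℝ N w 1) z 1 +
        fderiv ℝ (fun w => fderiv ℝ N w Complex.I) z Complex.I) -
      ((fderiv ℝ N z 1) ^ 2 + (fderiv ℝ N z Complex.I) ^ 2)) / N z ^ 2 + 4 * K ≤ 0 := by
    have h3 : m * (2 / (x ^ 2 + y ^ 2) - 4 * x ^ 2 / (x ^ 2 + y ^ 2) ^ 2) +
      m * (2 / (x ^ 2 + y ^ 2) - 4 * y ^ 2 / (x ^ 2 + y ^ 2) ^ 2) = 0 := by
      rw [← mul_add, hh, mul_zero]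
    have h4 := add_le_add t1 t2
    refine le_trans (le_of_eq ?_) (h4.trans_eq (add_zero 0))
    rw [show ∀ a b c d e f : ℝ, a + b - c + (d + e - f) = a + d + (b + e) - (c + f) from
      fun a b c d e f => by ring, h3, ← add_div]
    ring
  have h5 : (N z * (fderiv ℝ (fun w => fderiv ℝ N w 1) z 1 +
        fderiv ℝ (fun w => fderiv ℝ N w Complex.I) z Complex.I) -
      ((fderiv ℝ N z 1) ^ 2 + (fderiv ℝ N z Complex.I) ^ 2)) / N z ^ 2 ≤ -(4 * K) := by linarith
  rw [div_le_iff₀ (by positivity)] at h5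
  linarith

/-- Strong unique continuation: a nonnegative function with `Δ log N ≥ -C` vanishes near any point
where it vanishes to infinite order. -/
theorem eventually_eq_zero_of_flat {N : ℂ → ℝ} (hN : ContDiff ℝ ∞ N) (h0 : ∀ z, 0 ≤ N z)
    {z₀ : ℂ} {C R : ℝ} (hR : 0 < R)
    (hΔ : ∀ z ∈ Metric.closedBall z₀ R, -C * N z ^ 2 ≤
      N z * (fderiv ℝ (fun w => fderiv ℝ N w 1) z 1 +
        fderiv ℝ (fun w => fderiv ℝ N w Complex.I) z Complex.I) -
      ((fderiv ℝ N z 1) ^ 2 + (fderiv ℝ N z Complex.I) ^ 2))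
    (hflat : ∀ m : ℕ, N =O[𝓝 z₀] fun z => ‖z - z₀‖ ^ m) : N =ᶠ[𝓝 z₀] 0 := by
  -- Since Δ|z|² = 4 and 4K > C, log N + K|z - z₀|² is strictly subharmonic where N > 0.
  set K : ℝ := |C| + 1
  set P : ℂ → ℝ := fun z => N z * Real.exp (K * Complex.normSq (z - z₀)) with hP
  have hnsq : Continuous fun z : ℂ => Complex.normSq (z - z₀) :=
    Complex.continuous_normSq.comp (by fun_prop)
  have hPc : Continuous P := hN.continuous.mul (Real.continuous_exp.comp (hnsq.const_mul K))
  have hP0 : ∀ z, 0 ≤ P z := fun z => mul_nonneg (h0 z) (Real.exp_pos _).le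
  obtain ⟨zM, -, hzM⟩ := (isCompact_closedBall z₀ R).exists_isMaxOn
    ⟨z₀, Metric.mem_closedBall_self hR.le⟩ hPc.continuousOn
  set M := P zM
  have hM0 : 0 ≤ M := hP0 zM
  -- Dividing by |z - z₀|^(2m) does not affect subharmonicity of the logarithm, so a positive
  -- maximum over an annulus lies on its boundary. Flatness makes the inner circle harmless, and the
  -- outer circle gives the bound.
  have key : ∀ (m : ℕ) (z : ℂ), z ∈ Metric.closedBall z₀ R → z ≠ z₀ →
      P z / Complex.normSq (z - z₀) ^ m ≤ M / (R ^ 2) ^ m := by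
    intro m z hz hzz
    by_contra! hlt
    set Q : ℂ → ℝ := fun z => P z / Complex.normSq (z - z₀) ^ m with hQ
    have hQz : 0 < Q z := lt_of_le_of_lt (by positivity) hlt
    have hsmall : ∀ᶠ w in 𝓝 z₀, w ≠ z₀ → Q w < Q z := by
      -- One order of vanishing more than the denominator makes `Q` tend to 0 at z₀.
      obtain ⟨c, hc⟩ := (hflat (2 * m + 1)).bound
      have hlim : Tendsto (fun w : ℂ => c * ‖w - z₀‖ * Real.exp (K * Complex.normSq (w - z₀)))
          (𝓝 z₀) (𝓝 0) := by
        have : Continuous fun w : ℂ =>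
            c * ‖w - z₀‖ * Real.exp (K * Complex.normSq (w - z₀)) :=
          (continuous_const.mul (by fun_prop)).mul (Real.continuous_exp.comp (hnsq.const_mul K))
        simpa using this.tendsto z₀
      filter_upwards [hc, hlim.eventually (gt_mem_nhds hQz)] with w hw hw2 hne
      refine lt_of_le_of_lt ?_ hw2
      have hpos : 0 < ‖w - z₀‖ := norm_pos_iff.mpr (sub_ne_zero.mpr hne)
      rw [hQ, hP]
      simp only
      rw [div_le_iff₀ (by rw [Complex.normSq_eq_norm_sq]; positivity)]
      have : N w ≤ c * ‖w - z₀‖ ^ (2 * m + 1) := by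
        simpa [abs_of_nonneg (h0 w)] using hw
      calc N w * Real.exp (K * Complex.normSq (w - z₀))
          ≤ c * ‖w - z₀‖ ^ (2 * m + 1) * Real.exp (K * Complex.normSq (w - z₀)) := by gcongr
        _ = _ := by rw [Complex.normSq_eq_norm_sq]; ring
    obtain ⟨δ, hδ, hball⟩ := Metric.eventually_nhds_iff.mp hsmall
    have hzpos : 0 < dist z z₀ := dist_pos.mpr hzz
    -- The inner radius is small enough that `Q` is below `Q z` on the inner circle, and that `z`
    -- stays in the annulus.
    set ε := min (δ / 2) (dist z z₀ / 2)
    have hε : 0 < ε := lt_min (by linarith) (by linarith)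
    have hεδ : ε < δ := lt_of_le_of_lt (min_le_left _ _) (by linarith)
    have hεz : ε ≤ dist z z₀ := (min_le_right _ _).trans (by linarith)
    set A : Set ℂ := Metric.closedBall z₀ R ∩ {w | ε ≤ dist w z₀}
    have hA : IsCompact A := (isCompact_closedBall z₀ R).inter_right
      (isClosed_le continuous_const (continuous_id.dist continuous_const))
    have hne : ∀ w, ε ≤ dist w z₀ → w ≠ z₀ := fun w hw h => by
      rw [h, dist_self] at hw; linarith
    have hQc : ContinuousOn Q A := by
      refine hPc.continuousOn.div (hnsq.pow m).continuousOn fun w hw => ?_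
      exact pow_ne_zero _ (Complex.normSq_pos.mpr (sub_ne_zero.mpr (hne w hw.2))).ne'
    obtain ⟨z1, hz1A, hz1⟩ := hA.exists_isMaxOn ⟨z, hz, hεz⟩ hQc
    have hz1Q : Q z ≤ Q z1 := hz1 ⟨hz, hεz⟩
    have hz1ne := hne z1 hz1A.2
    have hlt1 : ε < dist z1 z₀ := by
      refine lt_of_le_of_ne hz1A.2 fun h => ?_
      have := hball (show dist z1 z₀ < δ by rw [← h]; exact hεδ) hz1ne
      linarith
    have hlt2 : dist z1 z₀ < R := by
      refine lt_of_le_of_ne hz1A.1 fun h => ?_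
      have : Q z1 ≤ M / (R ^ 2) ^ m := by
        simp only [hQ]
        rw [Complex.normSq_eq_norm_sq, ← dist_eq_norm, h]
        gcongr
        exact hzM hz1A.1
      linarith
    have hloc : ∀ᶠ w in 𝓝 z1, Q w ≤ Q z1 := by
      have hd : ContinuousAt (fun w => dist w z₀) z1 := by fun_prop
      filter_upwards [hd.eventually (lt_mem_nhds hlt1), hd.eventually (gt_mem_nhds hlt2)]
        with w h1 h2
      exact hz1 ⟨h2.le, h1.le⟩
    have hQ1 : 0 < Q z1 := hQz.trans_le hz1Q
    have hnsq1 : 0 < Complex.normSq (z1 - z₀) := Complex.normSq_pos.mpr (sub_ne_zero.mpr hz1ne)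
    have hN1 : 0 < N z1 := by
      refine lt_of_le_of_ne (h0 z1) fun h => ?_
      simp [hQ, hP, ← h] at hQ1
    refine not_isLocalMax_log hN (K := K) (m := m) hz1ne hN1 ?_ ?_
    · refine lt_of_lt_of_le ?_ (hΔ z1 hlt2.le)
      have : C < 4 * K := by have := le_abs_self C; have := abs_nonneg C; simp only [K]; linarith
      have h2 : 0 < N z1 ^ 2 := by positivity
      nlinarith
    · have hlog : ∀ w, 0 < N w → 0 < Complex.normSq (w - z₀) → Real.log (Q w) =
          Real.log (N w) + K * Complex.normSq (w - z₀) -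
            m * Real.log (Complex.normSq (w - z₀)) := by
        intro w h1 h2
        simp only [hQ, hP]
        rw [Real.log_div (by positivity) (by positivity), Real.log_mul h1.ne' (Real.exp_pos _).ne',
          Real.log_exp, Real.log_pow]
      have hNe : ∀ᶠ w in 𝓝 z1, 0 < N w := hN.continuous.continuousAt.eventually (lt_mem_nhds hN1)
      have hne' : ∀ᶠ w in 𝓝 z1, 0 < Complex.normSq (w - z₀) :=
        hnsq.continuousAt.eventually (lt_mem_nhds hnsq1)
      filter_upwards [hloc, hNe, hne'] with w h1 h2 h3
      rw [← hlog w h2 h3, ← hlog z1 hN1 hnsq1]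
      refine Real.log_le_log ?_ h1
      simp only [hQ, hP]; positivity
  filter_upwards [Metric.ball_mem_nhds z₀ hR] with z hz
  have hzR : dist z z₀ < R := hz
  have hP1 : P z ≤ 0 := by
    by_cases hzz : z = z₀
    · obtain ⟨c, hc⟩ := (hflat 1).bound
      have := hc.self_of_nhds
      simp at this
      simp [hP, hzz, this]
    have hnz : 0 < Complex.normSq (z - z₀) := Complex.normSq_pos.mpr (sub_ne_zero.mpr hzz)
    -- The bound `key` holds for every `m`, and the ratio is less than 1 inside the disc, so letting
    -- `m` tend to infinity forces `P z ≤ 0`.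
    have h1 : ∀ m : ℕ, P z ≤ M * (Complex.normSq (z - z₀) / R ^ 2) ^ m := by
      intro m
      have := key m z hzR.le hzz
      rw [div_le_iff₀ (by positivity)] at this
      rw [div_pow]
      calc P z ≤ _ := this
        _ = _ := by ring
    have hlt : Complex.normSq (z - z₀) / R ^ 2 < 1 := by
      rw [div_lt_one (by positivity), Complex.normSq_eq_norm_sq, ← dist_eq_norm]
      gcongr
    have := (tendsto_pow_atTop_nhds_zero_of_lt_one (by positivity) hlt).const_mul M
    rw [mul_zero] at this
    exact ge_of_tendsto' this h1
  have : N z * Real.exp (K * Complex.normSq (z - z₀)) ≤ 0 := hP1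
  have h2 := Real.exp_pos (K * Complex.normSq (z - z₀))
  exact le_antisymm (by by_contra! h; nlinarith [mul_pos h h2]) (h0 z)

end MaximumPrinciple

/-! ### Order of vanishing of smooth sections. -/

section Vanishing

open Filter Asymptotics

variable {E F G : Type*} [NormedAddCommGroup E] [NormedSpace ℂ E] [NormedAddCommGroup F]
  [NormedSpace ℂ F] [NormedAddCommGroup G] [NormedSpace ℂ G]

/-- All iterated Wirtinger derivatives of `g` of order less than `n` vanish at `z₀`. -/
def Vanishes (z₀ : ℂ) : ℕ → (ℂ → E) → Prop
  | 0, _ => True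
  | n + 1, g => g z₀ = 0 ∧ Vanishes z₀ n (wirt Complex.I g) ∧ Vanishes z₀ n (wirt (-Complex.I) g)

variable {z₀ : ℂ}

theorem Vanishes.of_succ {n : ℕ} {g : ℂ → E} (h : Vanishes z₀ (n + 1) g) : Vanishes z₀ n g := by
  induction n generalizing g with
  | zero => trivial
  | succ n ih => exact ⟨h.1, ih h.2.1, ih h.2.2⟩

theorem Vanishes.add {n : ℕ} {g h : ℂ → E} (hg : ContDiff ℝ ∞ g) (hh : ContDiff ℝ ∞ h)
    (vg : Vanishes z₀ n g) (vh : Vanishes z₀ n h) : Vanishes z₀ n (fun z => g z + h z) := by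
  induction n generalizing g h with
  | zero => trivial
  | succ n ih =>
    have e : ∀ s, wirt s (fun z => g z + h z) = fun z => wirt s g z + wirt s h z := fun s =>
      funext fun z => wirt_add (hg.differentiable (by simp) z) (hh.differentiable (by simp) z)
    refine ⟨by simp [vg.1, vh.1], ?_, ?_⟩
    · rw [e]; exact ih hg.wirt hh.wirt vg.2.1 vh.2.1
    · rw [e]; exact ih hg.wirt hh.wirt vg.2.2 vh.2.2

theorem ContDiff.bilinC (B : E →L[ℂ] F →L[ℂ] G) {g : ℂ → E} {h : ℂ → F} (hg : ContDiff ℝ ∞ g)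
    (hh : ContDiff ℝ ∞ h) : ContDiff ℝ ∞ fun z => B (g z) (h z) :=
  (B.bilinearRestrictScalars ℝ).isBoundedBilinearMap.contDiff.comp₂ hg hh

/-- Smooth coefficients do not lower the order of vanishing. An equation ∂̄g = (smooth)·g thus gives
∂̄g the order of vanishing of g, as `eq_zero_or_lower_bound` requires. -/
theorem Vanishes.bilin (B : E →L[ℂ] F →L[ℂ] G) {n : ℕ} {g : ℂ → E} {h : ℂ → F}
    (hg : ContDiff ℝ ∞ g) (hh : ContDiff ℝ ∞ h) (vh : Vanishes z₀ n h) :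
    Vanishes z₀ n (fun z => B (g z) (h z)) := by
  induction n generalizing g h with
  | zero => trivial
  | succ n ih =>
    have e : ∀ s, wirt s (fun z => B (g z) (h z)) =
        fun z => B (wirt s g z) (h z) + B (g z) (wirt s h z) := fun s =>
      funext fun z => wirt_bilin B (hg.differentiable (by simp) z) (hh.differentiable (by simp) z)
    refine ⟨by simp [vh.1], ?_, ?_⟩
    · rw [e]
      exact (ih hg.wirt hh vh.of_succ).add (hg.wirt.bilinC B hh) (hg.bilinC B hh.wirt)
        (ih hg hh.wirt vh.2.1)
    · rw [e]
      exact (ih hg.wirt hh vh.of_succ).add (hg.wirt.bilinC B hh) (hg.bilinC B hh.wirt)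
        (ih hg hh.wirt vh.2.2)

theorem isClosed_vanishes {n : ℕ} {g : ℂ → E} (hg : ContDiff ℝ ∞ g) :
    IsClosed {z | Vanishes z n g} := by
  induction n generalizing g with
  | zero => simp [Vanishes]
  | succ n ih =>
    exact (isClosed_singleton.preimage hg.continuous).inter ((ih hg.wirt).inter (ih hg.wirt))

theorem vanishes_of_eventuallyEq_zero {n : ℕ} {g : ℂ → E} (h : g =ᶠ[𝓝 z₀] 0) :
    Vanishes z₀ n g := by
  induction n generalizing g with
  | zero => trivial
  | succ n ih =>
    have e : ∀ s, wirt s g =ᶠ[𝓝 z₀] 0 := fun s => by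
      filter_upwards [h.eventuallyEq_nhds] with z hz
      rw [hz.wirt_eq]; exact wirt_const 0
    exact ⟨h.self_of_nhds, ih (e _), ih (e _)⟩

theorem isBigO_of_fderiv_isBigO {g : ℂ → E} (hg : Differentiable ℝ g) {n : ℕ} (h0 : g z₀ = 0)
    (h : fderiv ℝ g =O[𝓝 z₀] fun z => ‖z - z₀‖ ^ n) : g =O[𝓝 z₀] fun z => ‖z - z₀‖ ^ (n + 1) := by
  obtain ⟨c, hc⟩ := h.bound
  obtain ⟨δ, hδ, hball⟩ := Metric.eventually_nhds_iff.mp hc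
  refine IsBigO.of_bound c ?_
  filter_upwards [Metric.ball_mem_nhds z₀ hδ] with z hz
  have hz' : dist z z₀ < δ := hz
  have hbound : ∀ w ∈ Metric.closedBall z₀ (dist z z₀), ‖fderiv ℝ g w‖ ≤ c * ‖z - z₀‖ ^ n := by
    intro w hw
    have hw' : dist w z₀ ≤ dist z z₀ := hw
    have h1 := hball (lt_of_le_of_lt hw' hz')
    -- The constant from the asymptotic bound carries no sign. If it is negative, both norms bounded
    -- by it must be zero.
    by_cases hc0 : 0 ≤ c
    · refine h1.trans ?_
      rw [norm_pow, norm_norm, ← dist_eq_norm, ← dist_eq_norm]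
      gcongr
    · push Not at hc0
      have h2 := hball (lt_of_le_of_lt le_rfl hz')
      have : (0 : ℝ) ≤ c * ‖‖z - z₀‖ ^ n‖ := (norm_nonneg _).trans h2
      have h3 : (0 : ℝ) ≤ c * ‖‖w - z₀‖ ^ n‖ := (norm_nonneg _).trans h1
      have h4 : c * ‖‖w - z₀‖ ^ n‖ ≤ 0 := mul_nonpos_of_nonpos_of_nonneg hc0.le (norm_nonneg _)
      rw [norm_pow, norm_norm] at this
      linarith
  have := (convex_closedBall z₀ (dist z z₀)).norm_image_sub_le_of_norm_fderiv_le
    (fun w _ => hg w) hbound (Metric.mem_closedBall_self dist_nonneg)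
    (Metric.mem_closedBall.2 le_rfl)
  rw [h0, sub_zero] at this
  rw [norm_pow, norm_norm, pow_succ, ← mul_assoc]
  exact this

theorem isBigO_fderiv {g : ℂ → E} {r : ℂ → ℝ} (h1 : wirt Complex.I g =O[𝓝 z₀] r)
    (h2 : wirt (-Complex.I) g =O[𝓝 z₀] r) : fderiv ℝ g =O[𝓝 z₀] r := by
  refine IsBigO.trans ?_ (h2.norm_left.add h1.norm_left)
  refine IsBigO.of_bound 1 (Eventually.of_forall fun z => ?_)
  refine ContinuousLinearMap.opNorm_le_bound _ (by positivity) fun v => ?_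
  rw [fderiv_eq_wirt]
  refine (norm_add_le _ _).trans ?_
  rw [norm_smul, norm_smul, norm_star, Real.norm_of_nonneg (by positivity)]
  linarith

theorem Vanishes.isBigO {n : ℕ} {g : ℂ → E} (hg : ContDiff ℝ ∞ g) (h : Vanishes z₀ n g) :
    g =O[𝓝 z₀] fun z => ‖z - z₀‖ ^ n := by
  induction n generalizing g with
  | zero => simpa using hg.continuous.continuousAt.isBigO_one ℝ
  | succ n ih =>
    exact isBigO_of_fderiv_isBigO (hg.differentiable (by simp)) h.1
      (isBigO_fderiv (ih hg.wirt h.2.1) (ih hg.wirt h.2.2))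

/-- The leading Taylor term is holomorphic if `∂g/∂z̄` vanishes to the same order as `g`. -/
theorem exists_leading_term {n : ℕ} {g : ℂ → E} (hg : ContDiff ℝ ∞ g) (h : Vanishes z₀ n g)
    (hbar : Vanishes z₀ n (wirt Complex.I g)) :
    ∃ w : E, (fun z => g z - (z - z₀) ^ n • w) =O[𝓝 z₀] (fun z => ‖z - z₀‖ ^ (n + 1)) ∧
      (w = 0 → Vanishes z₀ (n + 1) g) := by
  induction n generalizing g with
  | zero =>
    refine ⟨g z₀, ?_, fun h0 => ⟨h0, trivial, trivial⟩⟩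
    have := (hg.differentiable (by simp) z₀).isBigO_sub
    simpa using this.norm_right
  | succ n ih =>
    have hcomm : wirt Complex.I (wirt (-Complex.I) g) = wirt (-Complex.I) (wirt Complex.I g) :=
      funext fun z => wirt_comm hg _ _
    -- Induct on ∂g: its ∂̄-derivative is ∂∂̄g, which vanishes to order n. Integrating the leading
    -- term (z - z₀)ⁿ w gives the factor 1/(n+1).
    obtain ⟨w, hw, hw0⟩ := ih (g := wirt (-Complex.I) g) hg.wirt h.2.2 (by
      rw [hcomm]; exact hbar.2.2)
    refine ⟨(1 / (n + 1 : ℂ)) • w, ?_, fun h0 => ⟨h.1, hbar, hw0 ?_⟩⟩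
    · have hpow : ∀ z, HasDerivAt (fun z : ℂ => (z - z₀) ^ (n + 1) • (1 / (n + 1 : ℂ)) • w)
          ((z - z₀) ^ n • w) z := by
        intro z
        have h1 : HasDerivAt (fun z : ℂ => (z - z₀) ^ (n + 1)) ((n + 1 : ℂ) * (z - z₀) ^ n) z := by
          simpa using ((hasDerivAt_id z).sub_const z₀).fun_pow (n + 1)
        refine (h1.smul_const ((1 / (n + 1 : ℂ)) • w)).congr_deriv ?_
        rw [smul_smul]; congr 1
        have : (n + 1 : ℂ) ≠ 0 := Nat.cast_add_one_ne_zero n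
        field_simp
      have hd : ∀ z, DifferentiableAt ℝ
          (fun z : ℂ => (z - z₀) ^ (n + 1) • (1 / (n + 1 : ℂ)) • w) z := fun z =>
        (hpow z).differentiableAt.restrictScalars ℝ
      have hgd := hg.differentiable (by simp)
      refine isBigO_of_fderiv_isBigO (fun z => (hgd z).sub (hd z)) (by simp [h.1])
        (isBigO_fderiv ?_ ?_)
      · refine (Vanishes.isBigO hg.wirt hbar).congr_left fun z => ?_
        have e := wirt_sub (s := Complex.I) (hgd z) (hd z)
        rw [(hpow z).wirt_I_eq, sub_zero] at e
        exact e.symm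
      · refine hw.congr_left fun z => ?_
        have e := wirt_sub (s := -Complex.I) (hgd z) (hd z)
        rw [(hpow z).wirt_neg_I_eq] at e
        exact e.symm
    · refine (smul_eq_zero.mp h0).resolve_left ?_
      have : (n + 1 : ℂ) ≠ 0 := Nat.cast_add_one_ne_zero n
      simpa using this

/-- A function of finite order of vanishing has a lower bound by a power of the distance. -/
theorem exists_lower_bound {n : ℕ} {g : ℂ → E} {w : E} (hw : w ≠ 0)
    (h : (fun z => g z - (z - z₀) ^ n • w) =O[𝓝 z₀] (fun z => ‖z - z₀‖ ^ (n + 1))) :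
    ∀ᶠ z in 𝓝 z₀, ‖w‖ / 2 * ‖z - z₀‖ ^ n ≤ ‖g z‖ := by
  obtain ⟨c, hc⟩ := h.bound
  have hlim : Tendsto (fun z : ℂ => c * ‖z - z₀‖) (𝓝 z₀) (𝓝 0) := by
    have : Continuous fun z : ℂ => c * ‖z - z₀‖ := by fun_prop
    simpa using this.tendsto z₀
  have hwp : 0 < ‖w‖ / 2 := by positivity
  filter_upwards [hc, hlim.eventually (gt_mem_nhds hwp)] with z h1 h2
  have h3 : ‖(z - z₀) ^ n • w‖ ≤ ‖g z‖ + ‖g z - (z - z₀) ^ n • w‖ := by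
    have := norm_sub_le (g z) (g z - (z - z₀) ^ n • w)
    simpa using this
  rw [norm_smul, norm_pow] at h3
  rw [norm_pow, norm_norm, pow_succ] at h1
  have h4 : c * (‖z - z₀‖ ^ n * ‖z - z₀‖) ≤ ‖w‖ / 2 * ‖z - z₀‖ ^ n := by
    calc c * (‖z - z₀‖ ^ n * ‖z - z₀‖) = c * ‖z - z₀‖ * ‖z - z₀‖ ^ n := by ring
      _ ≤ _ := by gcongr
  linarith

/-- Dichotomy for sections of bundles with a holomorphic structure: if `∂g/∂z̄` vanishes wherever
`g` does, to the same order, and `g` has strong unique continuation, then either `g = 0` or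
all zeros of `g` have finite order. -/
theorem eq_zero_or_lower_bound {g : ℂ → E} (hg : ContDiff ℝ ∞ g)
    (hbar : ∀ z n, Vanishes z n g → Vanishes z n (wirt Complex.I g))
    (hflat : ∀ z, (∀ n, Vanishes z n g) → g =ᶠ[𝓝 z] 0) :
    (∀ z, g z = 0) ∨ ∀ z₀, ∃ n : ℕ, ∃ c > 0, ∀ᶠ z in 𝓝 z₀, c * ‖z - z₀‖ ^ n ≤ ‖g z‖ := by
  -- The set of flat points is closed as an intersection of zero sets and open by unique
  -- continuation. Since ℂ is connected, it is empty or everything.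
  have hS : IsClopen {z | ∀ n, Vanishes z n g} := by
    refine ⟨?_, ?_⟩
    · simp only [Set.ofPred_forall]
      exact isClosed_iInter fun n => isClosed_vanishes hg
    · rw [isOpen_iff_mem_nhds]
      intro z hz
      filter_upwards [(hflat z hz).eventuallyEq_nhds] with w hw n
      exact vanishes_of_eventuallyEq_zero hw
  rcases isClopen_iff.mp hS with h | h
  · right
    intro z₀
    have h1 : ¬ ∀ n, Vanishes z₀ n g := fun h2 => by
      have : z₀ ∈ {z | ∀ n, Vanishes z n g} := h2
      rw [h] at this; exact this
    push Not at h1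
    classical
    -- Vanishing to order 0 is no condition, so the first failing index is n + 1 and n is the exact
    -- order of the zero.
    have hpos : Nat.find h1 ≠ 0 := fun h0 => by
      have := Nat.find_spec h1
      rw [h0] at this; exact this trivial
    obtain ⟨n, hn⟩ := Nat.exists_eq_succ_of_ne_zero hpos
    have hvan : Vanishes z₀ n g := by
      by_contra h2
      have := Nat.find_min' h1 h2
      omega
    have hnot : ¬ Vanishes z₀ (n + 1) g := by
      have := Nat.find_spec h1
      rwa [hn] at this
    obtain ⟨w, hw, hw0⟩ := exists_leading_term hg hvan (hbar z₀ n hvan)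
    have hwne : w ≠ 0 := fun h2 => hnot (hw0 h2)
    exact ⟨n, ‖w‖ / 2, by positivity, exists_lower_bound hwne hw⟩
  · left
    intro z
    have : z ∈ {z | ∀ n, Vanishes z n g} := by rw [h]; trivial
    exact (this 1).1

end Vanishing

/-! ### Unique continuation in terms of ∂∂̄ log |g|². -/

section Flatness

open Filter Asymptotics

theorem wirt_ofReal_eq {N : ℂ → ℝ} (hN : ContDiff ℝ ∞ N) (s z : ℂ) :
    wirt s (fun w => (N w : ℂ)) z =
      1 / 2 * ((fderiv ℝ N z 1 : ℂ) + s * (fderiv ℝ N z Complex.I : ℂ)) := by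
  have h : HasFDerivAt (fun w => (N w : ℂ)) (Complex.ofRealCLM.comp (fderiv ℝ N z)) z :=
    Complex.ofRealCLM.hasFDerivAt.comp z (hN.differentiable (by simp) z).hasFDerivAt
  rw [wirt, h.fderiv]
  simp

theorem wirt_wirt_ofReal_re {N : ℂ → ℝ} (hN : ContDiff ℝ ∞ N) (z : ℂ) :
    (wirt Complex.I (wirt (-Complex.I) (fun w => (N w : ℂ))) z).re =
      1 / 4 * (fderiv ℝ (fun w => fderiv ℝ N w 1) z 1 +
        fderiv ℝ (fun w => fderiv ℝ N w Complex.I) z Complex.I) := by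
  have hD : ∀ v : ℂ, ContDiff ℝ ∞ fun w => fderiv ℝ N w v := fun v =>
    (hN.fderiv_right (m := ∞) (by simp)).clm_apply contDiff_const
  have hDC : ∀ v : ℂ, DifferentiableAt ℝ (fun w => (fderiv ℝ N w v : ℂ)) z := fun v =>
    Complex.ofRealCLM.differentiableAt.comp z ((hD v).differentiable (by simp) z)
  have e : wirt (-Complex.I) (fun w => (N w : ℂ)) = fun w =>
      (1 / 2 : ℂ) • ((fderiv ℝ N w 1 : ℂ) + (-Complex.I) • (fderiv ℝ N w Complex.I : ℂ)) :=
    funext fun w => wirt_ofReal_eq hN _ w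
  have hI : DifferentiableAt ℝ (fun w => (-Complex.I) • (fderiv ℝ N w Complex.I : ℂ)) z :=
    (hDC Complex.I).const_smul (-Complex.I)
  have hsum : DifferentiableAt ℝ (fun w => (fderiv ℝ N w 1 : ℂ) +
      (-Complex.I) • (fderiv ℝ N w Complex.I : ℂ)) z := (hDC 1).add hI
  rw [e, wirt_const_smul _ hsum, wirt_add (hDC 1) hI, wirt_const_smul _ (hDC Complex.I),
    wirt_ofReal_eq (hD 1), wirt_ofReal_eq (hD Complex.I)]
  simp
  ring

theorem star_dot_self_eq_ofReal {ι : Type*} [Fintype ι] (x : ι → ℂ) :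
    star x ⬝ᵥ x = ((∑ i, ‖x i‖ ^ 2 : ℝ) : ℂ) := by
  simp [dotProduct, ← Complex.normSq_eq_norm_sq, Complex.normSq_eq_conj_mul_self]

/-- If `∂∂̄ log |g|² ≥ -c` then `g` vanishes near any point where it is flat. -/
theorem eventually_eq_zero_of_vanishes {g : ℂ → Fin 7 → ℂ} (hg : ContDiff ℝ ∞ g) {n : ℂ → ℂ}
    (hn : n = fun z => star (g z) ⬝ᵥ g z) {c : ℂ → ℝ} (hc : Continuous c)
    (h : ∀ z, -(c z) * (n z).re ^ 2 ≤
      (n z * wirt Complex.I (wirt (-Complex.I) n) z -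
        wirt Complex.I n z * wirt (-Complex.I) n z).re)
    {z₀ : ℂ} (hflat : ∀ k, Vanishes z₀ k g) : g =ᶠ[𝓝 z₀] 0 := by
  set N : ℂ → ℝ := fun z => ∑ i, ‖g z i‖ ^ 2
  have hnN : n = fun z => (N z : ℂ) := by
    rw [hn]; exact funext fun z => star_dot_self_eq_ofReal _
  have hns : ContDiff ℝ ∞ n := by rw [hn]; exact hg.star_fun.dot hg
  have hN : ContDiff ℝ ∞ N := by
    have : N = fun z => Complex.reCLM (n z) := by rw [hnN]; simp
    rw [this]; exact Complex.reCLM.contDiff.comp hns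
  obtain ⟨zM, -, hzM⟩ := (isCompact_closedBall z₀ (1 : ℝ)).exists_isMaxOn
    ⟨z₀, Metric.mem_closedBall_self zero_le_one⟩ hc.continuousOn
  -- The factor 4 comes from Δ = 4∂∂̄, and `c zM` is the maximum of `c` over the closed unit disc
  -- around z₀.
  have hz := eventually_eq_zero_of_flat hN (fun z => by positivity) (C := 4 * c zM)
    (z₀ := z₀) one_pos (fun z hz => ?_) (fun m => ?_)
  · filter_upwards [hz] with z hz
    have h1 : ∑ i, ‖g z i‖ ^ 2 = 0 := hz
    rw [Finset.sum_eq_zero_iff_of_nonneg fun i _ => by positivity] at h1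
    funext i
    simpa using h1 i (Finset.mem_univ i)
  · have h1 := h z
    have h2 : c z ≤ c zM := hzM hz
    rw [Complex.sub_re, hnN, Complex.re_ofReal_mul, wirt_wirt_ofReal_re hN, wirt_ofReal_eq hN,
      wirt_ofReal_eq hN] at h1
    have h3 : (1 / 2 * ((fderiv ℝ N z 1 : ℂ) + Complex.I * (fderiv ℝ N z Complex.I : ℂ)) *
        (1 / 2 * ((fderiv ℝ N z 1 : ℂ) + -Complex.I * (fderiv ℝ N z Complex.I : ℂ)))).re =
        1 / 4 * ((fderiv ℝ N z 1) ^ 2 + (fderiv ℝ N z Complex.I) ^ 2) := by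
      simp; ring
    rw [h3, Complex.ofReal_re] at h1
    have h4 : c z * N z ^ 2 ≤ c zM * N z ^ 2 := by gcongr
    linarith
  · have h1 : Vanishes z₀ m fun z => dotL (star (g z)) (g z) :=
      (hflat m).bilin dotL hg.star_fun hg
    have h2 : n =O[𝓝 z₀] fun z => ‖z - z₀‖ ^ m := by
      rw [hn]; exact h1.isBigO (hg.star_fun.dot hg)
    refine (isBigO_norm_left.mp ?_)
    refine h2.norm_left.congr_left fun z => ?_
    rw [hnN]; simp

theorem re_cauchy_schwarz (x y : Fin 7 → ℂ) :
    ((star x ⬝ᵥ y) * (star y ⬝ᵥ x)).re ≤ ((star x ⬝ᵥ x) * (star y ⬝ᵥ y)).re := by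
  have h : ∀ u v : Fin 7 → ℂ, star u ⬝ᵥ v = inner ℂ (WithLp.toLp 2 u) (WithLp.toLp 2 v) := by
    intro u v
    rw [EuclideanSpace.inner_toLp_toLp, dotProduct_comm]
  rw [h, h, h, h]
  have := norm_inner_le_norm (𝕜 := ℂ) (WithLp.toLp 2 x) (WithLp.toLp 2 y)
  rw [← inner_conj_symm (WithLp.toLp 2 y), Complex.mul_conj, inner_self_eq_norm_sq_to_K,
    inner_self_eq_norm_sq_to_K, Complex.normSq_eq_norm_sq]
  have h2 : ∀ r t : ℝ, ((r : ℂ) ^ 2 * (t : ℂ) ^ 2).re = r ^ 2 * t ^ 2 := by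
    intro r t; norm_cast
  rw [Complex.ofReal_re]
  refine le_trans ?_ (h2 _ _).ge
  rw [← mul_pow]
  exact pow_le_pow_left₀ (norm_nonneg _) this 2

end Flatness

/-- A complexified almost complex curve in `S⁶`, in a local coordinate. -/
structure IsAlmostComplexLift (F : ℂ → Fin 7 → ℂ) : Prop where
  smooth : ContDiff ℝ ∞ F
  real : ∀ z, star (F z) = F z
  unit : ∀ z, F z ⬝ᵥ F z = 1
  cross : ∀ z, cross7 (F z) (wirt Complex.I F z) = (-Complex.I) • wirt Complex.I F z

/-! ### Structure equations of an almost complex curve. -/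

namespace AC

open Complex

variable (F : ℂ → Fin 7 → ℂ)

/-- `∂F/∂z̄`. -/
noncomputable def a : ℂ → Fin 7 → ℂ := wirt I F

/-- `∂²F/∂z̄²`. -/
noncomputable def b : ℂ → Fin 7 → ℂ := wirt I (a F)

/-- `∂³F/∂z̄³`. -/
noncomputable def c : ℂ → Fin 7 → ℂ := wirt I (b F)

/-- The energy density `|∂F/∂z̄|²`. -/
noncomputable def e (z : ℂ) : ℂ := star (a F z) ⬝ᵥ a F z

/-- The Hermitian product of the first two derivatives. -/
noncomputable def s (z : ℂ) : ℂ := star (a F z) ⬝ᵥ b F z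

/-- The section `a × b` which spans the directrix curve. -/
noncomputable def h (z : ℂ) : Fin 7 → ℂ := cross7 (a F z) (b F z)

/-- `e` times the component of `b` which is orthogonal to `a`. -/
noncomputable def k (z : ℂ) : Fin 7 → ℂ := e F z • b F z - s F z • a F z

/-- The squared norm of `h`. -/
noncomputable def n (z : ℂ) : ℂ := star (h F z) ⬝ᵥ h F z

end AC

namespace IsAlmostComplexLift

open Complex AC

variable {F : ℂ → Fin 7 → ℂ} (hF : IsAlmostComplexLift F)

theorem negI_sq : (-I) * (-I) = (-1 : ℂ) := by simp

theorem star_negI : star (-I) = -(-I) := by simp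

theorem star_dot_star_swap (x y : Fin 7 → ℂ) : star (star x ⬝ᵥ y) = star y ⬝ᵥ x := by
  rw [star_dot, star_star, dotProduct_comm]

include hF

theorem smooth_a : ContDiff ℝ ∞ (a F) := hF.smooth.wirt

theorem smooth_b : ContDiff ℝ ∞ (b F) := hF.smooth_a.wirt

theorem smooth_c : ContDiff ℝ ∞ (c F) := hF.smooth_b.wirt

theorem smooth_e : ContDiff ℝ ∞ (e F) := hF.smooth_a.star_fun.dot hF.smooth_a

theorem smooth_s : ContDiff ℝ ∞ (s F) := hF.smooth_a.star_fun.dot hF.smooth_b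

theorem smooth_h : ContDiff ℝ ∞ (h F) := hF.smooth_a.cross7 hF.smooth_b

theorem smooth_k : ContDiff ℝ ∞ (k F) :=
  (hF.smooth_e.smul hF.smooth_b).sub (hF.smooth_s.smul hF.smooth_a)

theorem smooth_n : ContDiff ℝ ∞ (n F) := hF.smooth_h.star_fun.dot hF.smooth_h

theorem diff_F (z : ℂ) : DifferentiableAt ℝ F z := hF.smooth.differentiable (by simp) z

theorem diff_a (z : ℂ) : DifferentiableAt ℝ (a F) z := hF.smooth_a.differentiable (by simp) z

theorem diff_b (z : ℂ) : DifferentiableAt ℝ (b F) z := hF.smooth_b.differentiable (by simp) z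

theorem diff_c (z : ℂ) : DifferentiableAt ℝ (c F) z := hF.smooth_c.differentiable (by simp) z

theorem diff_e (z : ℂ) : DifferentiableAt ℝ (e F) z := hF.smooth_e.differentiable (by simp) z

theorem diff_s (z : ℂ) : DifferentiableAt ℝ (s F) z := hF.smooth_s.differentiable (by simp) z

theorem diff_h (z : ℂ) : DifferentiableAt ℝ (h F) z := hF.smooth_h.differentiable (by simp) z

theorem diff_k (z : ℂ) : DifferentiableAt ℝ (k F) z := hF.smooth_k.differentiable (by simp) z

theorem diff_n (z : ℂ) : DifferentiableAt ℝ (n F) z := hF.smooth_n.differentiable (by simp) z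

theorem diff_star_a (z : ℂ) : DifferentiableAt ℝ (fun z => star (a F z)) z :=
  hF.smooth_a.star_fun.differentiable (by simp) z

theorem diff_star_h (z : ℂ) : DifferentiableAt ℝ (fun z => star (h F z)) z :=
  hF.smooth_h.star_fun.differentiable (by simp) z

omit hF in
theorem star_e (z : ℂ) : star (e F z) = e F z := star_dot_star_swap _ _

omit hF in
theorem star_n (z : ℂ) : star (n F z) = n F z := star_dot_star_swap _ _

omit hF in
theorem star_s (z : ℂ) : star (s F z) = star (b F z) ⬝ᵥ a F z := star_dot_star_swap _ _

/-! #### Pointwise relations -/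

theorem F_a (z : ℂ) : cross7 (F z) (a F z) = (-I) • a F z := hF.cross z

theorem F_b (z : ℂ) : cross7 (F z) (b F z) = (-I) • b F z := by
  have h1 := wirt_cross7 (s := I) (hF.diff_F z) (hF.diff_a z)
  rw [show (fun z => cross7 (F z) (a F z)) = fun z => (-I) • a F z from funext hF.F_a,
    wirt_const_smul _ (hF.diff_a z)] at h1
  change (-I) • b F z = cross7 (a F z) (a F z) + cross7 (F z) (b F z) at h1
  rw [cross7_self, zero_add] at h1
  exact h1.symm

/-- The third derivative is the first that can leave the -i eigenspace: differentiating F × b = -i b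
produces the term a × b = h. -/
theorem F_c (z : ℂ) : cross7 (F z) (c F z) = (-I) • c F z - h F z := by
  have h1 := wirt_cross7 (s := I) (hF.diff_F z) (hF.diff_b z)
  rw [show (fun z => cross7 (F z) (b F z)) = fun z => (-I) • b F z from funext hF.F_b,
    wirt_const_smul _ (hF.diff_b z)] at h1
  change (-I) • c F z = h F z + cross7 (F z) (c F z) at h1
  rw [h1]; abel

theorem F_h (z : ℂ) : cross7 (F z) (h F z) = I • h F z := by
  have := cross7_eigen_eigen negI_sq (hF.F_a z) (hF.F_b z)
  rwa [neg_neg] at this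

theorem F_star {z : ℂ} {x : Fin 7 → ℂ} {t : ℂ} (hx : cross7 (F z) x = t • x) :
    cross7 (F z) (star x) = star t • star x := by
  have := congrArg star hx
  rwa [star_cross7, hF.real, star_smul] at this

theorem F_star_a (z : ℂ) : cross7 (F z) (star (a F z)) = I • star (a F z) := by
  simpa using hF.F_star (hF.F_a z)

theorem F_star_b (z : ℂ) : cross7 (F z) (star (b F z)) = I • star (b F z) := by
  simpa using hF.F_star (hF.F_b z)

theorem F_star_h (z : ℂ) : cross7 (F z) (star (h F z)) = (-I) • star (h F z) := by
  simpa using hF.F_star (hF.F_h z)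

theorem F_k (z : ℂ) : cross7 (F z) (k F z) = (-I) • k F z := by
  rw [k, cross7_sub_right, cross7_smul_right, cross7_smul_right, hF.F_a, hF.F_b]; module

theorem dot_F_a (z : ℂ) : F z ⬝ᵥ a F z = 0 := dot_eq_zero_of_eigen negI_sq (hF.F_a z)

theorem dot_F_star_a (z : ℂ) : F z ⬝ᵥ star (a F z) = 0 :=
  dot_eq_zero_of_eigen I_mul_I (hF.F_star_a z)

theorem dot_a_a (z : ℂ) : a F z ⬝ᵥ a F z = 0 :=
  dot_eq_zero_of_eigen_eigen negI_sq (hF.F_a z) (hF.F_a z)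

theorem dot_a_b (z : ℂ) : a F z ⬝ᵥ b F z = 0 :=
  dot_eq_zero_of_eigen_eigen negI_sq (hF.F_a z) (hF.F_b z)

theorem dot_b_b (z : ℂ) : b F z ⬝ᵥ b F z = 0 :=
  dot_eq_zero_of_eigen_eigen negI_sq (hF.F_b z) (hF.F_b z)

omit hF in
theorem dot_star_a_k (z : ℂ) : star (a F z) ⬝ᵥ k F z = 0 := by
  rw [k, dotProduct_sub, dotProduct_smul, dotProduct_smul, ← e, ← s, smul_eq_mul, smul_eq_mul]
  ring

theorem dot_star_a_h (z : ℂ) : star (a F z) ⬝ᵥ h F z = 0 :=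
  dot_eq_zero_of_eigen_eigen I_mul_I (hF.F_star_a z) (hF.F_h z)

theorem dot_star_h_of_eigen {z : ℂ} {x : Fin 7 → ℂ} (hx : cross7 (F z) x = (-I) • x) :
    star (h F z) ⬝ᵥ x = 0 :=
  dot_eq_zero_of_eigen_eigen negI_sq (hF.F_star_h z) hx

theorem dot_star_k_h (z : ℂ) : star (k F z) ⬝ᵥ h F z = 0 := by
  rw [← star_dot_star_swap, hF.dot_star_h_of_eigen (hF.F_k z), star_zero]

/-- Combined with `dz_h`, this makes ∂h linear in h with smooth coefficients, which controls the
zeros of h. -/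
theorem k_eq (z : ℂ) : k F z = (-1 / 2 : ℂ) • cross7 (star (a F z)) (h F z) := by
  have h1 := cross7_opposite_cross7 negI_sq (hF.F_a z) (hF.F_b z) (z := star (a F z))
    (by rw [neg_neg]; exact hF.F_star_a z)
  rw [h, h1, k, e, s]; module

omit hF in
theorem cross_a_k (z : ℂ) : cross7 (a F z) (k F z) = e F z • h F z := by
  rw [k, cross7_sub_right, cross7_smul_right, cross7_smul_right, cross7_self, h]; simp

theorem cross_a_h (z : ℂ) : cross7 (a F z) (h F z) = 0 := by
  rw [h, cross7_cross7_self, hF.dot_a_a, hF.dot_a_b]; simp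

theorem cross_b_h (z : ℂ) : cross7 (b F z) (h F z) = 0 := by
  rw [h, cross7_swap (a F z), cross7_neg_right, cross7_cross7_self, hF.dot_b_b, dotProduct_comm,
    hF.dot_a_b]; simp

/-- Because ∂h = i k, this is what makes the directrix superhorizontal. -/
theorem cross_h_k (z : ℂ) : cross7 (h F z) (k F z) = 0 := by
  rw [cross7_swap, k, cross7_sub_left, cross7_smul_left, cross7_smul_left, hF.cross_a_h,
    hF.cross_b_h]; simp

omit hF in
theorem e_ne_zero {z : ℂ} (hz : h F z ≠ 0) : e F z ≠ 0 := by
  intro h0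
  have : a F z = 0 := eq_zero_of_dot_star_self (by rw [dotProduct_comm]; exact h0)
  exact hz (by rw [h, this, cross7_zero_left])

omit hF in
theorem k_ne_zero {z : ℂ} (hz : h F z ≠ 0) : k F z ≠ 0 := by
  intro h0
  have := cross_a_k (F := F) z
  rw [h0, cross7_zero_right] at this
  exact (smul_ne_zero (e_ne_zero hz) hz) this.symm

omit hF in
theorem n_ne_zero {z : ℂ} (hz : h F z ≠ 0) : n F z ≠ 0 := fun h0 =>
  hz (eq_zero_of_dot_star_self (by rw [dotProduct_comm]; exact h0))

omit hF in
theorem star_k_dot_k_ne_zero {z : ℂ} (hz : k F z ≠ 0) : star (k F z) ⬝ᵥ k F z ≠ 0 := fun h0 =>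
  hz (eq_zero_of_dot_star_self (by rw [dotProduct_comm]; exact h0))

omit hF in
theorem star_k_dot_k (z : ℂ) : star (k F z) ⬝ᵥ k F z =
    e F z * (e F z * (star (b F z) ⬝ᵥ b F z) - s F z * star (s F z)) := by
  have h1 : star (k F z) = e F z • star (b F z) - star (s F z) • star (a F z) := by
    rw [k, star_sub, star_smul, star_smul, star_e]
  rw [h1, sub_dotProduct, smul_dotProduct, smul_dotProduct, dot_star_a_k, k, dotProduct_sub,
    dotProduct_smul, dotProduct_smul, ← star_s]
  simp only [smul_eq_mul]; ring

/-! #### First derivatives -/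

theorem dz_F (z : ℂ) : wirt (-I) F z = star (a F z) := by
  have h1 := wirt_star (s := -I) (g := F) (z := z)
  rw [show (fun z => star (F z)) = F from funext hF.real] at h1
  rw [h1]; simp [a]

/-- This is harmonicity of the curve. The vector d = ∂∂̄F is real, so adding the ∂-derivative of F ×
a = -i a to its conjugate gives F × d = 0. Hence d is a multiple of F, and differentiating F · a = 0
gives the factor. -/
theorem dz_a (z : ℂ) : wirt (-I) (a F) z = -(e F z) • F z := by
  set d := wirt (-I) (a F) z with hd
  have h1 := wirt_cross7 (s := -I) (hF.diff_F z) (hF.diff_a z)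
  rw [show (fun z => cross7 (F z) (a F z)) = fun z => (-I) • a F z from funext hF.F_a,
    wirt_const_smul _ (hF.diff_a z), hF.dz_F, ← hd] at h1
  have hdr : star d = d := by
    have h2 : d = wirt I (fun z => star (a F z)) z := by
      rw [hd, a, wirt_comm hF.smooth,
        show wirt (-I) F = fun z => star (a F z) from funext hF.dz_F]
      rfl
    nth_rw 1 [h2]
    rw [wirt_star, star_star, hd]; simp
  have h3 := congrArg star h1
  rw [star_add, star_cross7, star_cross7, star_star, hdr, hF.real, star_smul, hdr,
    cross7_swap (a F z)] at h3
  have h4 : cross7 (F z) d = 0 := by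
    have h5 : (2 : ℂ) • cross7 (F z) d = 0 := by
      have : star (-I) = I := by simp
      rw [this] at h3
      linear_combination (norm := module) -h1 - h3
    simpa using h5
  have h6 := cross7_cross7_self (F z) d
  rw [h4, cross7_zero_right, hF.unit, one_smul] at h6
  have h7 := wirt_dot (s := -I) (hF.diff_F z) (hF.diff_a z)
  rw [show (fun z => F z ⬝ᵥ a F z) = fun _ => (0 : ℂ) from funext hF.dot_F_a, wirt_const, hF.dz_F,
    ← e, ← hd] at h7
  rw [(sub_eq_zero.mp h6.symm).symm, show F z ⬝ᵥ d = -e F z by linear_combination -h7]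

theorem dbar_star_a (z : ℂ) : wirt I (fun z => star (a F z)) z = -(e F z) • F z := by
  rw [wirt_star]
  have : star I = -I := by simp
  rw [this, hF.dz_a, star_smul, star_neg, star_e, hF.real]

omit hF in
theorem dz_star_a (z : ℂ) : wirt (-I) (fun z => star (a F z)) z = star (b F z) := by
  rw [wirt_star]; simp [b]

theorem dbar_e (z : ℂ) : wirt I (e F) z = s F z := by
  have h1 := wirt_dot (s := I) (hF.diff_star_a z) (hF.diff_a z)
  rw [hF.dbar_star_a, smul_dotProduct, hF.dot_F_a, smul_zero, zero_add] at h1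
  exact h1

theorem dz_e (z : ℂ) : wirt (-I) (e F) z = star (s F z) := by
  have h1 := wirt_dot (s := -I) (hF.diff_star_a z) (hF.diff_a z)
  rw [dz_star_a, hF.dz_a, dotProduct_smul, dotProduct_comm _ (F z), hF.dot_F_star_a,
    smul_zero, add_zero, ← star_s] at h1
  exact h1

theorem dz_b (z : ℂ) : wirt (-I) (b F) z = -(s F z) • F z - e F z • a F z := by
  rw [b, wirt_comm hF.smooth_a,
    show wirt (-I) (a F) = fun z => -(e F z • F z) from funext fun z => by rw [hF.dz_a, neg_smul],
    wirt_neg, wirt_smul (hF.diff_e z) (hF.diff_F z), hF.dbar_e, ← a]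
  module

theorem dz_s (z : ℂ) : wirt (-I) (s F) z = star (b F z) ⬝ᵥ b F z - e F z ^ 2 := by
  have h1 := wirt_dot (s := -I) (hF.diff_star_a z) (hF.diff_b z)
  rw [dz_star_a, hF.dz_b, dotProduct_sub, dotProduct_smul, dotProduct_smul,
    dotProduct_comm _ (F z), hF.dot_F_star_a, ← e] at h1
  refine h1.trans ?_
  simp only [smul_eq_mul]; ring

theorem dz_h (z : ℂ) : wirt (-I) (h F) z = I • k F z := by
  have h1 := wirt_cross7 (s := -I) (hF.diff_a z) (hF.diff_b z)
  refine h1.trans ?_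
  rw [hF.dz_a, hF.dz_b, cross7_sub_right, cross7_smul_left, cross7_smul_right, cross7_smul_right,
    cross7_swap (a F z) (F z), hF.F_a, hF.F_b, cross7_self, k]
  module

theorem dz_k (z : ℂ) :
    wirt (-I) (k F) z = star (s F z) • b F z - (star (b F z) ⬝ᵥ b F z) • a F z := by
  have h1 : wirt (-I) (k F) z = _ := wirt_sub (s := -I)
    ((hF.smooth_e.smul hF.smooth_b).differentiable (by simp) z)
    ((hF.smooth_s.smul hF.smooth_a).differentiable (by simp) z)
  have h2 := wirt_smul (s := -I) (hF.diff_e z) (hF.diff_b z)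
  have h3 := wirt_smul (s := -I) (hF.diff_s z) (hF.diff_a z)
  refine h1.trans ?_
  refine (congrArg₂ (· - ·) h2 h3).trans ?_
  rw [hF.dz_e, hF.dz_b, hF.dz_s, hF.dz_a]
  module

theorem dbar_k (z : ℂ) : wirt I (k F) z = e F z • c F z - wirt I (s F) z • a F z := by
  have h1 : wirt I (k F) z = _ := wirt_sub (s := I)
    ((hF.smooth_e.smul hF.smooth_b).differentiable (by simp) z)
    ((hF.smooth_s.smul hF.smooth_a).differentiable (by simp) z)
  have h2 := wirt_smul (s := I) (hF.diff_e z) (hF.diff_b z)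
  have h3 := wirt_smul (s := I) (hF.diff_s z) (hF.diff_a z)
  refine h1.trans ?_
  refine (congrArg₂ (· - ·) h2 h3).trans ?_
  rw [hF.dbar_e, ← b, ← c]
  module

/-- The coefficient i e/2 is forced: it removes the i-eigencomponent which ∂̄k acquires from the h
term in `F_c`. -/
theorem F_dbar_k (z : ℂ) : cross7 (F z) (wirt I (k F) z - (I * e F z / 2) • h F z) =
    (-I) • (wirt I (k F) z - (I * e F z / 2) • h F z) := by
  rw [cross7_sub_right, cross7_smul_right, hF.F_h, hF.dbar_k, cross7_sub_right, cross7_smul_right,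
    cross7_smul_right, hF.F_c, hF.F_a]
  match_scalars
  · ring
  · linear_combination (-(e F z)) * I_mul_I
  · ring

/-! #### Second derivatives and unique continuation -/

/-- The right side is e|b|² - |s|² - e³, whose first two terms have a nonnegative difference by
Cauchy–Schwarz. `h_log_bound` follows the same pattern. -/
theorem a_log_bound (z : ℂ) : -(e F z).re * (e F z).re ^ 2 ≤
    (e F z * wirt I (wirt (-I) (e F)) z - wirt I (e F) z * wirt (-I) (e F) z).re := by
  rw [wirt_comm hF.smooth_e, show wirt I (e F) = s F from funext hF.dbar_e, hF.dz_s, hF.dz_e]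
  have h1 := re_cauchy_schwarz (a F z) (b F z)
  rw [← e, ← s, ← star_s] at h1
  have h2 : e F z = ((e F z).re : ℂ) := (Complex.conj_eq_iff_re.mp (star_e z)).symm
  have h3 : (e F z ^ 3).re = (e F z).re ^ 3 := by
    conv_lhs => rw [h2]
    norm_cast
  have h4 : e F z * (star (b F z) ⬝ᵥ b F z - e F z ^ 2) - s F z * star (s F z) =
      (e F z * (star (b F z) ⬝ᵥ b F z) - s F z * star (s F z)) - e F z ^ 3 := by ring
  rw [h4, sub_re, sub_re, h3]
  linarith [h1]

theorem dz_n (z : ℂ) : wirt (-I) (n F) z = star (wirt I (h F) z) ⬝ᵥ h F z := by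
  have h1 := wirt_dot (s := -I) (hF.diff_star_h z) (hF.diff_h z)
  refine h1.trans ?_
  rw [hF.dz_h, dotProduct_smul, hF.dot_star_h_of_eigen (hF.F_k z), smul_zero, add_zero, wirt_star]
  simp

theorem dbar_n (z : ℂ) : wirt I (n F) z = star (h F z) ⬝ᵥ wirt I (h F) z := by
  have h1 := wirt_dot (s := I) (hF.diff_star_h z) (hF.diff_h z)
  refine h1.trans ?_
  rw [wirt_star, show star I = -I by simp, hF.dz_h, star_smul, smul_dotProduct, hF.dot_star_k_h,
    smul_zero, zero_add]

theorem dz_dbar_n (z : ℂ) : wirt (-I) (wirt I (n F)) z =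
    star (wirt I (h F) z) ⬝ᵥ wirt I (h F) z - e F z / 2 * n F z := by
  rw [show wirt I (n F) = _ from funext hF.dbar_n]
  have h1 := wirt_dot (s := -I) (hF.diff_star_h z)
    (hF.smooth_h.wirt (s := I) |>.differentiable (by simp) z)
  refine h1.trans ?_
  rw [wirt_comm hF.smooth_h, show wirt (-I) (h F) = _ from funext hF.dz_h,
    wirt_const_smul _ (hF.diff_k z), wirt_star, show star (-I) = I by simp]
  have h2 := hF.dot_star_h_of_eigen (hF.F_dbar_k z)
  rw [dotProduct_sub, dotProduct_smul, ← n, smul_eq_mul] at h2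
  rw [dotProduct_smul, smul_eq_mul]
  linear_combination I * h2 + e F z * n F z / 2 * I_mul_I

theorem h_log_bound (z : ℂ) : -((e F z).re / 2) * (n F z).re ^ 2 ≤
    (n F z * wirt I (wirt (-I) (n F)) z - wirt I (n F) z * wirt (-I) (n F) z).re := by
  rw [wirt_comm hF.smooth_n, hF.dz_dbar_n, hF.dbar_n, hF.dz_n]
  have h1 := re_cauchy_schwarz (h F z) (wirt I (h F) z)
  rw [← n] at h1
  have h2 : e F z = ((e F z).re : ℂ) := (Complex.conj_eq_iff_re.mp (star_e z)).symm
  have h2' : n F z = ((n F z).re : ℂ) := (Complex.conj_eq_iff_re.mp (star_n z)).symm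
  have h3 : (e F z / 2 * n F z ^ 2).re = (e F z).re / 2 * (n F z).re ^ 2 := by
    rw [h2, h2']; norm_cast
  have h4 : n F z * (star (wirt I (h F) z) ⬝ᵥ wirt I (h F) z - e F z / 2 * n F z) -
      star (h F z) ⬝ᵥ wirt I (h F) z * star (wirt I (h F) z) ⬝ᵥ h F z =
      (n F z * (star (wirt I (h F) z) ⬝ᵥ wirt I (h F) z) -
      star (h F z) ⬝ᵥ wirt I (h F) z * star (wirt I (h F) z) ⬝ᵥ h F z) -
      e F z / 2 * n F z ^ 2 := by ring
  rw [h4, sub_re, sub_re, h3]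
  linarith [h1]

/-- Either `f` is constant or all zeros of `∂f/∂z̄` have finite order. -/
theorem a_dichotomy : (∀ z, a F z = 0) ∨
    ∀ z₀, ∃ m : ℕ, ∃ r > 0, ∀ᶠ z in 𝓝 z₀, r * ‖z - z₀‖ ^ m ≤ ‖a F z‖ := by
  have hs := hF.smooth_a.star_fun
  have key : (∀ z, star (a F z) = 0) ∨ ∀ z₀, ∃ m : ℕ, ∃ r > 0,
      ∀ᶠ z in 𝓝 z₀, r * ‖z - z₀‖ ^ m ≤ ‖star (a F z)‖ := by
    refine eq_zero_or_lower_bound hs (fun z m hv => ?_) (fun z hv => ?_)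
    -- The equation ∂̄ā = -(a · ā) F is linear in ā with smooth coefficients.
    · have h1 := (hv.bilin dotL hF.smooth_a hs).bilin ((ContinuousLinearMap.lsmul ℂ ℂ).flip)
        (hF.smooth.const_smul (-1 : ℂ) : ContDiff ℝ ∞ fun z => (-1 : ℂ) • F z)
        (hF.smooth_a.dot hs)
      convert h1 using 1
      funext z
      rw [hF.dbar_star_a]
      simp [dotProduct_comm (a F z), e]
    · refine eventually_eq_zero_of_vanishes hs (n := e F) ?_
        (c := fun z => (e F z).re) (continuous_re.comp hF.smooth_e.continuous)
        hF.a_log_bound hv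
      funext z
      rw [star_star, dotProduct_comm]; rfl
  simpa using key

/-- Either `h = 0` or all zeros of `h` have finite order. -/
theorem h_dichotomy : (∀ z, h F z = 0) ∨
    ∀ z₀, ∃ m : ℕ, ∃ r > 0, ∀ᶠ z in 𝓝 z₀, r * ‖z - z₀‖ ^ m ≤ ‖h F z‖ := by
  have hs := hF.smooth_h.star_fun
  have key : (∀ z, star (h F z) = 0) ∨ ∀ z₀, ∃ m : ℕ, ∃ r > 0,
      ∀ᶠ z in 𝓝 z₀, r * ‖z - z₀‖ ^ m ≤ ‖star (h F z)‖ := by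
    refine eq_zero_or_lower_bound hs (fun z m hv => ?_) (fun z hv => ?_)
    -- Conjugating ∂h = i k with `k_eq` gives ∂̄h̄ = (i/2) a × h̄. The argument runs on h̄ because
    -- ∂̄h is not yet controlled.
    · have h1 := hv.bilin crossL
        (hF.smooth_a.const_smul (I / 2) : ContDiff ℝ ∞ fun z => (I / 2) • a F z) hs
      convert h1 using 1
      funext z
      rw [wirt_star, show star I = -I by simp, hF.dz_h, hF.k_eq, crossL_apply, cross7_smul_left,
        star_smul, star_smul, star_cross7, star_star, smul_smul]
      congr 1
      simp; ring
    · refine eventually_eq_zero_of_vanishes hs (n := n F) ?_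
        (c := fun z => (e F z).re / 2) ((continuous_re.comp hF.smooth_e.continuous).div_const 2)
        hF.h_log_bound hv
      funext z
      rw [star_star, dotProduct_comm]; rfl
  simpa using key

end IsAlmostComplexLift

/-! ### The sextic differential and the closing of the structure equations. -/

namespace IsAlmostComplexLift

open Complex AC Filter

variable {F : ℂ → Fin 7 → ℂ}

/-- The coefficient of the sextic differential of the curve. -/
noncomputable def sextic (F : ℂ → Fin 7 → ℂ) (z : ℂ) : ℂ := c F z ⬝ᵥ h F z

theorem dot_a_h (z : ℂ) : a F z ⬝ᵥ h F z = 0 := by rw [dotProduct_comm]; exact cross7_dot_left _ _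

theorem dot_b_h (z : ℂ) : b F z ⬝ᵥ h F z = 0 := by rw [dotProduct_comm]; exact cross7_dot_right _ _

section

variable (hF : IsAlmostComplexLift F)
include hF

theorem dot_F_h (z : ℂ) : F z ⬝ᵥ h F z = 0 := dot_eq_zero_of_eigen I_mul_I (hF.F_h z)

theorem dot_a_c (z : ℂ) : a F z ⬝ᵥ c F z = 0 := by
  have h1 := wirt_dot (s := I) (hF.diff_a z) (hF.diff_b z)
  rw [show (fun z => a F z ⬝ᵥ b F z) = fun _ => (0 : ℂ) from funext hF.dot_a_b, wirt_const, ← b,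
    hF.dot_b_b, zero_add] at h1
  exact h1.symm

theorem dot_b_c (z : ℂ) : b F z ⬝ᵥ c F z = 0 := by
  have h1 := wirt_dot (s := I) (hF.diff_b z) (hF.diff_b z)
  rw [show (fun z => b F z ⬝ᵥ b F z) = fun _ => (0 : ℂ) from funext hF.dot_b_b, wirt_const, ← c,
    dotProduct_comm (c F z)] at h1
  linear_combination -h1 / 2

theorem dz_c (z : ℂ) : wirt (-I) (c F) z =
    -(wirt I (s F) z) • F z - (2 * s F z) • a F z - e F z • b F z := by
  have e1 : wirt (-I) (b F) = fun z => -(s F z • F z) - e F z • a F z :=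
    funext fun z => by rw [hF.dz_b, neg_smul]
  rw [c, wirt_comm hF.smooth_b, e1,
    wirt_sub ((hF.diff_s z).fun_smul (hF.diff_F z)).fun_neg
      ((hF.diff_e z).fun_smul (hF.diff_a z)), wirt_neg,
    wirt_smul (hF.diff_s z) (hF.diff_F z), wirt_smul (hF.diff_e z) (hF.diff_a z), hF.dbar_e,
    ← a, ← b]
  module

theorem smooth_sextic : ContDiff ℝ ∞ (sextic F) := hF.smooth_c.dot hF.smooth_h

/-- ∂c lies in the span of F, a, b, all orthogonal to h, while ∂h = i k lies in the span of a and b,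
both orthogonal to c. -/
theorem dz_sextic (z : ℂ) : wirt (-I) (sextic F) z = 0 := by
  refine (wirt_dot (s := -I) (hF.diff_c z) (hF.diff_h z)).trans ?_
  rw [hF.dz_c, hF.dz_h, sub_dotProduct, sub_dotProduct, smul_dotProduct, smul_dotProduct,
    smul_dotProduct, hF.dot_F_h, dot_a_h, dot_b_h, dotProduct_smul, k, dotProduct_sub,
    dotProduct_smul, dotProduct_smul, dotProduct_comm _ (b F z), dotProduct_comm _ (a F z),
    hF.dot_a_c, hF.dot_b_c]
  simp

end

/-! #### Change of coordinate -/

section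

variable {F' : ℂ → Fin 7 → ℂ} (hF : IsAlmostComplexLift F) (hrel : ∀ w ≠ 0, F' w = F w⁻¹)

/-- The conjugate of the derivative of `w ↦ 1 / w`. -/
noncomputable def invFactor (w : ℂ) : ℂ := star (-(w ^ 2)⁻¹)

theorem smooth_invFactor {w : ℂ} (hw : w ≠ 0) : ContDiffAt ℝ ∞ invFactor w := by
  have h1 : ContDiffAt ℝ ∞ (fun w : ℂ => -(w ^ 2)⁻¹) w := by
    have h2 : ContDiff ℝ ∞ fun w : ℂ => w ^ 2 := contDiff_id.pow 2
    exact (h2.contDiffAt.inv (pow_ne_zero 2 hw)).neg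
  exact ((starL' ℝ : ℂ ≃L[ℝ] ℂ).contDiff.contDiffAt (x := -(w ^ 2)⁻¹)).comp w h1

theorem invFactor_ne_zero {w : ℂ} (hw : w ≠ 0) : invFactor w ≠ 0 := by
  simp [invFactor, hw]

theorem dbar_comp_inv {g : ℂ → Fin 7 → ℂ} (hg : ContDiff ℝ ∞ g) {w : ℂ} (hw : w ≠ 0) :
    wirt I (fun w => g w⁻¹) w = invFactor w • wirt I g w⁻¹ :=
  wirt_I_comp (hasDerivAt_inv hw) (hg.differentiable (by simp) _)

theorem diff_comp_inv {g : ℂ → Fin 7 → ℂ} (hg : ContDiff ℝ ∞ g) {w : ℂ} (hw : w ≠ 0) :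
    DifferentiableAt ℝ (fun w => g w⁻¹) w :=
  DifferentiableAt.comp w (hg.differentiable (by simp) _)
    ((hasDerivAt_inv hw).differentiableAt.restrictScalars ℝ)

include hF hrel

theorem a_transform {w : ℂ} (hw : w ≠ 0) : a F' w = invFactor w • a F w⁻¹ := by
  have e1 : F' =ᶠ[𝓝 w] fun w => F w⁻¹ := (eventually_ne_nhds hw).mono hrel
  rw [a, e1.wirt_eq, dbar_comp_inv hF.smooth hw]; rfl

theorem b_transform {w : ℂ} (hw : w ≠ 0) :
    b F' w = wirt I invFactor w • a F w⁻¹ + invFactor w ^ 2 • b F w⁻¹ := by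
  have e1 : a F' =ᶠ[𝓝 w] fun w => invFactor w • a F w⁻¹ :=
    (eventually_ne_nhds hw).mono fun w hw => a_transform hF hrel hw
  rw [b, e1.wirt_eq, wirt_smul ((smooth_invFactor hw).differentiableAt (by simp))
    (diff_comp_inv hF.smooth_a hw), dbar_comp_inv hF.smooth_a hw, smul_smul, ← sq]; rfl

theorem c_transform {w : ℂ} (hw : w ≠ 0) : ∃ r t : ℂ,
    c F' w = r • a F w⁻¹ + t • b F w⁻¹ + invFactor w ^ 3 • c F w⁻¹ := by
  have e1 : b F' =ᶠ[𝓝 w] fun w => wirt I invFactor w • a F w⁻¹ + invFactor w ^ 2 • b F w⁻¹ :=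
    (eventually_ne_nhds hw).mono fun w hw => b_transform hF hrel hw
  have d1 : DifferentiableAt ℝ (wirt I invFactor) w :=
    (smooth_invFactor hw).wirt.differentiableAt (by simp)
  have d2 : DifferentiableAt ℝ (fun w => invFactor w ^ 2) w :=
    ((smooth_invFactor hw).differentiableAt (by simp)).pow 2
  have da := diff_comp_inv hF.smooth_a hw
  have db := diff_comp_inv hF.smooth_b hw
  rw [c, e1.wirt_eq, wirt_add (d1.fun_smul da) (d2.fun_smul db), wirt_smul d1 da, wirt_smul d2 db,
    dbar_comp_inv hF.smooth_a hw, dbar_comp_inv hF.smooth_b hw]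
  refine ⟨wirt I (wirt I invFactor) w, wirt I invFactor w * invFactor w +
    wirt I (fun w => invFactor w ^ 2) w, ?_⟩
  rw [← b, ← c]; module

theorem h_transform {w : ℂ} (hw : w ≠ 0) : h F' w = invFactor w ^ 3 • h F w⁻¹ := by
  rw [h, a_transform hF hrel hw, b_transform hF hrel hw, cross7_smul_left, cross7_add_right,
    cross7_smul_right, cross7_smul_right, cross7_self, h]
  module

/-- The lower order terms of c are multiples of a and b and disappear against h, so c · h transforms
as the coefficient of a differential of degree six in dz̄. -/
theorem sextic_transform {w : ℂ} (hw : w ≠ 0) :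
    sextic F' w = invFactor w ^ 6 * sextic F w⁻¹ := by
  obtain ⟨r, t, hc⟩ := c_transform hF hrel hw
  rw [sextic, hc, h_transform hF hrel hw, add_dotProduct, add_dotProduct, smul_dotProduct,
    smul_dotProduct, smul_dotProduct, dotProduct_smul, dotProduct_smul, dotProduct_smul, dot_a_h,
    dot_b_h, sextic]
  simp only [smul_eq_mul]; ring

/-- The sextic differential of an almost complex sphere vanishes. -/
theorem sextic_eq_zero (hF' : IsAlmostComplexLift F') (z : ℂ) : sextic F z = 0 := by
  have hd : Differentiable ℂ fun z => star (sextic F z) := fun z => by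
    have h1 := (hF.smooth_sextic.star_fun.differentiable (by simp)) z
    refine (hasDerivAt_of_wirt_eq_zero h1 ?_).differentiableAt
    rw [wirt_star, show star I = -I by simp, hF.dz_sextic, star_zero]
  -- With w = 1/z the transformation law makes the conjugate of `sextic F z` equal to w¹² times that
  -- of `sextic F' w`, which tends to 0 at infinity. Liouville's theorem then applies to this entire
  -- function.
  have hlim : Tendsto (fun z => star (sextic F z)) (cocompact ℂ) (𝓝 0) := by
    have h2 : Tendsto (fun w : ℂ => w ^ 12 * star (sextic F' w)) (𝓝 0) (𝓝 0) := by
      have : Continuous fun w : ℂ => w ^ 12 * star (sextic F' w) :=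
        (continuous_id.pow 12).mul hF'.smooth_sextic.star_fun.continuous
      simpa using this.tendsto 0
    have h3 : Tendsto (fun z : ℂ => z⁻¹) (cocompact ℂ) (𝓝 0) := by
      rw [← Metric.cobounded_eq_cocompact]; exact tendsto_inv₀_cobounded
    refine (h2.comp h3).congr' ?_
    have h4 : ∀ᶠ z : ℂ in cocompact ℂ, z ≠ 0 :=
      (isCompact_singleton (x := (0 : ℂ))).compl_mem_cocompact
    filter_upwards [h4] with z hz
    have hz' : z⁻¹ ≠ 0 := inv_ne_zero hz
    simp only [Function.comp]
    rw [sextic_transform hF hrel hz', inv_inv, star_mul', star_pow, invFactor, star_star]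
    field_simp
  have := hd.apply_eq_of_tendsto_cocompact z hlim
  simpa using congrArg star this

end

/-! #### Consequences of the vanishing of the sextic differential -/

section

variable (hF : IsAlmostComplexLift F) (hS : ∀ z, sextic F z = 0) {z : ℂ} (hz : h F z ≠ 0)
include hF

omit hF in
theorem k_dot_h (z : ℂ) : k F z ⬝ᵥ h F z = 0 := by
  rw [k, sub_dotProduct, smul_dotProduct, smul_dotProduct, dot_a_h, dot_b_h]; simp

theorem dot_h_h (z : ℂ) : h F z ⬝ᵥ h F z = 0 :=
  dot_eq_zero_of_eigen_eigen I_mul_I (hF.F_h z) (hF.F_h z)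

theorem dot_star_a_dbar_k (z : ℂ) : star (a F z) ⬝ᵥ wirt I (k F) z = 0 := by
  have h1 := wirt_dot (s := I) (hF.diff_star_a z) (hF.diff_k z)
  rw [show (fun z => star (a F z) ⬝ᵥ k F z) = fun _ => (0 : ℂ) from funext dot_star_a_k,
    wirt_const, hF.dbar_star_a, smul_dotProduct, dot_eq_zero_of_eigen negI_sq (hF.F_k z), smul_zero,
    zero_add] at h1
  exact h1.symm

omit hF in
theorem eigen_eq_zero_of_star_a_star_k {v : Fin 7 → ℂ} (hF : IsAlmostComplexLift F)
    (hz : h F z ≠ 0) (hv : cross7 (F z) v = (-I) • v) (h1 : star (a F z) ⬝ᵥ v = 0)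
    (h2 : star (b F z) ⬝ᵥ v = 0) (h3 : h F z ⬝ᵥ v = 0) : v = 0 :=
  eigen_eq_zero (hF.real z) negI_sq star_negI (hF.F_a z) (hF.F_b z) hv hz h1 h2 h3

include hS hz

/-- After removal of the h and k components, the rest of ∂̄k lies in the -i eigenspace and is
Hermitian-orthogonal to a and b. That eigenspace would still allow the direction h̄, and the
vanishing of the sextic differential excludes it. -/
theorem exists_dbar_k : ∃ y : ℂ, wirt I (k F) z = (I * e F z / 2) • h F z + y • k F z := by
  set u := wirt I (k F) z - (I * e F z / 2) • h F z with hu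
  set y := (star (k F z) ⬝ᵥ u) / (star (k F z) ⬝ᵥ k F z)
  have hkk := star_k_dot_k_ne_zero (k_ne_zero hz)
  have hk0 : star (k F z) ⬝ᵥ (u - y • k F z) = 0 := by
    rw [dotProduct_sub, dotProduct_smul, smul_eq_mul, div_mul_cancel₀ _ hkk, sub_self]
  have ha0 : star (a F z) ⬝ᵥ (u - y • k F z) = 0 := by
    rw [dotProduct_sub, dotProduct_smul, dot_star_a_k, hu, dotProduct_sub, hF.dot_star_a_dbar_k,
      dotProduct_smul, hF.dot_star_a_h]
    simp
  have h0 : u - y • k F z = 0 := by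
    refine hF.eigen_eq_zero_of_star_a_star_k hz ?_ ha0 ?_ ?_
    · rw [cross7_sub_right, cross7_smul_right, hF.F_dbar_k, hF.F_k]; module
    · have h1 : star (k F z) = e F z • star (b F z) - star (s F z) • star (a F z) := by
        rw [k, star_sub, star_smul, star_smul, star_e]
      rw [h1, sub_dotProduct, smul_dotProduct, smul_dotProduct, ha0, smul_zero, sub_zero] at hk0
      exact (smul_eq_zero.mp hk0).resolve_left (e_ne_zero hz)
    · have hS' := hS z
      rw [sextic] at hS'
      rw [hu, hF.dbar_k, dotProduct_sub, dotProduct_sub, dotProduct_sub, dotProduct_smul,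
        dotProduct_smul, dotProduct_smul, dotProduct_smul, hF.dot_h_h, dotProduct_comm _ (c F z),
        dotProduct_comm _ (a F z), dotProduct_comm _ (k F z), hS', dot_a_h, k_dot_h]
      simp
  refine ⟨y, ?_⟩
  linear_combination (norm := module) h0

/-- Differentiate a × k = e h in z̄: the term b × k = s h cancels (∂̄e) h, and a × ∂̄k contributes y
e h. -/
theorem exists_dbar_k_dbar_h : ∃ y : ℂ,
    wirt I (k F) z = (I * e F z / 2) • h F z + y • k F z ∧ wirt I (h F) z = y • h F z := by
  obtain ⟨y, hy⟩ := hF.exists_dbar_k hS hz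
  refine ⟨y, hy, ?_⟩
  have h1 := wirt_cross7 (s := I) (hF.diff_a z) (hF.diff_k z)
  rw [show (fun z => cross7 (a F z) (k F z)) = fun z => e F z • h F z from funext cross_a_k,
    wirt_smul (hF.diff_e z) (hF.diff_h z), hF.dbar_e, hy, ← b, cross7_add_right, cross7_smul_right,
    cross7_smul_right, hF.cross_a_h, cross_a_k, k, cross7_sub_right, cross7_smul_right, cross7_self,
    cross7_smul_right, cross7_swap (b F z), ← h] at h1
  have h2 : e F z • (wirt I (h F) z - y • h F z) = 0 := by
    linear_combination (norm := module) h1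
  exact sub_eq_zero.mp ((smul_eq_zero.mp h2).resolve_left (e_ne_zero hz))

end

end IsAlmostComplexLift

/-! ### The harmonic sequence and where it ends. -/

section DbarTransform

open Complex Filter

variable {g : ℂ → Fin 7 → ℂ} {z : ℂ}

theorem star_dot_self_ne_zero {v : Fin 7 → ℂ} (hv : v ≠ 0) : star v ⬝ᵥ v ≠ 0 := fun h0 =>
  hv (eq_zero_of_dot_star_self (by rw [dotProduct_comm]; exact h0))

theorem Filter.EventuallyEq.dbarTransform_eq {g' : ℂ → Fin 7 → ℂ} (e : g =ᶠ[𝓝 z] g') :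
    dbarTransform g z = dbarTransform g' z := by
  rw [dbarTransform, dbarTransform, dbar_eq_wirt, dbar_eq_wirt, e.wirt_eq, e.eq_of_nhds]

theorem dbarTransform_eq {u : Fin 7 → ℂ} {y : ℂ} (hg : g z ≠ 0)
    (h : wirt I g z = u + y • g z) (hu : star (g z) ⬝ᵥ u = 0) : dbarTransform g z = u := by
  rw [dbarTransform, dbar_eq_wirt, h, dotProduct_add, hu, dotProduct_smul, zero_add, smul_eq_mul,
    mul_div_cancel_right₀ _ (star_dot_self_ne_zero hg)]
  abel

/-- The transform is tensorial: differentiating the factor only adds a multiple of g, which the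
projection removes. -/
theorem dbarTransform_smul {r : ℂ → ℂ} (hr : DifferentiableAt ℝ r z)
    (hg : DifferentiableAt ℝ g z) (hr0 : r z ≠ 0) (hg0 : g z ≠ 0) :
    dbarTransform (fun z => r z • g z) z = r z • dbarTransform g z := by
  have h0 := star_dot_self_ne_zero hg0
  refine dbarTransform_eq (y := wirt I r z / r z +
    (star (g z) ⬝ᵥ wirt I g z) / (star (g z) ⬝ᵥ g z)) (smul_ne_zero hr0 hg0) ?_ ?_
  · rw [wirt_smul hr hg, dbarTransform, dbar_eq_wirt]
    match_scalars <;> field_simp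
    ring
  · rw [dbarTransform, dbar_eq_wirt, dotProduct_smul, star_smul, smul_dotProduct, dotProduct_sub,
      dotProduct_smul, smul_eq_mul (_ / _), div_mul_cancel₀ _ h0, sub_self, smul_zero, smul_zero]

/-- The next descending element vanishes if the line spanned by the section is holomorphic. -/
theorem dbarTransform_eq_zero_of_holomorphic {H : ℂ → Fin 7 → ℂ} (hg : DifferentiableAt ℝ g z)
    (hg0 : g z ≠ 0) (hH : AnalyticAt ℂ H z) (hH0 : H z ≠ 0)
    (hpar : ∀ᶠ w in 𝓝 z, ∀ i j, g w i * H w j = g w j * H w i) : dbarTransform g z = 0 := by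
  obtain ⟨j, hj⟩ : ∃ j, H z j ≠ 0 := by
    by_contra! h; exact hH0 (funext h)
  have hHd : HasDerivAt H (deriv H z) z := hH.differentiableAt.hasDerivAt
  have hgi : ∀ i, DifferentiableAt ℝ (fun w => g w i) z := fun i => differentiableAt_pi.mp hg i
  have hHi : ∀ i, HasDerivAt (fun w => H w i) (deriv H z i) z := fun i => hasDerivAt_pi.mp hHd i
  have hHiR : ∀ i, DifferentiableAt ℝ (fun w => H w i) z := fun i =>
    (hHi i).differentiableAt.restrictScalars ℝ
  have hcomp : ∀ i, wirt I (fun w => g w i) z = wirt I g z i := fun i =>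
    wirt_clm (ContinuousLinearMap.proj (R := ℂ) (φ := fun _ : Fin 7 => ℂ) i) hg
  have h1 : ∀ i, wirt I g z i * H z j = wirt I g z j * H z i := by
    intro i
    have e1 : (fun w => g w i * H w j) =ᶠ[𝓝 z] fun w => g w j * H w i := hpar.mono fun w h => h i j
    have e2 := e1.wirt_eq (s := I)
    rwa [wirt_mul (hgi i) (hHiR j), wirt_mul (hgi j) (hHiR i), (hHi i).wirt_I_eq,
      (hHi j).wirt_I_eq, mul_zero, mul_zero, add_zero, add_zero, hcomp, hcomp] at e2
  have h2 : ∀ i, g z i * H z j = g z j * H z i := fun i => hpar.self_of_nhds i j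
  have hgj : g z j ≠ 0 := fun h0 => hg0 (funext fun i => by
    have := h2 i
    rw [h0, zero_mul] at this
    exact (mul_eq_zero.mp this).resolve_right hj)
  refine dbarTransform_eq (y := wirt I g z j / g z j) hg0 ?_ (dotProduct_zero _)
  funext i
  simp only [zero_add, Pi.smul_apply, smul_eq_mul]
  have h3 : wirt I g z i = wirt I g z j * H z i / H z j := by
    rw [eq_div_iff hj]; exact h1 i
  have h4 : g z i = g z j * H z i / H z j := by
    rw [eq_div_iff hj]; exact h2 i
  rw [h3, h4]
  field_simp

theorem wirt_inv {r : ℂ → ℂ} {s : ℂ} (hr : DifferentiableAt ℝ r z) (h0 : r z ≠ 0) :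
    wirt s (fun z => (r z)⁻¹) z = -(wirt s r z / r z ^ 2) := by
  have hi : DifferentiableAt ℝ (fun z => (r z)⁻¹) z := hr.fun_inv h0
  have e : (fun z => r z * (r z)⁻¹) =ᶠ[𝓝 z] fun _ => (1 : ℂ) :=
    (hr.continuousAt.eventually_ne h0).mono fun w hw => mul_inv_cancel₀ hw
  have h1 := wirt_mul (s := s) hr hi
  rw [e.wirt_eq, wirt_const] at h1
  field_simp
  field_simp at h1
  linear_combination -h1

end DbarTransform

namespace IsAlmostComplexLift

open Complex AC Filter

variable {F : ℂ → Fin 7 → ℂ} (hF : IsAlmostComplexLift F) {z : ℂ}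

include hF

theorem eventually_h_ne_zero (hz : h F z ≠ 0) : ∀ᶠ w in 𝓝 z, h F w ≠ 0 :=
  hF.smooth_h.continuous.continuousAt.eventually_ne hz

theorem F_ne_zero (z : ℂ) : F z ≠ 0 := fun h0 => by
  have := hF.unit z
  simp [h0] at this

omit hF in
theorem a_ne_zero (hz : h F z ≠ 0) : a F z ≠ 0 := fun h0 => hz (by rw [h, h0, cross7_zero_left])

theorem dbarTransform_F : dbarTransform F = a F := by
  funext z
  refine dbarTransform_eq (y := 0) (hF.F_ne_zero z) (by rw [zero_smul, add_zero]; rfl) ?_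
  rw [hF.real]; exact hF.dot_F_a z

omit hF in
theorem dbarTransform_a (hz : h F z ≠ 0) : dbarTransform (a F) z = (e F z)⁻¹ • k F z := by
  have he := e_ne_zero hz
  refine dbarTransform_eq (y := s F z / e F z) (a_ne_zero hz) ?_ ?_
  · change b F z = _
    rw [k]
    match_scalars <;> field_simp
    ring
  · rw [dotProduct_smul, dot_star_a_k, smul_zero]

variable (hS : ∀ z, sextic F z = 0)

include hS

theorem dbarTransform_k (hz : h F z ≠ 0) : dbarTransform (k F) z = (I * e F z / 2) • h F z := by
  obtain ⟨y, hy⟩ := hF.exists_dbar_k hS hz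
  exact dbarTransform_eq (k_ne_zero hz) hy (by rw [dotProduct_smul, hF.dot_star_k_h, smul_zero])

theorem dbarTransform_h (hz : h F z ≠ 0) : dbarTransform (h F) z = 0 := by
  obtain ⟨y, -, hy⟩ := hF.exists_dbar_k_dbar_h hS hz
  exact dbarTransform_eq (y := y) hz (by rw [zero_add, hy]) (dotProduct_zero _)

omit hS in
theorem iterate_two (hz : h F z ≠ 0) : dbarTransform^[2] F z = (e F z)⁻¹ • k F z := by
  rw [Function.iterate_succ_apply', Function.iterate_one, hF.dbarTransform_F]
  exact dbarTransform_a hz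

theorem iterate_three (hz : h F z ≠ 0) : dbarTransform^[3] F z = (I / 2) • h F z := by
  have he := e_ne_zero hz
  rw [Function.iterate_succ_apply']
  have e1 : dbarTransform^[2] F =ᶠ[𝓝 z] fun z => (e F z)⁻¹ • k F z :=
    (hF.eventually_h_ne_zero hz).mono fun w hw => hF.iterate_two hw
  rw [e1.dbarTransform_eq, dbarTransform_smul ((hF.diff_e z).fun_inv he) (hF.diff_k z)
    (inv_ne_zero he) (k_ne_zero hz), hF.dbarTransform_k hS hz, smul_smul]
  congr 1
  field_simp

theorem iterate_four (hz : h F z ≠ 0) : dbarTransform^[4] F z = 0 := by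
  rw [Function.iterate_succ_apply']
  have e1 : dbarTransform^[3] F =ᶠ[𝓝 z] fun z => (I / 2 : ℂ) • h F z :=
    (hF.eventually_h_ne_zero hz).mono fun w hw => hF.iterate_three hS hw
  rw [e1.dbarTransform_eq, dbarTransform_smul (differentiableAt_const _) (hF.diff_h z) (by simp) hz,
    hF.dbarTransform_h hS hz, smul_zero]

theorem iterate_ne_zero (hz : h F z ≠ 0) {j : ℕ} (hj : j ≤ 3) : dbarTransform^[j] F z ≠ 0 := by
  interval_cases j
  · exact hF.F_ne_zero z
  · rw [Function.iterate_one, hF.dbarTransform_F]; exact a_ne_zero hz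
  · rw [hF.iterate_two hz]; exact smul_ne_zero (inv_ne_zero (e_ne_zero hz)) (k_ne_zero hz)
  · rw [hF.iterate_three hS hz]; exact smul_ne_zero (by simp) hz

omit hS in
theorem iterate_differentiableAt (hz : h F z ≠ 0) {j : ℕ} (hj : j ≤ 2) :
    DifferentiableAt ℝ (dbarTransform^[j] F) z := by
  interval_cases j
  · exact hF.diff_F z
  · rw [Function.iterate_one, hF.dbarTransform_F]; exact hF.diff_a z
  · have e1 : dbarTransform^[2] F =ᶠ[𝓝 z] fun z => (e F z)⁻¹ • k F z :=
      (hF.eventually_h_ne_zero hz).mono fun w hw => hF.iterate_two hw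
    exact (((hF.diff_e z).fun_inv (e_ne_zero hz)).fun_smul (hF.diff_k z)).congr_of_eventuallyEq e1

end IsAlmostComplexLift

/-! ### The holomorphic lift of the directrix. -/

namespace AC

/-- The holomorphic lift `h / |h|²` of the directrix curve. -/
noncomputable def holoLift (F : ℂ → Fin 7 → ℂ) (z : ℂ) : Fin 7 → ℂ := (n F z)⁻¹ • h F z

end AC

namespace IsAlmostComplexLift

open Complex AC Filter

variable {F : ℂ → Fin 7 → ℂ} (hF : IsAlmostComplexLift F) {z : ℂ} (hz : h F z ≠ 0)

include hz in
theorem lift_ne_zero : holoLift F z ≠ 0 := smul_ne_zero (inv_ne_zero (n_ne_zero hz)) hz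

include hF hz

theorem smooth_lift : ContDiffAt ℝ ∞ (holoLift F) z :=
  (hF.smooth_n.contDiffAt.inv (n_ne_zero hz)).smul hF.smooth_h.contDiffAt

/-- If ∂̄h = y h then also ∂̄|h|² = y |h|², because ∂h is Hermitian-orthogonal to h. The quotient is
therefore annihilated by ∂̄. -/
theorem hasDerivAt_lift (hS : ∀ z, sextic F z = 0) :
    HasDerivAt (holoLift F) (wirt (-I) (holoLift F) z) z := by
  obtain ⟨y, -, hy⟩ := hF.exists_dbar_k_dbar_h hS hz
  refine hasDerivAt_of_wirt_eq_zero ((hF.smooth_lift hz).differentiableAt (by simp)) ?_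
  have hn := n_ne_zero hz
  have e1 : wirt I (n F) z = y * n F z := by
    rw [hF.dbar_n, hy, dotProduct_smul]; rfl
  refine (wirt_smul ((hF.diff_n z).fun_inv hn) (hF.diff_h z)).trans ?_
  rw [wirt_inv (hF.diff_n z) hn, e1, hy]
  match_scalars
  field_simp
  ring

theorem cross_lift : cross7 (holoLift F z) (wirt (-I) (holoLift F) z) = 0 := by
  have e1 : wirt (-I) (holoLift F) z = _ :=
    wirt_smul ((hF.diff_n z).fun_inv (n_ne_zero hz)) (hF.diff_h z)
  rw [e1, holoLift, hF.dz_h, cross7_add_right, cross7_smul_left, cross7_smul_left,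
    cross7_smul_right, cross7_smul_right, cross7_smul_right, cross7_self, hF.cross_h_k]
  simp

end IsAlmostComplexLift

/-! ### Osculating spaces of a curve in a moving frame -/

section MovingFrame

open Complex Filter

variable {E : Type*} [NormedAddCommGroup E] [NormedSpace ℂ E]

/-- `g` is a combination of `e₀, …, e_{j-1}` with smooth coefficients on `U`. -/
def InFrame (U : Set ℂ) (e : ℕ → ℂ → E) : ℕ → (ℂ → E) → Prop
  | 0, g => ∀ z ∈ U, g z = 0
  | j + 1, g => ∃ (r : ℂ → ℂ) (g' : ℂ → E), (∀ z ∈ U, ContDiffAt ℝ ∞ r z) ∧ InFrame U e j g' ∧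
      ∀ z ∈ U, g z = g' z + r z • e j z

variable {U : Set ℂ} {e : ℕ → ℂ → E}

theorem InFrame.add_last {j : ℕ} {g : ℂ → E} {t : ℂ → ℂ} (h : InFrame U e (j + 1) g)
    (ht : ∀ z ∈ U, ContDiffAt ℝ ∞ t z) : InFrame U e (j + 1) fun z => g z + t z • e j z := by
  obtain ⟨r, q, hr, hq, hgq⟩ := h
  refine ⟨fun z => r z + t z, q, fun z hz => (hr z hz).add (ht z hz), hq, fun z hz => ?_⟩
  simp only
  rw [hgq z hz, add_smul, add_assoc]

theorem InFrame.contDiffAt (hU : IsOpen U) (he : ∀ i, ∀ z ∈ U, ContDiffAt ℝ ∞ (e i) z) {j : ℕ}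
    {g : ℂ → E} (h : InFrame U e j g) : ∀ z ∈ U, ContDiffAt ℝ ∞ g z := by
  induction j generalizing g with
  | zero =>
    intro z hz
    exact (contDiffAt_const (c := (0 : E))).congr_of_eventuallyEq
      (eventually_of_mem (hU.mem_nhds hz) h)
  | succ j ih =>
    obtain ⟨r, q, hr, hq, hgq⟩ := h
    intro z hz
    exact ((ih hq z hz).add ((hr z hz).smul (he j z hz))).congr_of_eventuallyEq
      (eventually_of_mem (hU.mem_nhds hz) hgq)

variable {p q : ℕ → ℂ → ℂ} {m : ℕ}

theorem InFrame.wirt (hU : IsOpen U) (he : ∀ i, ∀ z ∈ U, ContDiffAt ℝ ∞ (e i) z)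
    (hp : ∀ i, ∀ z ∈ U, ContDiffAt ℝ ∞ (p i) z) (hq : ∀ i, ∀ z ∈ U, ContDiffAt ℝ ∞ (q i) z)
    {s : ℂ} (hrec : ∀ i < m, ∀ z ∈ U, wirt s (e i) z = p i z • e (i + 1) z + q i z • e i z) {j : ℕ}
    (hj : j ≤ m) {g : ℂ → E} (h : InFrame U e j g) : InFrame U e (j + 1) (wirt s g) := by
  induction j generalizing g with
  | zero =>
    refine ⟨fun _ => 0, fun _ => 0, fun z _ => contDiffAt_const, fun z _ => rfl, fun z hz => ?_⟩
    have e1 : g =ᶠ[𝓝 z] fun _ => 0 := eventually_of_mem (hU.mem_nhds hz) h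
    rw [e1.wirt_eq, wirt_const]; simp
  | succ j ih =>
    obtain ⟨r, g', hr, hg', hgq⟩ := h
    have h1 : InFrame U e (j + 1) fun z =>
        _root_.wirt s g' z + (_root_.wirt s r z + r z * q j z) • e j z :=
      (ih (by omega) hg').add_last fun z hz => (hr z hz).wirt.add ((hr z hz).mul (hq j z hz))
    refine ⟨fun z => r z * p j z, _, fun z hz => (hr z hz).mul (hp j z hz), h1, fun z hz => ?_⟩
    have e1 : g =ᶠ[𝓝 z] fun z => g' z + r z • e j z := eventually_of_mem (hU.mem_nhds hz) hgq
    have d1 := (hr z hz).differentiableAt (by simp)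
    have d2 := (he j z hz).differentiableAt (by simp)
    rw [e1.wirt_eq, wirt_add ((hg'.contDiffAt hU he z hz).differentiableAt (by simp))
      (d1.fun_smul d2), wirt_smul d1 d2, hrec j (by omega) z hz]
    module

/-- Each derivative climbs one step in the frame, and its leading coefficient is `r` times a product
of the `p i`. The passage from frame to derivatives is thus triangular with nonvanishing diagonal.
-/
theorem inFrame_iterate (hU : IsOpen U) (he : ∀ i, ∀ z ∈ U, ContDiffAt ℝ ∞ (e i) z)
    (hp : ∀ i, ∀ z ∈ U, ContDiffAt ℝ ∞ (p i) z) (hq : ∀ i, ∀ z ∈ U, ContDiffAt ℝ ∞ (q i) z)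
    {s : ℂ} (hrec : ∀ i < m, ∀ z ∈ U, wirt s (e i) z = p i z • e (i + 1) z + q i z • e i z)
    (hp0 : ∀ i < m, ∀ z ∈ U, p i z ≠ 0) {g : ℂ → E} {r : ℂ → ℂ}
    (hr : ∀ z ∈ U, ContDiffAt ℝ ∞ r z) (hr0 : ∀ z ∈ U, r z ≠ 0) (hg : ∀ z ∈ U, g z = r z • e 0 z)
    {j : ℕ} (hj : j ≤ m) : ∃ (t : ℂ → ℂ) (g' : ℂ → E), (∀ z ∈ U, ContDiffAt ℝ ∞ t z) ∧
      (∀ z ∈ U, t z ≠ 0) ∧ InFrame U e j g' ∧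
      ∀ z ∈ U, (wirt s)^[j] g z = g' z + t z • e j z := by
  induction j with
  | zero => exact ⟨r, fun _ => 0, hr, hr0, fun z _ => rfl, fun z hz => by simpa using hg z hz⟩
  | succ j ih =>
    obtain ⟨t, g', ht, ht0, hg', hgt⟩ := ih (by omega)
    refine ⟨fun z => t z * p j z, _, fun z hz => (ht z hz).mul (hp j z hz),
      fun z hz => mul_ne_zero (ht0 z hz) (hp0 j (by omega) z hz),
      (hg'.wirt hU he hp hq hrec (by omega)).add_last
        (t := fun z => wirt s t z + t z * q j z) fun z hz =>
          (ht z hz).wirt.add ((ht z hz).mul (hq j z hz)), fun z hz => ?_⟩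
    rw [Function.iterate_succ_apply']
    have e1 : (wirt s)^[j] g =ᶠ[𝓝 z] fun z => g' z + t z • e j z :=
      eventually_of_mem (hU.mem_nhds hz) hgt
    have d1 := (ht z hz).differentiableAt (by simp)
    have d2 := (he j z hz).differentiableAt (by simp)
    rw [e1.wirt_eq, wirt_add ((hg'.contDiffAt hU he z hz).differentiableAt (by simp))
      (d1.fun_smul d2), wirt_smul d1 d2, hrec j (by omega) z hz]
    module

theorem InFrame.apply_eq_zero {j : ℕ} {g : ℂ → E} (h : InFrame U e j g) {z : ℂ} (hz : z ∈ U)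
    (ℓ : E →ₗ[ℂ] ℂ) (hℓ : ∀ i < j, ℓ (e i z) = 0) : ℓ (g z) = 0 := by
  induction j generalizing g with
  | zero => rw [h z hz, map_zero]
  | succ j ih =>
    obtain ⟨r, g', -, hg', hgq⟩ := h
    rw [hgq z hz, map_add, map_smul, ih hg' fun i hi => hℓ i (by omega), hℓ j (by omega)]
    simp

/-- A linear form which annihilates the derivatives of `r e₀` annihilates the frame. -/
theorem annihilates_frame (hU : IsOpen U) (he : ∀ i, ∀ z ∈ U, ContDiffAt ℝ ∞ (e i) z)
    (hp : ∀ i, ∀ z ∈ U, ContDiffAt ℝ ∞ (p i) z) (hq : ∀ i, ∀ z ∈ U, ContDiffAt ℝ ∞ (q i) z)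
    {s : ℂ} (hrec : ∀ i < m, ∀ z ∈ U, wirt s (e i) z = p i z • e (i + 1) z + q i z • e i z)
    (hp0 : ∀ i < m, ∀ z ∈ U, p i z ≠ 0) {g : ℂ → E} {r : ℂ → ℂ}
    (hr : ∀ z ∈ U, ContDiffAt ℝ ∞ r z) (hr0 : ∀ z ∈ U, r z ≠ 0) (hg : ∀ z ∈ U, g z = r z • e 0 z)
    {z : ℂ} (hz : z ∈ U) (ℓ : E →ₗ[ℂ] ℂ) (hℓ : ∀ j ≤ m, ℓ ((wirt s)^[j] g z) = 0) {j : ℕ}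
    (hj : j ≤ m) : ℓ (e j z) = 0 := by
  induction j using Nat.strong_induction_on with
  | _ j ih =>
    obtain ⟨t, g', -, ht0, hg', hgt⟩ := inFrame_iterate hU he hp hq hrec hp0 hr hr0 hg hj
    have h1 := hℓ j hj
    rw [hgt z hz, map_add, map_smul,
      hg'.apply_eq_zero hz ℓ fun i hi => ih i hi (by omega), zero_add] at h1
    exact (smul_eq_zero.mp h1).resolve_left (ht0 z hz)

end MovingFrame

/-! ### Linear fullness of the directrix. -/

namespace IsAlmostComplexLift

open Complex AC Filter

variable {F : ℂ → Fin 7 → ℂ} (hF : IsAlmostComplexLift F) {z : ℂ} (hz : h F z ≠ 0)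

include hF hz

/-- The derivatives up to order six of the holomorphic lift of the directrix curve span `ℂ⁷`. -/
theorem lift_full (hS : ∀ z, sextic F z = 0) {v : Fin 7 → ℂ}
    (hv : ∀ j ≤ 6, (wirt (-I))^[j] (holoLift F) z ⬝ᵥ v = 0) : v = 0 := by
  set U : Set ℂ := {z | h F z ≠ 0}
  have hU : IsOpen U := isOpen_ne_fun hF.smooth_h.continuous continuous_const
  -- Under ∂ each member h, k, a, F, ā, b̄ goes to the next plus a multiple of itself. The last
  -- member c̄ stands in for h̄, which the conjugate of `exists_dbar_k` recovers from ā, b̄, c̄.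
  set E : ℕ → ℂ → Fin 7 → ℂ := fun i => match i with
    | 0 => h F
    | 1 => k F
    | 2 => a F
    | 3 => F
    | 4 => fun z => star (a F z)
    | 5 => fun z => star (b F z)
    | _ => fun z => star (c F z)
  set p : ℕ → ℂ → ℂ := fun i => match i with
    | 0 => fun _ => I
    | 1 => fun z => -((star (k F z) ⬝ᵥ k F z) * (e F z)⁻¹ * (e F z)⁻¹)
    | 2 => fun z => -(e F z)
    | _ => fun _ => 1
  set q : ℕ → ℂ → ℂ := fun i => match i with
    | 1 => fun z => star (s F z) * (e F z)⁻¹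
    | _ => fun _ => 0
  have hei : ∀ z ∈ U, ContDiffAt ℝ ∞ (fun z => (e F z)⁻¹) z := fun z hz =>
    hF.smooth_e.contDiffAt.inv (e_ne_zero hz)
  have hE : ∀ i, ∀ z ∈ U, ContDiffAt ℝ ∞ (E i) z := by
    intro i z hz
    match i with
    | 0 => exact hF.smooth_h.contDiffAt
    | 1 => exact hF.smooth_k.contDiffAt
    | 2 => exact hF.smooth_a.contDiffAt
    | 3 => exact hF.smooth.contDiffAt
    | 4 => exact hF.smooth_a.star_fun.contDiffAt
    | 5 => exact hF.smooth_b.star_fun.contDiffAt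
    | (i + 6) => exact hF.smooth_c.star_fun.contDiffAt
  have hp : ∀ i, ∀ z ∈ U, ContDiffAt ℝ ∞ (p i) z := by
    intro i z hz
    match i with
    | 0 => exact contDiffAt_const
    | 1 => exact (((hF.smooth_k.star_fun.dot hF.smooth_k).contDiffAt.mul (hei z hz)).mul
        (hei z hz)).neg
    | 2 => exact hF.smooth_e.neg.contDiffAt
    | (i + 3) => exact contDiffAt_const
  have hq : ∀ i, ∀ z ∈ U, ContDiffAt ℝ ∞ (q i) z := by
    intro i z hz
    match i with
    | 0 => exact contDiffAt_const
    | 1 => exact hF.smooth_s.star_fun.contDiffAt.mul (hei z hz)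
    | (i + 2) => exact contDiffAt_const
  have hp0 : ∀ i < 6, ∀ z ∈ U, p i z ≠ 0 := by
    intro i _ z hz
    match i with
    | 0 => exact I_ne_zero
    | 1 =>
      have h1 := inv_ne_zero (e_ne_zero hz)
      exact neg_ne_zero.mpr (mul_ne_zero (mul_ne_zero (star_k_dot_k_ne_zero (k_ne_zero hz)) h1) h1)
    | 2 => exact neg_ne_zero.mpr (e_ne_zero hz)
    | (i + 3) => exact one_ne_zero
  have hrec : ∀ i < 6, ∀ z ∈ U,
      wirt (-I) (E i) z = p i z • E (i + 1) z + q i z • E i z := by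
    intro i hi z hz
    have he := e_ne_zero hz
    match i with
    | 0 => simp only [E, p, q, hF.dz_h]; simp
    | 1 =>
      simp only [E, p, q, hF.dz_k, star_k_dot_k]
      rw [k]
      match_scalars
      · field_simp
      · field_simp
        ring
    | 2 => simp only [E, p, q, hF.dz_a]; simp
    | 3 => simp only [E, p, q, hF.dz_F]; simp
    | 4 => simp only [E, p, q, dz_star_a]; simp
    | 5 =>
      simp only [E, p, q]
      rw [wirt_star]; simp [c]
    | (i + 6) => omega
  have key : ∀ j ≤ 6, E j z ⬝ᵥ v = 0 := fun j hj =>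
    annihilates_frame hU hE hp hq hrec hp0 (r := fun z => (n F z)⁻¹) (g := holoLift F)
      (fun z hz => hF.smooth_n.contDiffAt.inv (n_ne_zero hz))
      (fun z hz => inv_ne_zero (n_ne_zero hz)) (fun z hz => rfl) (z := z) hz
      (LinearMap.flip (dotProductBilin ℂ ℂ) v) hv hj
  have v0 : h F z ⬝ᵥ v = 0 := key 0 (by norm_num)
  have v1 : k F z ⬝ᵥ v = 0 := key 1 (by norm_num)
  have v2 : a F z ⬝ᵥ v = 0 := key 2 (by norm_num)
  have v3 : F z ⬝ᵥ v = 0 := key 3 (by norm_num)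
  have v4 : star (a F z) ⬝ᵥ v = 0 := key 4 (by norm_num)
  have v5 : star (b F z) ⬝ᵥ v = 0 := key 5 (by norm_num)
  have v6 : star (c F z) ⬝ᵥ v = 0 := key 6 (by norm_num)
  have he := e_ne_zero hz
  have vb : b F z ⬝ᵥ v = 0 := by
    rw [k, sub_dotProduct, smul_dotProduct, smul_dotProduct, v2, smul_zero, sub_zero] at v1
    exact (smul_eq_zero.mp v1).resolve_left he
  have vh : star (h F z) ⬝ᵥ v = 0 := by
    obtain ⟨y, hy⟩ := hF.exists_dbar_k hS hz
    have h1 : (I * e F z / 2) • h F z = e F z • c F z - wirt I (s F) z • a F z - y • k F z := by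
      rw [← hF.dbar_k, hy]; abel
    have h2 := congrArg (fun x => star x ⬝ᵥ v) h1
    simp only [k, star_sub, star_smul, sub_dotProduct, smul_dotProduct, v4, v5, v6, smul_zero,
      sub_zero] at h2
    refine (smul_eq_zero.mp h2).resolve_left ?_
    refine star_ne_zero.mpr ?_
    exact div_ne_zero (mul_ne_zero I_ne_zero he) two_ne_zero
  have hFF : cross7 (F z) (cross7 (F z) v) = -v := by
    rw [cross7_cross7_self, v3, hF.unit]; simp
  have hdot : ∀ {x : Fin 7 → ℂ} {t : ℂ}, cross7 (F z) x = t • x →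
      x ⬝ᵥ cross7 (F z) v = -(t * (x ⬝ᵥ v)) := by
    intro x t hx
    rw [dotProduct_comm, cross7_dot_swap_right, hx, smul_dotProduct, smul_eq_mul]
  -- As F · v = 0, the vectors v ± i F × v are twice the components of v in the eigenspaces for ∓i.
  -- Each is killed separately, the second after conjugation.
  have w1 : v + I • cross7 (F z) v = 0 := by
    refine hF.eigen_eq_zero_of_star_a_star_k hz ?_ ?_ ?_ ?_
    · rw [cross7_add_right, cross7_smul_right, hFF]
      match_scalars
      · simp
      · simp
    · rw [dotProduct_add, dotProduct_smul, hdot (hF.F_star_a z), v4]; simp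
    · rw [dotProduct_add, dotProduct_smul, hdot (hF.F_star_b z), v5]; simp
    · rw [dotProduct_add, dotProduct_smul, hdot (hF.F_h z), v0]; simp
  have w2 : star (v - I • cross7 (F z) v) = 0 := by
    have hconj : ∀ x : Fin 7 → ℂ, x ⬝ᵥ (v - I • cross7 (F z) v) = 0 →
        star x ⬝ᵥ star (v - I • cross7 (F z) v) = 0 := fun x hx => by
      rw [← star_dot, hx, star_zero]
    refine hF.eigen_eq_zero_of_star_a_star_k hz ?_ (hconj _ ?_) (hconj _ ?_) ?_
    · have : cross7 (F z) (v - I • cross7 (F z) v) = I • (v - I • cross7 (F z) v) := by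
        rw [cross7_sub_right, cross7_smul_right, hFF]
        match_scalars
        · simp
        · simp
      simpa using hF.F_star this
    · rw [dotProduct_sub, dotProduct_smul, hdot (hF.F_a z), v2]; simp
    · rw [dotProduct_sub, dotProduct_smul, hdot (hF.F_b z), vb]; simp
    · have := hconj (star (h F z)) (by
        rw [dotProduct_sub, dotProduct_smul, hdot (hF.F_star_h z), vh]; simp)
      rwa [star_star] at this
  have w3 : v - I • cross7 (F z) v = 0 := star_eq_zero.mp w2
  have : (2 : ℂ) • v = 0 := by
    linear_combination (norm := module) w1 + w3
  simpa using this

end IsAlmostComplexLift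

/-! ### Isolated zeros. -/

section IsolatedZeros

open Filter

theorem eventually_ne_zero_of_lower_bound {E : Type*} [NormedAddCommGroup E] {g : ℂ → E} {z₀ : ℂ}
    {m : ℕ} {r : ℝ} (hr : 0 < r) (h : ∀ᶠ z in 𝓝 z₀, r * ‖z - z₀‖ ^ m ≤ ‖g z‖) :
    ∀ᶠ z in 𝓝[≠] z₀, g z ≠ 0 := by
  filter_upwards [h.filter_mono nhdsWithin_le_nhds, self_mem_nhdsWithin] with z hz hne h0
  rw [h0, norm_zero] at hz
  have : 0 < ‖z - z₀‖ := norm_pos_iff.mpr (sub_ne_zero.mpr hne)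
  have : 0 < r * ‖z - z₀‖ ^ m := by positivity
  linarith

theorem finite_zeros_of_isolated {E : Type*} [Zero E] {g : ℂ → E}
    (h : ∀ z₀, ∀ᶠ z in 𝓝[≠] z₀, g z ≠ 0) {K : Set ℂ} (hK : IsCompact K) :
    ({z | g z = 0} ∩ K).Finite := by
  by_contra hinf
  obtain ⟨x, -, hx⟩ := Set.Infinite.exists_accPt_of_subset_isCompact hinf hK Set.inter_subset_right
  rw [accPt_iff_frequently_nhdsNE] at hx
  exact hx ((h x).mono fun z hz hz' => hz hz'.1)

/-- Countability is what makes the complement of the zero set connected in the plane. -/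
theorem countable_zeros_of_isolated {E : Type*} [Zero E] {g : ℂ → E}
    (h : ∀ z₀, ∀ᶠ z in 𝓝[≠] z₀, g z ≠ 0) : {z | g z = 0}.Countable := by
  have : {z | g z = 0} = ⋃ m : ℕ, {z | g z = 0} ∩ Metric.closedBall 0 m := by
    rw [← Set.inter_iUnion, Metric.iUnion_closedBall_nat, Set.inter_univ]
  rw [this]
  exact Set.countable_iUnion fun m =>
    (finite_zeros_of_isolated h (isCompact_closedBall _ _)).countable

end IsolatedZeros

/-! ### Curves with h identically zero are not full. -/

namespace IsAlmostComplexLift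

open Complex AC Filter

theorem exists_real_orthogonal (x y : Fin 7 → ℂ) :
    ∃ v : Fin 7 → ℝ, v ≠ 0 ∧ (fun i => (v i : ℂ)) ⬝ᵥ x = 0 ∧ (fun i => (v i : ℂ)) ⬝ᵥ y = 0 := by
  let f : (Fin 7 → ℝ) →ₗ[ℝ] ℂ × ℂ :=
    { toFun := fun v => ((fun i => (v i : ℂ)) ⬝ᵥ x, (fun i => (v i : ℂ)) ⬝ᵥ y)
      map_add' := fun u v => by
        ext <;> simp [dotProduct, add_mul, Finset.sum_add_distrib]
      map_smul' := fun r v => by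
        ext <;> simp [dotProduct, mul_assoc, Finset.mul_sum] }
  have h : LinearMap.ker f ≠ ⊥ := f.ker_ne_bot_of_finrank_lt (by
    rw [Module.finrank_prod, Complex.finrank_real_complex, Module.finrank_fin_fun]; norm_num)
  obtain ⟨v, hv, hv0⟩ := Submodule.exists_mem_ne_zero_of_ne_bot h
  have h1 : f v = 0 := hv
  exact ⟨v, hv0, congrArg Prod.fst h1, congrArg Prod.snd h1⟩

theorem star_ofReal_vec (v : Fin 7 → ℝ) :
    star (fun i => (v i : ℂ)) = fun i => (v i : ℂ) := by
  funext i; simp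

variable {F : ℂ → Fin 7 → ℂ} (hF : IsAlmostComplexLift F)

include hF

theorem eq_const_of_a_eq_zero (ha : ∀ z, a F z = 0) (z : ℂ) : F z = F 0 := by
  refine is_const_of_fderiv_eq_zero (𝕜 := ℝ) (hF.smooth.differentiable (by simp)) (fun w => ?_) z 0
  ext1 v
  rw [fderiv_eq_wirt, hF.dz_F, ← a, ha]
  simp

/-- If `h` vanishes identically then the curve lies in a proper linear subspace. -/
theorem exists_orthogonal_of_h_eq_zero (hh : ∀ z, h F z = 0) :
    ∃ v : Fin 7 → ℝ, v ≠ 0 ∧ ∀ z, (fun i => (v i : ℂ)) ⬝ᵥ F z = 0 := by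
  rcases hF.a_dichotomy with ha | ha
  · obtain ⟨v, hv0, hv, -⟩ := exists_real_orthogonal (F 0) 0
    exact ⟨v, hv0, fun z => by rw [hF.eq_const_of_a_eq_zero ha, hv]⟩
  have hiso : ∀ z₀, ∀ᶠ z in 𝓝[≠] z₀, a F z ≠ 0 := fun z₀ => by
    obtain ⟨m, r, hr, h1⟩ := ha z₀
    exact eventually_ne_zero_of_lower_bound hr h1
  obtain ⟨p, hp⟩ := (hiso 0).exists
  obtain ⟨v, hv0, hv1, hv2⟩ := exists_real_orthogonal (F p) (a F p)
  refine ⟨v, hv0, ?_⟩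
  set V : Fin 7 → ℂ := fun i => (v i : ℂ)
  have hV : star V = V := star_ofReal_vec v
  set U : Set ℂ := {z | a F z = 0}ᶜ
  have hUo : IsOpen U := (isClosed_eq hF.smooth_a.continuous continuous_const).isOpen_compl
  have hUc : IsPreconnected U := (Set.Countable.isPathConnected_compl_of_one_lt_rank
    (by rw [Complex.rank_real_complex]; norm_num)
    (countable_zeros_of_isolated hiso)).isConnected.isPreconnected
  have he : ∀ z ∈ U, e F z ≠ 0 := fun z hz => star_dot_self_ne_zero hz
  set x : ℂ → ℂ := fun z => V ⬝ᵥ F z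
  set y : ℂ → ℂ := fun z => V ⬝ᵥ a F z
  set y' : ℂ → ℂ := fun z => V ⬝ᵥ star (a F z)
  have hV' : ContDiff ℝ ∞ fun _ : ℂ => V := contDiff_const
  have dx : ∀ z, DifferentiableAt ℝ x z := (hV'.dot hF.smooth).differentiable (by simp)
  have dy : ∀ z, DifferentiableAt ℝ y z := (hV'.dot hF.smooth_a).differentiable (by simp)
  have dy' : ∀ z, DifferentiableAt ℝ y' z :=
    (hV'.dot hF.smooth_a.star_fun).differentiable (by simp)
  have wV : ∀ {g : ℂ → Fin 7 → ℂ} {z : ℂ}, DifferentiableAt ℝ g z →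
      wirt I (fun z => V ⬝ᵥ g z) z = V ⬝ᵥ wirt I g z := fun hg =>
    (wirt_dot (differentiableAt_const V) hg).trans (by rw [wirt_const, zero_dotProduct, zero_add])
  have wx : ∀ z, wirt I x z = y z := fun z => wV (hF.diff_F z)
  have wy : ∀ z, wirt I y z = V ⬝ᵥ b F z := fun z => wV (hF.diff_a z)
  have wy' : ∀ z, wirt I y' z = -(e F z * x z) := fun z => by
    rw [show wirt I y' z = _ from wV (hF.diff_star_a z), hF.dbar_star_a, dotProduct_smul,
      smul_eq_mul, neg_mul]
  have sx : ∀ z, star (x z) = x z := fun z => by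
    change star (V ⬝ᵥ F z) = _; rw [star_dot, hV, hF.real]
  have sy : ∀ z, star (y z) = y' z := fun z => by
    change star (V ⬝ᵥ a F z) = _; rw [star_dot, hV]
  have sy' : ∀ z, star (y' z) = y z := fun z => by rw [← sy, star_star]
  -- This is the squared length of the projection of the real vector `V` to span(F, a, ā). When h =
  -- 0, b is a multiple of a off the zeros of a. The span is then parallel and `q` is constant, with
  -- value 0 at `p` by the choice of `v`.
  set q : ℂ → ℂ := fun z => x z * x z + (2 : ℂ) • (y z * y' z * (e F z)⁻¹)
  have dq : ∀ z ∈ U, DifferentiableAt ℝ q z := fun z hz =>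
    ((dx z).fun_mul (dx z)).fun_add
      ((((dy z).fun_mul (dy' z)).fun_mul ((hF.diff_e z).fun_inv (he z hz))).fun_const_smul (2 : ℂ))
  have wq : ∀ z ∈ U, wirt I q z = 0 := by
    intro z hz
    have hez := he z hz
    have dyy := (dy z).fun_mul (dy' z)
    have dyye := dyy.fun_mul ((hF.diff_e z).fun_inv hez)
    have hb : e F z * (V ⬝ᵥ b F z) = s F z * y z := by
      have : k F z = 0 := by rw [hF.k_eq, hh, cross7_zero_right, smul_zero]
      rw [k, sub_eq_zero] at this
      have h2 := congrArg (fun u => V ⬝ᵥ u) this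
      simpa [dotProduct_smul] using h2
    rw [wirt_add ((dx z).fun_mul (dx z)) (dyye.fun_const_smul (2 : ℂ)), wirt_const_smul _ dyye,
      wirt_mul dyy ((hF.diff_e z).fun_inv hez), wirt_mul (dx z) (dx z), wirt_mul (dy z) (dy' z),
      wirt_inv (hF.diff_e z) hez, hF.dbar_e, wx, wy, wy', smul_eq_mul]
    field_simp
    linear_combination 2 * y' z * hb
  have sq : ∀ z, star (q z) = q z := fun z => by
    simp only [q, star_add, star_smul, star_mul', star_inv₀, star_e, sx, sy, sy']
    simp only [smul_eq_mul, star_ofNat]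
    ring
  have wq' : ∀ z ∈ U, wirt (-I) q z = 0 := by
    intro z hz
    have h1 := wirt_star (s := -I) (g := q) (z := z)
    rw [show (fun z => star (q z)) = q from funext sq] at h1
    rw [h1, show star (-I) = I by simp, wq z hz, star_zero]
  have hq0 : q p = 0 := by
    have h1 : x p = 0 := hv1
    have h2 : y p = 0 := hv2
    simp [q, h1, h2]
  have hqU : ∀ z ∈ U, q z = 0 := by
    intro z hz
    rw [← hq0]
    refine hUo.is_const_of_fderiv_eq_zero (𝕜 := ℝ) hUc
      (fun w hw => (dq w hw).differentiableWithinAt) (fun w hw => ?_) hz hp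
    ext1 u
    rw [fderiv_eq_wirt, wq w hw, wq' w hw]
    simp
  have hxU : ∀ z ∈ U, x z = 0 := by
    intro z hz
    have h1 := hqU z hz
    have e1 : e F z = ((∑ i, ‖a F z i‖ ^ 2 : ℝ) : ℂ) := star_dot_self_eq_ofReal _
    have e2 : x z = ((x z).re : ℂ) := (Complex.conj_eq_iff_re.mp (sx z)).symm
    have e3 : y z * y' z = ((Complex.normSq (y z) : ℝ) : ℂ) := by
      rw [← sy]; exact Complex.mul_conj _
    simp only [q] at h1
    rw [e3, e1, e2] at h1
    have h2 : (x z).re * (x z).re +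
        2 * (Complex.normSq (y z) * (∑ i, ‖a F z i‖ ^ 2)⁻¹) = 0 := by
      rw [smul_eq_mul] at h1
      exact_mod_cast h1
    have h3 : 0 ≤ 2 * (Complex.normSq (y z) * (∑ i, ‖a F z i‖ ^ 2)⁻¹) := by
      have := Complex.normSq_nonneg (y z)
      positivity
    have h4 : (x z).re = 0 := by nlinarith [mul_self_nonneg (x z).re]
    rw [e2, h4, ofReal_zero]
  intro z
  have hzcl : ∃ᶠ w in 𝓝[≠] z, x w = 0 := ((hiso z).mono fun w hw => hxU w hw).frequently
  have hclosed : IsClosed {w | x w = 0} :=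
    isClosed_eq (hV'.dot hF.smooth).continuous continuous_const
  exact hclosed.mem_of_frequently_of_tendsto hzcl (tendsto_id.mono_left nhdsWithin_le_nhds)

end IsAlmostComplexLift

/-! ### Curves on the Riemann sphere -/

section Sphere

open Complex Filter

/-- The complexified local expression of a map `S² → S⁶`. -/
noncomputable def localLift (f : RiemannSphere → SixSphere) (c : Bool) (z : ℂ) : Fin 7 → ℂ :=
  fun i => (localExpr f c z i : ℂ)

theorem sphereParam_inv (c : Bool) {w : ℂ} (hw : w ≠ 0) :
    sphereParam (!c) w = sphereParam c w⁻¹ := by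
  cases c
  · simp [sphereParam, hw]
  · simp [sphereParam, hw]

theorem sphereParam_injective (c : Bool) : Function.Injective (sphereParam c) := by
  cases c
  · exact OnePoint.coe_injective
  · intro z w h
    by_cases hz : z = 0 <;> by_cases hw : w = 0
    · rw [hz, hw]
    · simp [sphereParam, hz, hw] at h
    · simp [sphereParam, hz, hw] at h
    · simpa [sphereParam, hz, hw] using h

/-- Every point of the sphere has a coordinate of norm at most one. -/
theorem exists_sphereParam (p : RiemannSphere) : ∃ c z, ‖z‖ ≤ 1 ∧ sphereParam c z = p := by
  induction p using OnePoint.rec with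
  | infty => exact ⟨true, 0, by simp, by simp [sphereParam]⟩
  | coe z =>
    rcases le_total ‖z‖ 1 with h | h
    · exact ⟨false, z, h, rfl⟩
    · have hz : z ≠ 0 := fun h0 => by simp [h0] at h; linarith
      refine ⟨true, z⁻¹, ?_, by simp [sphereParam, hz]⟩
      rw [norm_inv]; exact inv_le_one_of_one_le₀ h

variable {f : RiemannSphere → SixSphere}

theorem localLift_inv (c : Bool) {w : ℂ} (hw : w ≠ 0) :
    localLift f (!c) w = localLift f c w⁻¹ := by
  funext i
  simp only [localLift, localExpr, sphereParam_inv c hw]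

/-- Complex linearity gives F × F_x = F_y and F × F_y = -F_x, so F_x + i F_y is an eigenvector for
-i. -/
theorem IsAlmostComplexCurve.isAlmostComplexLift (hf : IsAlmostComplexCurve f) (c : Bool) :
    IsAlmostComplexLift (localLift f c) := by
  obtain ⟨hs, hJ⟩ := hf c
  let L : (Fin 7 → ℝ) →L[ℝ] (Fin 7 → ℂ) :=
    ContinuousLinearMap.pi fun i => Complex.ofRealCLM.comp (ContinuousLinearMap.proj i)
  have hL : localLift f c = fun z => L (localExpr f c z) := rfl
  have hd : ∀ z v, fderiv ℝ (localLift f c) z v = L (fderiv ℝ (localExpr f c) z v) := by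
    intro z v
    have : HasFDerivAt (localLift f c) (L.comp (fderiv ℝ (localExpr f c) z)) z :=
      L.hasFDerivAt.comp z (hs.differentiable (by simp) z).hasFDerivAt
    rw [this.fderiv]; rfl
  have hLc : ∀ u v, cross7 (L u) (L v) = L (cross7 u v) := fun u v =>
    cross7_map Complex.ofRealHom u v
  refine ⟨?_, fun z => ?_, fun z => ?_, fun z => ?_⟩
  · rw [hL]; exact L.contDiff.comp hs
  · exact IsAlmostComplexLift.star_ofReal_vec _
  · have h1 : ‖(f (sphereParam c z)).1‖ = 1 := by simp
    rw [EuclideanSpace.norm_eq, Real.sqrt_eq_one] at h1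
    have h2 : localLift f c z ⬝ᵥ localLift f c z =
        ((∑ i, ‖(f (sphereParam c z)).1 i‖ ^ 2 : ℝ) : ℂ) := by
      simp [dotProduct, localLift, localExpr, sq]
    rw [h2, h1, ofReal_one]
  · have h1 := hJ z 1
    have h2 := hJ z I
    rw [mul_one] at h1
    rw [I_mul_I, map_neg] at h2
    have k1 : cross7 (localLift f c z) (fderiv ℝ (localLift f c) z 1) =
        fderiv ℝ (localLift f c) z I := by
      rw [hd, hd, h1]; exact hLc _ _
    have k2 : cross7 (localLift f c z) (fderiv ℝ (localLift f c) z I) =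
        -fderiv ℝ (localLift f c) z 1 := by
      rw [hd, hd, ← map_neg, h2]; exact hLc _ _
    rw [wirt, cross7_smul_right, cross7_add_right, cross7_smul_right, k1, k2]
    match_scalars
    · linear_combination (1 / 2 : ℂ) * I_mul_I
    · ring

theorem IsLinearlyFull.exists_dot_ne_zero (hfull : IsLinearlyFull f) {v : Fin 7 → ℝ}
    (hv : v ≠ 0) : ∃ c z, (fun i => (v i : ℂ)) ⬝ᵥ localLift f c z ≠ 0 := by
  by_contra! h
  let φ : EuclideanSpace ℝ (Fin 7) →ₗ[ℝ] ℝ :=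
    { toFun := fun x => v ⬝ᵥ WithLp.ofLp x
      map_add' := fun x y => by simp [dotProduct_add]
      map_smul' := fun r x => by simp [dotProduct_smul] }
  have h1 : LinearMap.ker φ = ⊤ := by
    refine hfull _ fun p => ?_
    obtain ⟨c, z, -, rfl⟩ := exists_sphereParam p
    have h2 := h c z
    have h3 : ((v ⬝ᵥ localExpr f c z : ℝ) : ℂ) = 0 := by
      rw [← h2]; simp [dotProduct, localLift]
    exact_mod_cast h3
  have h4 : φ (WithLp.toLp 2 v) = 0 := by
    have : WithLp.toLp 2 v ∈ LinearMap.ker φ := by rw [h1]; trivial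
    exact this
  exact hv (dotProduct_self_eq_zero.mp h4)

/-- The section spanning the directrix curve of a full curve has isolated zeros of finite order. -/
theorem IsAlmostComplexCurve.h_lower_bound (hf : IsAlmostComplexCurve f)
    (hfull : IsLinearlyFull f) (c : Bool) (z₀ : ℂ) : ∃ m : ℕ, ∃ r > 0,
      ∀ᶠ z in 𝓝 z₀, r * ‖z - z₀‖ ^ m ≤ ‖AC.h (localLift f c) z‖ := by
  have hF := hf.isAlmostComplexLift
  refine ((hF c).h_dichotomy.resolve_left fun h0 => ?_) z₀
  obtain ⟨v, hv0, hv⟩ := (hF c).exists_orthogonal_of_h_eq_zero h0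
  obtain ⟨c', z, hz⟩ := hfull.exists_dot_ne_zero hv0
  rcases eq_or_ne c' c with rfl | hc
  · exact hz (hv z)
  · obtain rfl : c' = !c := by cases c <;> cases c' <;> simp_all
    have hcont : Continuous fun w => (fun i => (v i : ℂ)) ⬝ᵥ localLift f (!c) w :=
      ((contDiff_const (c := fun i => (v i : ℂ))).dot (hF (!c)).smooth).continuous
    have hclosed : IsClosed {w | (fun i => (v i : ℂ)) ⬝ᵥ localLift f (!c) w = 0} :=
      isClosed_eq hcont continuous_const
    -- The two coordinates overlap off 0, so the linear relation transfers there and extends to 0 by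
    -- continuity.
    have : ∀ᶠ w in 𝓝[≠] z, w ≠ 0 := by
      rcases eq_or_ne z 0 with rfl | hz0
      · exact self_mem_nhdsWithin
      · exact (eventually_ne_nhds hz0).filter_mono nhdsWithin_le_nhds
    have hmem : z ∈ {w | (fun i => (v i : ℂ)) ⬝ᵥ localLift f (!c) w = 0} := by
      refine hclosed.mem_of_frequently_of_tendsto (b := 𝓝[≠] z) (f := id)
        (this.mono fun w hw => ?_).frequently (tendsto_id.mono_left nhdsWithin_le_nhds)
      simp only [id, Set.mem_ofPred_eq]
      rw [localLift_inv c hw, hv]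
    exact hz hmem

theorem IsAlmostComplexCurve.eventually_h_ne_zero (hf : IsAlmostComplexCurve f)
    (hfull : IsLinearlyFull f) (c : Bool) (z₀ : ℂ) :
    ∀ᶠ z in 𝓝[≠] z₀, AC.h (localLift f c) z ≠ 0 := by
  obtain ⟨m, r, hr, h⟩ := hf.h_lower_bound hfull c z₀
  exact eventually_ne_zero_of_lower_bound hr h

theorem IsAlmostComplexCurve.sextic_eq_zero (hf : IsAlmostComplexCurve f) (c : Bool) (z : ℂ) :
    IsAlmostComplexLift.sextic (localLift f c) z = 0 :=
  (hf.isAlmostComplexLift c).sextic_eq_zero (fun _ hw => localLift_inv c hw)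
    (hf.isAlmostComplexLift (!c)) z

end Sphere

/-- `F 0` is a holomorphic curve in `ℂ⁷` with derivatives `F 1, F 2, …`, which is annihilated by
the cross product with its derivative and whose derivatives of order at most six span `ℂ⁷`. -/
structure IsSuperhorizontal (U : Set ℂ) (F : ℕ → ℂ → Fin 7 → ℂ) : Prop where
  isOpen : IsOpen U
  deriv : ∀ i, ∀ z ∈ U, HasDerivAt (F i) (F (i + 1) z) z
  cross : ∀ z ∈ U, cross7 (F 0 z) (F 1 z) = 0
  full : ∀ z ∈ U, ∀ v, (∀ j ≤ 6, F j z ⬝ᵥ v = 0) → v = 0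

theorem hasDerivAt_mulVec (A : Matrix (Fin 7) (Fin 7) ℂ) {g : ℂ → Fin 7 → ℂ} {g' : Fin 7 → ℂ}
    {z : ℂ} (hg : HasDerivAt g g' z) : HasDerivAt (fun z => A *ᵥ g z) (A *ᵥ g') z :=
  (LinearMap.toContinuousLinearMap A.mulVecLin).hasFDerivAt.comp_hasDerivAt z hg

/-! ### Superhorizontal curves and their linear equivalences. -/

namespace IsSuperhorizontal

variable {U : Set ℂ} {F : ℕ → ℂ → Fin 7 → ℂ} (hF : IsSuperhorizontal U F)

include hF

theorem bilin_step {E : Type*} [NormedAddCommGroup E] [NormedSpace ℂ E]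
    (B : (Fin 7 → ℂ) →L[ℂ] (Fin 7 → ℂ) →L[ℂ] E) {i j : ℕ}
    (h : ∀ z ∈ U, B (F i z) (F j z) = 0) :
    ∀ z ∈ U, B (F (i + 1) z) (F j z) + B (F i z) (F (j + 1) z) = 0 := by
  intro z hz
  have h1 : HasDerivAt (fun z => B (F i z) (F j z))
      (B (F (i + 1) z) (F j z) + B (F i z) (F (j + 1) z)) z := by
    have := (B.isBoundedBilinearMap.hasFDerivAt (F i z, F j z)).comp_hasDerivAt z
      ((hF.deriv i z hz).prodMk (hF.deriv j z hz))
    refine this.congr_deriv ?_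
    simp [IsBoundedBilinearMap.deriv, add_comm]
  have h2 : HasDerivAt (fun z => B (F i z) (F j z)) 0 z :=
    (hasDerivAt_const z (0 : E)).congr_of_eventuallyEq
      (Filter.eventually_of_mem (hF.isOpen.mem_nhds hz) h)
  exact h1.unique h2

theorem dot_step {i j : ℕ} (h : ∀ z ∈ U, F i z ⬝ᵥ F j z = 0) :
    ∀ z ∈ U, F (i + 1) z ⬝ᵥ F j z + F i z ⬝ᵥ F (j + 1) z = 0 :=
  hF.bilin_step dotL h

theorem cross_step {i j : ℕ} (h : ∀ z ∈ U, cross7 (F i z) (F j z) = 0) :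
    ∀ z ∈ U, cross7 (F (i + 1) z) (F j z) + cross7 (F i z) (F (j + 1) z) = 0 :=
  hF.bilin_step crossL h

theorem linearIndependent {z : ℂ} (hz : z ∈ U) :
    LinearIndependent ℂ fun j : Fin 7 => F j z := by
  set M : Matrix (Fin 7) (Fin 7) ℂ := Matrix.of fun j => F j z
  have h1 : Function.Injective M.mulVec := by
    refine (injective_iff_map_eq_zero M.mulVecLin).mpr fun v hv => ?_
    refine hF.full z hz v fun j hj => ?_
    exact congrFun hv ⟨j, by omega⟩
  exact Matrix.linearIndependent_rows_iff_isUnit.mpr (Matrix.mulVec_injective_iff_isUnit.mp h1)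

theorem ne_zero {z : ℂ} (hz : z ∈ U) : F 0 z ≠ 0 := (hF.linearIndependent hz).ne_zero 0

/-- For u × v = 0 the double product formula reads (u · v) u = (u · u) v, and u, v are independent.
-/
theorem dot_eq_zero_of_cross {z : ℂ} (hz : z ∈ U) {i j : Fin 7} (hij : i ≠ j)
    (h : cross7 (F i z) (F j z) = 0) : F i z ⬝ᵥ F j z = 0 ∧ F i z ⬝ᵥ F i z = 0 := by
  have hli : LinearIndependent ℂ ![F i z, F j z] := by
    have h1 := (hF.linearIndependent hz).comp ![i, j] (by
      intro s t hst
      fin_cases s <;> fin_cases t <;> simp_all [eq_comm])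
    convert h1 using 1
    funext t
    fin_cases t <;> rfl
  have h2 := cross7_cross7_self (F i z) (F j z)
  rw [h, cross7_zero_right, sub_eq_add_neg, ← neg_smul] at h2
  obtain ⟨h3, h4⟩ := hli.eq_zero_of_pair h2.symm
  exact ⟨h3, neg_eq_zero.mp h4⟩

/-! #### Isotropy -/

theorem cross_zero_two : ∀ z ∈ U, cross7 (F 0 z) (F 2 z) = 0 := fun z hz => by
  simpa [cross7_self] using hF.cross_step hF.cross z hz

theorem cross_one_two : ∀ z ∈ U, cross7 (F 1 z) (F 2 z) + cross7 (F 0 z) (F 3 z) = 0 :=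
  hF.cross_step hF.cross_zero_two

theorem cross_three_zero {z : ℂ} (hz : z ∈ U) :
    cross7 (F 3 z) (F 0 z) = cross7 (F 1 z) (F 2 z) := by
  rw [cross7_swap, eq_neg_of_add_eq_zero_right (hF.cross_one_two z hz), neg_neg]

/-- All products of weight at most five vanish, and those of weight six are proportional. -/
theorem isotropic : (∀ i j, i + j ≤ 5 → ∀ z ∈ U, F i z ⬝ᵥ F j z = 0) ∧
    ∀ z ∈ U, F 3 z ⬝ᵥ F 3 z = -(F 0 z ⬝ᵥ F 6 z) := by
  have d00 : ∀ z ∈ U, F 0 z ⬝ᵥ F 0 z = 0 := fun z hz =>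
    (hF.dot_eq_zero_of_cross hz (i := 0) (j := 1) (by decide) (hF.cross z hz)).2
  have d01 : ∀ z ∈ U, F 0 z ⬝ᵥ F 1 z = 0 := fun z hz =>
    (hF.dot_eq_zero_of_cross hz (i := 0) (j := 1) (by decide) (hF.cross z hz)).1
  have d11 : ∀ z ∈ U, F 1 z ⬝ᵥ F 1 z = 0 := fun z hz =>
    (hF.dot_eq_zero_of_cross hz (i := 1) (j := 0) (by decide)
      (by rw [cross7_swap]; exact neg_eq_zero.mpr (hF.cross z hz))).2
  have d22 : ∀ z ∈ U, F 2 z ⬝ᵥ F 2 z = 0 := fun z hz =>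
    (hF.dot_eq_zero_of_cross hz (i := 2) (j := 0) (by decide)
      (by rw [cross7_swap]; exact neg_eq_zero.mpr (hF.cross_zero_two z hz))).2
  have next : ∀ {i j : ℕ}, (∀ z ∈ U, F (i + 1) z ⬝ᵥ F j z = 0) → (∀ z ∈ U, F i z ⬝ᵥ F j z = 0) →
      ∀ z ∈ U, F i z ⬝ᵥ F (j + 1) z = 0 := fun h1 h2 z hz => by
    have := hF.dot_step h2 z hz
    rwa [h1 z hz, zero_add] at this
  have diag : ∀ {i : ℕ}, (∀ z ∈ U, F i z ⬝ᵥ F i z = 0) → ∀ z ∈ U, F i z ⬝ᵥ F (i + 1) z = 0 :=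
    fun h z hz => by
      have := hF.dot_step h z hz
      rw [dotProduct_comm] at this
      linear_combination this / 2
  have d02 := next d11 d01
  have d12 := diag d11
  have d03 := next d12 d02
  have d13 := next d22 d12
  have d04 := next d13 d03
  have d23 := diag d22
  have d14 := next d23 d13
  have d05 := next d14 d04
  have main : ∀ i j, i ≤ j → i + j ≤ 5 → ∀ z ∈ U, F i z ⬝ᵥ F j z = 0 := by
    intro i j hij h
    have hi : i ≤ 2 := by omega
    have hj : j ≤ 5 := by omega
    interval_cases i <;> interval_cases j <;> omega
  refine ⟨fun i j h z hz => ?_, fun z hz => ?_⟩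
  · rcases le_total i j with hij | hij
    · exact main i j hij h z hz
    · rw [dotProduct_comm]; exact main j i hij (by omega) z hz
  · have e1 := hF.dot_step d05 z hz
    have e2 := hF.dot_step d14 z hz
    have e3 := hF.dot_step d23 z hz
    linear_combination e3 - e2 + e1

theorem dot_zero_six_ne_zero {z : ℂ} (hz : z ∈ U) : F 0 z ⬝ᵥ F 6 z ≠ 0 := by
  intro h0
  refine hF.ne_zero hz (hF.full z hz _ fun j hj => ?_)
  rw [dotProduct_comm]
  rcases (show j ≤ 5 ∨ j = 6 by omega) with h | rfl
  · exact hF.isotropic.1 0 j (by omega) z hz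
  · exact h0

/-- A vector orthogonal to the fifth osculating space is a multiple of `F 0`. -/
theorem eq_smul_of_orthogonal {z : ℂ} (hz : z ∈ U) {v : Fin 7 → ℂ}
    (hv : ∀ j ≤ 5, v ⬝ᵥ F j z = 0) :
    v = ((v ⬝ᵥ F 6 z) / (F 0 z ⬝ᵥ F 6 z)) • F 0 z := by
  refine sub_eq_zero.mp (hF.full z hz _ fun j hj => ?_)
  rw [dotProduct_comm, sub_dotProduct, smul_dotProduct, smul_eq_mul]
  rcases (show j ≤ 5 ∨ j = 6 by omega) with h | rfl
  · rw [hv j h, hF.isotropic.1 0 j (by omega) z hz]; simp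
  · rw [div_mul_cancel₀ _ (hF.dot_zero_six_ne_zero hz), sub_self]

theorem linearMap_eq_zero {z : ℂ} (hz : z ∈ U) (ℓ : (Fin 7 → ℂ) →ₗ[ℂ] ℂ)
    (h : ∀ j ≤ 6, ℓ (F j z) = 0) (x : Fin 7 → ℂ) : ℓ x = 0 := by
  have h1 : ∀ y : Fin 7 → ℂ, ℓ y = y ⬝ᵥ fun i => ℓ (Pi.single i 1) := by
    intro y
    rw [LinearMap.pi_apply_eq_sum_univ ℓ y]
    refine Finset.sum_congr rfl fun i _ => ?_
    rw [smul_eq_mul]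
    congr 2
    funext j
    simp [Pi.single_apply, eq_comm]
  have h2 : (fun i => ℓ (Pi.single i 1)) = 0 := hF.full z hz _ fun j hj => by rw [← h1, h j hj]
  rw [h1, h2, dotProduct_zero]

/-- The ratio `(F₁ × F₂) / F₀`. -/
noncomputable def ratio (F : ℕ → ℂ → Fin 7 → ℂ) (z : ℂ) : ℂ :=
  (cross7 (F 1 z) (F 2 z) ⬝ᵥ F 6 z) / (F 0 z ⬝ᵥ F 6 z)

/-- By isotropy the orthogonal complement of the fifth osculating space is the line of F₀, so it
suffices that F₁ × F₂ is orthogonal to F₀, …, F₅. -/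
theorem cross_one_two_eq {z : ℂ} (hz : z ∈ U) :
    cross7 (F 1 z) (F 2 z) = ratio F z • F 0 z := by
  refine hF.eq_smul_of_orthogonal hz fun j hj => ?_
  have tri_step : ∀ {i j k : ℕ}, (∀ z ∈ U, cross7 (F i z) (F j z) ⬝ᵥ F k z = 0) →
      ∀ z ∈ U, cross7 (F (i + 1) z) (F j z) ⬝ᵥ F k z + cross7 (F i z) (F (j + 1) z) ⬝ᵥ F k z +
        cross7 (F i z) (F j z) ⬝ᵥ F (k + 1) z = 0 := by
    intro i j k h z hz
    have e1 : HasDerivAt (fun z => crossL (F i z) (F j z))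
        (cross7 (F (i + 1) z) (F j z) + cross7 (F i z) (F (j + 1) z)) z := by
      have := (crossL.isBoundedBilinearMap.hasFDerivAt (F i z, F j z)).comp_hasDerivAt z
        ((hF.deriv i z hz).prodMk (hF.deriv j z hz))
      refine this.congr_deriv ?_
      simp [IsBoundedBilinearMap.deriv, add_comm, crossL_apply]
    have e2 : HasDerivAt (fun z => dotL (crossL (F i z) (F j z)) (F k z))
        ((cross7 (F (i + 1) z) (F j z) + cross7 (F i z) (F (j + 1) z)) ⬝ᵥ F k z +
          cross7 (F i z) (F j z) ⬝ᵥ F (k + 1) z) z := by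
      have := (dotL.isBoundedBilinearMap.hasFDerivAt
        (crossL (F i z) (F j z), F k z)).comp_hasDerivAt z (e1.prodMk (hF.deriv k z hz))
      refine this.congr_deriv ?_
      simp [IsBoundedBilinearMap.deriv, add_comm, crossL_apply, dotL_apply]
    have e3 : HasDerivAt (fun z => dotL (crossL (F i z) (F j z)) (F k z)) 0 z :=
      (hasDerivAt_const z (0 : ℂ)).congr_of_eventuallyEq
        (Filter.eventually_of_mem (hF.isOpen.mem_nhds hz) h)
    rw [← add_dotProduct]
    exact e2.unique e3
  have h12 : ∀ z ∈ U, ∀ x, cross7 (F 1 z) (F 2 z) ⬝ᵥ x = -(cross7 (F 0 z) (F 3 z) ⬝ᵥ x) :=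
    fun z hz x => by rw [eq_neg_of_add_eq_zero_left (hF.cross_one_two z hz), neg_dotProduct]
  have t123 : ∀ z ∈ U, cross7 (F 1 z) (F 2 z) ⬝ᵥ F 3 z = 0 := fun z hz => by
    rw [h12 z hz, cross7_dot_right, neg_zero]
  have t124 : ∀ z ∈ U, cross7 (F 1 z) (F 2 z) ⬝ᵥ F 4 z = 0 := fun z hz => by
    simpa [cross7_self, cross7_dot_right] using tri_step t123 z hz
  have t034 : ∀ z ∈ U, cross7 (F 0 z) (F 3 z) ⬝ᵥ F 4 z = 0 := fun z hz => by
    have := h12 z hz (F 4 z)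
    rw [t124 z hz] at this
    exact neg_eq_zero.mp this.symm
  -- Write [ijk] for (Fᵢ × Fⱼ) · Fₖ. Differentiating [124] = 0 and [034] = 0 yields [125] = -[134] =
  -- [035], while F₁ × F₂ = -F₀ × F₃ yields [125] = -[035].
  have t125 : ∀ z ∈ U, cross7 (F 1 z) (F 2 z) ⬝ᵥ F 5 z = 0 := fun z hz => by
    have e1 := tri_step t124 z hz
    have e2 := tri_step t034 z hz
    have e3 := h12 z hz (F 5 z)
    simp only [cross7_self, cross7_dot_right, zero_dotProduct, zero_add, add_zero,
      Nat.reduceAdd] at e1 e2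
    linear_combination (e1 - e2 + e3) / 2
  interval_cases j
  · rw [cross7_dot_rotate, cross7_dot_rotate, hF.cross z hz, zero_dotProduct]
  · exact cross7_dot_left _ _
  · exact cross7_dot_right _ _
  · exact t123 z hz
  · exact t124 z hz
  · exact t125 z hz

/-- Apply F₃ × · twice to F₀: since F₃ × F₀ = F₁ × F₂ is the ratio times F₀, the double product
formula gives -(F₃ · F₃) = F₀ · F₆. The quadratic form thus fixes the ratio up to sign. -/
theorem ratio_sq {z : ℂ} (hz : z ∈ U) : ratio F z ^ 2 = F 0 z ⬝ᵥ F 6 z := by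
  have h1 := cross7_cross7_self (F 3 z) (F 0 z)
  rw [hF.cross_three_zero hz, hF.cross_one_two_eq hz, cross7_smul_right, hF.cross_three_zero hz,
    hF.cross_one_two_eq hz, hF.isotropic.1 3 0 (by norm_num) z hz, hF.isotropic.2 z hz, zero_smul,
    zero_sub, neg_smul, neg_neg, smul_smul] at h1
  have h2 := smul_left_injective ℂ (hF.ne_zero hz) h1
  rw [sq]; exact h2

theorem continuousOn (i : ℕ) : ContinuousOn (F i) U := fun z hz =>
  (hF.deriv i z hz).continuousAt.continuousWithinAt

theorem continuousOn_ratio : ContinuousOn (ratio F) U := by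
  have h1 : ContinuousOn (fun z => dotL (crossL (F 1 z) (F 2 z)) (F 6 z)) U := by
    have := hF.continuousOn 1
    have := hF.continuousOn 2
    have := hF.continuousOn 6
    fun_prop
  have h2 : ContinuousOn (fun z => dotL (F 0 z) (F 6 z)) U := by
    have := hF.continuousOn 0
    have := hF.continuousOn 6
    fun_prop
  exact h1.div h2 fun z hz => hF.dot_zero_six_ne_zero hz

/-- An alternating cross product vanishes if it kills the lowest osculating planes of `F`. -/
theorem alternating_eq_zero (hne : U.Nonempty)
    (Θ : (Fin 7 → ℂ) →L[ℂ] (Fin 7 → ℂ) →L[ℂ] (Fin 7 → ℂ))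
    (hswap : ∀ u v, Θ u v = -Θ v u) (hdot : ∀ u v w, Θ u v ⬝ᵥ w = -(Θ u w ⬝ᵥ v))
    (h01 : ∀ z ∈ U, Θ (F 0 z) (F 1 z) = 0) (h12 : ∀ z ∈ U, Θ (F 1 z) (F 2 z) = 0) (u v) :
    Θ u v = 0 := by
  have self : ∀ u, Θ u u = 0 := fun u => self_eq_neg.mp (hswap u u)
  have dself : ∀ u w, Θ u w ⬝ᵥ w = 0 := fun u w => self_eq_neg.mp (hdot u w w)
  have dswap : ∀ u v w, Θ u v ⬝ᵥ w = -(Θ w v ⬝ᵥ u) := fun u v w => by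
    rw [hswap, neg_dotProduct, hdot, neg_neg, hswap, neg_dotProduct]
  have right : ∀ {i j : ℕ}, (∀ z ∈ U, Θ (F (i + 1) z) (F j z) = 0) →
      (∀ z ∈ U, Θ (F i z) (F j z) = 0) → ∀ z ∈ U, Θ (F i z) (F (j + 1) z) = 0 :=
    fun h1 h2 z hz => by
      have := hF.bilin_step Θ h2 z hz
      rwa [h1 z hz, zero_add] at this
  have diag : ∀ {i j : ℕ}, j = i + 1 → (∀ z ∈ U, Θ (F i z) (F j z) = 0) →
      ∀ z ∈ U, Θ (F i z) (F (j + 1) z) = 0 := fun hij h => by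
    subst hij
    exact right (fun z _ => self _) h
  have ext : ∀ {i j : ℕ}, (∀ z ∈ U, ∀ m ≤ 6, Θ (F i z) (F j z) ⬝ᵥ F m z = 0) →
      ∀ z ∈ U, Θ (F i z) (F j z) = 0 := fun h z hz =>
    hF.full z hz _ fun m hm => by rw [dotProduct_comm]; exact h z hz m hm
  have kill : ∀ {i j m : ℕ} {z : ℂ}, Θ (F i z) (F m z) = 0 →
      Θ (F i z) (F j z) ⬝ᵥ F m z = 0 := fun h => by
    rw [hdot, h, zero_dotProduct, neg_zero]
  have kill' : ∀ {i j m : ℕ} {z : ℂ}, Θ (F m z) (F j z) = 0 →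
      Θ (F i z) (F j z) ⬝ᵥ F m z = 0 := fun h => by
    rw [dswap, h, zero_dotProduct, neg_zero]
  -- The pairs (i, j) are treated by increasing i + j. Differentiating the pairs of one weight
  -- relates neighbours of the next. When no neighbour is known to vanish, one pair is tested
  -- against every Fₘ by total skewness.
  have h02 := diag rfl h01
  have h03 := right h12 h02
  have h13 := diag rfl h12
  have h04 := right h13 h03
  have h14_05 := hF.bilin_step Θ h04
  have h23_14 := hF.bilin_step Θ h13
  have t235 : ∀ z ∈ U, Θ (F 2 z) (F 3 z) ⬝ᵥ F 5 z = 0 := fun z hz => by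
    rw [eq_neg_of_add_eq_zero_left (h23_14 z hz), eq_neg_of_add_eq_zero_left (h14_05 z hz), neg_neg,
      dself]
  have t145 : ∀ z ∈ U, Θ (F 1 z) (F 4 z) ⬝ᵥ F 5 z = 0 := fun z hz => by
    rw [eq_neg_of_add_eq_zero_left (h14_05 z hz), neg_dotProduct, dself, neg_zero]
  have h05 : ∀ z ∈ U, Θ (F 0 z) (F 5 z) = 0 := by
    have tri_step : ∀ {i j k : ℕ}, (∀ z ∈ U, Θ (F i z) (F j z) ⬝ᵥ F k z = 0) →
        ∀ z ∈ U, Θ (F (i + 1) z) (F j z) ⬝ᵥ F k z + Θ (F i z) (F (j + 1) z) ⬝ᵥ F k z +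
          Θ (F i z) (F j z) ⬝ᵥ F (k + 1) z = 0 := by
      intro i j k h z hz
      have e1 : HasDerivAt (fun z => Θ (F i z) (F j z))
          (Θ (F (i + 1) z) (F j z) + Θ (F i z) (F (j + 1) z)) z := by
        have := (Θ.isBoundedBilinearMap.hasFDerivAt (F i z, F j z)).comp_hasDerivAt z
          ((hF.deriv i z hz).prodMk (hF.deriv j z hz))
        refine this.congr_deriv ?_
        simp [IsBoundedBilinearMap.deriv, add_comm]
      have e2 : HasDerivAt (fun z => dotL (Θ (F i z) (F j z)) (F k z))
          ((Θ (F (i + 1) z) (F j z) + Θ (F i z) (F (j + 1) z)) ⬝ᵥ F k z +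
            Θ (F i z) (F j z) ⬝ᵥ F (k + 1) z) z := by
        have := (dotL.isBoundedBilinearMap.hasFDerivAt
          (Θ (F i z) (F j z), F k z)).comp_hasDerivAt z (e1.prodMk (hF.deriv k z hz))
        refine this.congr_deriv ?_
        simp [IsBoundedBilinearMap.deriv, add_comm, dotL_apply]
      have e3 : HasDerivAt (fun z => dotL (Θ (F i z) (F j z)) (F k z)) 0 z :=
        (hasDerivAt_const z (0 : ℂ)).congr_of_eventuallyEq
          (Filter.eventually_of_mem (hF.isOpen.mem_nhds hz) h)
      rw [← add_dotProduct]
      exact e2.unique e3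
    refine ext fun z hz m hm => ?_
    -- With [ijk] = Θ(Fᵢ, Fⱼ) · Fₖ, the derivatives of [235] = 0 and [145] = 0 both express [245]
    -- and give [236] = [146]. The relation Θ₂₃ = -Θ₁₄ gives the opposite sign, so both vanish, and
    -- [056] = -[146].
    have t056 : Θ (F 0 z) (F 5 z) ⬝ᵥ F 6 z = 0 := by
      have e1 := tri_step t235 z hz
      have e2 := tri_step t145 z hz
      simp only [self, dself, zero_dotProduct, zero_add, add_zero, Nat.reduceAdd] at e1 e2
      have e3 := congrArg (· ⬝ᵥ F 6 z) (h14_05 z hz)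
      have e4 := congrArg (· ⬝ᵥ F 6 z) (h23_14 z hz)
      simp only [add_dotProduct, zero_dotProduct, Nat.reduceAdd] at e3 e4
      linear_combination (e1 - e2 + 2 * e3 - e4) / 2
    interval_cases m
    · exact kill (self _)
    · exact kill (h01 z hz)
    · exact kill (h02 z hz)
    · exact kill (h03 z hz)
    · exact kill (h04 z hz)
    · exact dself _ _
    · exact t056
  have h14 : ∀ z ∈ U, Θ (F 1 z) (F 4 z) = 0 := fun z hz => by
    have := h14_05 z hz
    rwa [h05 z hz, add_zero] at this
  have h23 : ∀ z ∈ U, Θ (F 2 z) (F 3 z) = 0 := fun z hz => by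
    have := h23_14 z hz
    rwa [h14 z hz, add_zero] at this
  have h24 := diag rfl h23
  have h15 := right h24 h14
  have h06 := right h15 h05
  have h34_25 := hF.bilin_step Θ h24
  have h25_16 := hF.bilin_step Θ h15
  have h34 : ∀ z ∈ U, Θ (F 3 z) (F 4 z) = 0 := by
    refine ext fun z hz m hm => ?_
    interval_cases m
    · exact kill' (h04 z hz)
    · exact kill' (h14 z hz)
    · exact kill' (h24 z hz)
    · exact kill (self _)
    · exact dself _ _
    · rw [eq_neg_of_add_eq_zero_left (h34_25 z hz), neg_dotProduct, dself, neg_zero]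
    · rw [eq_neg_of_add_eq_zero_left (h34_25 z hz), eq_neg_of_add_eq_zero_left (h25_16 z hz),
        neg_neg, dself]
  have h25 : ∀ z ∈ U, Θ (F 2 z) (F 5 z) = 0 := fun z hz => by
    have := h34_25 z hz
    rwa [h34 z hz, zero_add] at this
  have h16 : ∀ z ∈ U, Θ (F 1 z) (F 6 z) = 0 := fun z hz => by
    have := h25_16 z hz
    rwa [h25 z hz, zero_add] at this
  have h35 := diag rfl h34
  have h26 := right h35 h25
  have h45_36 := hF.bilin_step Θ h35
  have h45 : ∀ z ∈ U, Θ (F 4 z) (F 5 z) = 0 := by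
    refine ext fun z hz m hm => ?_
    interval_cases m
    · exact kill' (h05 z hz)
    · exact kill' (h15 z hz)
    · exact kill' (h25 z hz)
    · exact kill' (h35 z hz)
    · exact kill (self _)
    · exact dself _ _
    · rw [eq_neg_of_add_eq_zero_left (h45_36 z hz), neg_dotProduct, dself, neg_zero]
  have h36 : ∀ z ∈ U, Θ (F 3 z) (F 6 z) = 0 := fun z hz => by
    have := h45_36 z hz
    rwa [h45 z hz, zero_add] at this
  have h46 := diag rfl h45
  have h56 : ∀ z ∈ U, Θ (F 5 z) (F 6 z) = 0 := by
    refine ext fun z hz m hm => ?_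
    interval_cases m
    · exact kill' (h06 z hz)
    · exact kill' (h16 z hz)
    · exact kill' (h26 z hz)
    · exact kill' (h36 z hz)
    · exact kill' (h46 z hz)
    · exact kill (self _)
    · exact dself _ _
  have main : ∀ z ∈ U, ∀ i ≤ 6, ∀ j ≤ 6, Θ (F i z) (F j z) = 0 := by
    have lt : ∀ z ∈ U, ∀ i j, i < j → j ≤ 6 → Θ (F i z) (F j z) = 0 := by
      intro z hz i j hij hj
      have hi : i ≤ 5 := by omega
      interval_cases i <;> interval_cases j <;> try omega
      all_goals first
        | exact h01 z hz | exact h02 z hz | exact h03 z hz | exact h04 z hz | exact h05 z hz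
        | exact h06 z hz | exact h12 z hz | exact h13 z hz | exact h14 z hz | exact h15 z hz
        | exact h16 z hz | exact h23 z hz | exact h24 z hz | exact h25 z hz | exact h26 z hz
        | exact h34 z hz | exact h35 z hz | exact h36 z hz | exact h45 z hz | exact h46 z hz
        | exact h56 z hz
    intro z hz i hi j hj
    rcases lt_trichotomy i j with h | rfl | h
    · exact lt z hz i j h hj
    · exact self _
    · rw [hswap, lt z hz j i h hi, neg_zero]
  obtain ⟨z, hz⟩ := hne
  have m1 : ∀ u, ∀ j ≤ 6, Θ u (F j z) = 0 := by
    intro u j hj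
    funext t
    exact hF.linearMap_eq_zero hz
      ((LinearMap.proj t).comp ((Θ.flip (F j z) : (Fin 7 → ℂ) →L[ℂ] (Fin 7 → ℂ)) :
        (Fin 7 → ℂ) →ₗ[ℂ] (Fin 7 → ℂ)))
      (fun i hi => congrFun (main z hz i hi j hj) t) u
  funext t
  exact hF.linearMap_eq_zero hz
    ((LinearMap.proj t).comp ((Θ u : (Fin 7 → ℂ) →L[ℂ] (Fin 7 → ℂ)) :
      (Fin 7 → ℂ) →ₗ[ℂ] (Fin 7 → ℂ))) (fun j hj => congrFun (m1 u j hj) t) v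

/-! #### Linear images -/

theorem mulVec {A : Matrix (Fin 7) (Fin 7) ℂ} (hA : IsUnit A)
    (hc : ∀ z ∈ U, cross7 (A *ᵥ F 0 z) (A *ᵥ F 1 z) = 0) :
    IsSuperhorizontal U fun i z => A *ᵥ F i z where
  isOpen := hF.isOpen
  deriv i z hz := hasDerivAt_mulVec A (hF.deriv i z hz)
  cross := hc
  full z hz v hv := by
    have h1 : Aᵀ *ᵥ v = 0 := hF.full z hz _ fun j hj => by
      rw [Matrix.mulVec_transpose, dotProduct_comm, ← Matrix.dotProduct_mulVec, dotProduct_comm]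
      exact hv j hj
    exact Matrix.mulVec_injective_of_isUnit ((A.isUnit_transpose.mpr hA))
      (h1.trans (Matrix.mulVec_zero _).symm)

/-- If `A` maps a superhorizontal curve to a superhorizontal curve then `A` is a conformal map of
the complex quadratic form. -/
theorem exists_dot_mulVec_eq (hne : U.Nonempty) (hconn : IsPreconnected U)
    {A : Matrix (Fin 7) (Fin 7) ℂ} (hA : IsUnit A)
    (hc : ∀ z ∈ U, cross7 (A *ᵥ F 0 z) (A *ᵥ F 1 z) = 0) :
    ∃ c : ℂ, c ≠ 0 ∧ ∀ u v, (A *ᵥ u) ⬝ᵥ (A *ᵥ v) = c * (u ⬝ᵥ v) := by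
  have hK := hF.mulVec hA hc
  set N := Aᵀ * A
  have hN : ∀ u v, (N *ᵥ u) ⬝ᵥ v = (A *ᵥ u) ⬝ᵥ (A *ᵥ v) := fun u v => by
    rw [← Matrix.mulVec_mulVec, Matrix.mulVec_transpose, ← Matrix.dotProduct_mulVec]
  -- Isotropy of the image curve says that AᵀA F₀ is orthogonal to F₀, …, F₅, so F₀ is an
  -- eigenvector of AᵀA with this eigenvalue.
  set lam : ℂ → ℂ := fun z => (N *ᵥ F 0 z) ⬝ᵥ F 6 z / (F 0 z ⬝ᵥ F 6 z)
  have h0 : ∀ z ∈ U, N *ᵥ F 0 z = lam z • F 0 z := fun z hz =>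
    hF.eq_smul_of_orthogonal hz fun j hj => by
      rw [hN]; exact hK.isotropic.1 0 j (by omega) z hz
  have hcont : ContinuousOn lam U := by
    have e1 : ContinuousOn (fun z => (N *ᵥ F 0 z) ⬝ᵥ F 6 z) U := by
      have e3 : ContinuousOn (fun z => dotL (A *ᵥ F 0 z) (A *ᵥ F 6 z)) U := by
        have := hK.continuousOn 0
        have := hK.continuousOn 6
        fun_prop
      exact e3.congr fun z _ => hN _ _
    have e2 : ContinuousOn (fun z => dotL (F 0 z) (F 6 z)) U := by
      have := hF.continuousOn 0
      have := hF.continuousOn 6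
      fun_prop
    exact e1.div e2 fun z hz => hF.dot_zero_six_ne_zero hz
  -- A continuous function with values in the finite spectrum is constant on a connected set.
  -- Differentiating N F₀ = λ F₀ then gives the same eigenvalue on all Fⱼ, which span.
  have hfin : {c : ℂ | Module.End.HasEigenvalue N.mulVecLin c}.Finite :=
    Module.End.finite_hasEigenvalue _
  have hmem : Set.MapsTo lam U {c : ℂ | Module.End.HasEigenvalue N.mulVecLin c} := fun z hz =>
    Module.End.hasEigenvalue_of_hasEigenvector (x := F 0 z)
      ⟨Module.End.mem_eigenspace_iff.mpr (h0 z hz), hF.ne_zero hz⟩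
  obtain ⟨p, hp⟩ := hne
  have hconst : ∀ z ∈ U, lam z = lam p := fun z hz =>
    hconn.constant_of_mapsTo hfin.isDiscrete hcont hmem hz hp
  have hj : ∀ j, ∀ z ∈ U, N *ᵥ F j z = lam p • F j z := by
    intro j
    induction j with
    | zero => exact fun z hz => by rw [h0 z hz, hconst z hz]
    | succ j ih =>
      intro z hz
      refine ((hasDerivAt_mulVec N (hF.deriv j z hz)).congr_of_eventuallyEq ?_).unique
        ((hF.deriv j z hz).const_smul (lam p))
      exact Filter.eventually_of_mem (hF.isOpen.mem_nhds hz) fun w hw => (ih w hw).symm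
  have hall : ∀ u v, (A *ᵥ u) ⬝ᵥ (A *ᵥ v) = lam p * (u ⬝ᵥ v) := by
    intro u v
    have e1 := hF.linearMap_eq_zero hp
      ((dotL.flip (N.transpose *ᵥ v - lam p • v) : (Fin 7 → ℂ) →L[ℂ] ℂ) : (Fin 7 → ℂ) →ₗ[ℂ] ℂ)
      (fun j _ => by
        change F j p ⬝ᵥ _ = 0
        rw [dotProduct_sub, Matrix.mulVec_transpose, dotProduct_comm, ← Matrix.dotProduct_mulVec,
          hj j p hp, dotProduct_smul, dotProduct_smul, dotProduct_comm, sub_self]) u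
    change u ⬝ᵥ _ = 0 at e1
    rw [dotProduct_sub, Matrix.mulVec_transpose, dotProduct_comm, ← Matrix.dotProduct_mulVec,
      dotProduct_smul, dotProduct_comm, hN, sub_eq_zero] at e1
    exact e1
  refine ⟨lam p, fun h => hK.dot_zero_six_ne_zero hp ?_, hall⟩
  rw [hall, h, zero_mul]

/-- Lowering an index turns Aᵀ(Au × Av) - u × v into a difference of two 3-forms, so
`alternating_eq_zero` applies. Orthogonality of A converts its vanishing into equivariance. -/
theorem map_cross7 (hne : U.Nonempty) {A : Matrix (Fin 7) (Fin 7) ℂ}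
    (hdot : ∀ u v, (A *ᵥ u) ⬝ᵥ (A *ᵥ v) = u ⬝ᵥ v)
    (h01 : ∀ z ∈ U, cross7 (A *ᵥ F 0 z) (A *ᵥ F 1 z) = 0)
    (h12 : ∀ z ∈ U, cross7 (A *ᵥ F 1 z) (A *ᵥ F 2 z) = A *ᵥ cross7 (F 1 z) (F 2 z)) (u v) :
    cross7 (A *ᵥ u) (A *ᵥ v) = A *ᵥ cross7 u v := by
  have hAA : Aᵀ * A = 1 := by
    ext i j
    have := hdot (Pi.single i 1) (Pi.single j 1)
    simpa [Matrix.mul_apply, dotProduct, Matrix.one_apply, Pi.single_apply, eq_comm] using this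
  have hAA' : A * Aᵀ = 1 := mul_eq_one_comm.mp hAA
  let a : (Fin 7 → ℂ) →L[ℂ] (Fin 7 → ℂ) := LinearMap.toContinuousLinearMap A.mulVecLin
  let t : (Fin 7 → ℂ) →L[ℂ] (Fin 7 → ℂ) := LinearMap.toContinuousLinearMap Aᵀ.mulVecLin
  let Θ : (Fin 7 → ℂ) →L[ℂ] (Fin 7 → ℂ) →L[ℂ] (Fin 7 → ℂ) :=
    (ContinuousLinearMap.compL ℂ _ _ _ t).comp (crossL.bilinearComp a a) - crossL
  have hΘ : ∀ u v, Θ u v = Aᵀ *ᵥ cross7 (A *ᵥ u) (A *ᵥ v) - cross7 u v := fun u v => rfl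
  have hΘd : ∀ u v w, Θ u v ⬝ᵥ w =
      cross7 (A *ᵥ u) (A *ᵥ v) ⬝ᵥ (A *ᵥ w) - cross7 u v ⬝ᵥ w := fun u v w => by
    rw [hΘ, sub_dotProduct, Matrix.mulVec_transpose, ← Matrix.dotProduct_mulVec]
  have h := hF.alternating_eq_zero hne Θ
    (fun u v => by rw [hΘ, hΘ, cross7_swap u v, cross7_swap (A *ᵥ u), Matrix.mulVec_neg]; abel)
    (fun u v w => by rw [hΘd, hΘd, cross7_dot_swap_right, cross7_dot_swap_right u]; ring)
    (fun z hz => by rw [hΘ, h01 z hz, hF.cross z hz, Matrix.mulVec_zero, sub_zero])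
    (fun z hz => by rw [hΘ, h12 z hz, Matrix.mulVec_mulVec, hAA, Matrix.one_mulVec, sub_self]) u v
  rw [hΘ, sub_eq_zero] at h
  rw [← h, Matrix.mulVec_mulVec, hAA', Matrix.one_mulVec]

/-- A linear map between superhorizontal curves is a multiple of an automorphism of the cross
product. -/
theorem exists_smul_map_cross7 (hne : U.Nonempty) (hconn : IsPreconnected U)
    {A : Matrix (Fin 7) (Fin 7) ℂ} (hA : IsUnit A)
    (hc : ∀ z ∈ U, cross7 (A *ᵥ F 0 z) (A *ᵥ F 1 z) = 0) :
    ∃ μ : ℂ, μ ≠ 0 ∧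
      ∀ u v, cross7 ((μ • A) *ᵥ u) ((μ • A) *ᵥ v) = (μ • A) *ᵥ cross7 u v := by
  obtain ⟨c, hc0, hdot⟩ := hF.exists_dot_mulVec_eq hne hconn hA hc
  -- Scaling by a square root of 1/c turns the conformal map into one preserving the quadratic form.
  obtain ⟨μ, hμ⟩ := IsAlgClosed.exists_pow_nat_eq c⁻¹ (n := 2) (by norm_num)
  have hμ0 : μ ≠ 0 := fun h => by simp [h] at hμ; exact hc0 hμ.symm
  set B := μ • A with hB
  have hBdot : ∀ u v, (B *ᵥ u) ⬝ᵥ (B *ᵥ v) = u ⬝ᵥ v := fun u v => by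
    rw [hB, Matrix.smul_mulVec, Matrix.smul_mulVec, smul_dotProduct, dotProduct_smul, hdot,
      smul_smul, ← sq, hμ, smul_eq_mul, inv_mul_cancel_left₀ hc0]
  have hBc : ∀ z ∈ U, cross7 (B *ᵥ F 0 z) (B *ᵥ F 1 z) = 0 := fun z hz => by
    rw [hB, Matrix.smul_mulVec, Matrix.smul_mulVec, cross7_smul_left, cross7_smul_right, hc z hz,
      smul_zero, smul_zero]
  have hBu : IsUnit B := by
    rw [Matrix.isUnit_iff_isUnit_det] at hA ⊢
    rw [hB, Matrix.det_smul]
    exact (isUnit_iff_ne_zero.mpr (pow_ne_zero _ hμ0)).mul hA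
  have hK := hF.mulVec hBu hBc
  have hr : Set.EqOn (ratio (fun i z => B *ᵥ F i z) ^ 2) (ratio F ^ 2) U := fun z hz => by
    simp only [Pi.pow_apply]
    rw [hK.ratio_sq hz, hF.ratio_sq hz, hBdot]
  have h12 := fun z hz => hK.cross_one_two_eq (z := z) hz
  -- The ratios of the two curves have the same nonvanishing square, so on a connected set they
  -- agree up to one global sign. Passing from B to -B keeps BF₁ × BF₂ and reverses BF₀, which
  -- repairs a wrong sign.
  rcases hconn.eq_or_eq_neg_of_sq_eq hK.continuousOn_ratio hF.continuousOn_ratio hr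
    (fun {z} hz h => hF.dot_zero_six_ne_zero hz (by rw [← hF.ratio_sq hz, h]; norm_num))
    with h | h
  · refine ⟨μ, hμ0, hF.map_cross7 hne hBdot hBc fun z hz => ?_⟩
    rw [h12 z hz, hF.cross_one_two_eq hz, h hz, Matrix.mulVec_smul]
  · refine ⟨-μ, neg_ne_zero.mpr hμ0, ?_⟩
    rw [neg_smul]
    refine hF.map_cross7 hne (A := -B) (fun u v => ?_) (fun z hz => ?_) fun z hz => ?_
    · simp only [Matrix.neg_mulVec, neg_dotProduct, dotProduct_neg, neg_neg, hBdot]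
    · simp only [Matrix.neg_mulVec, cross7_neg_left, cross7_neg_right, neg_neg, hBc z hz]
    · simp only [Matrix.neg_mulVec, cross7_neg_left, cross7_neg_right, neg_neg]
      rw [h12 z hz, hF.cross_one_two_eq hz, h hz, Matrix.mulVec_smul, Pi.neg_apply, neg_smul]

end IsSuperhorizontal

/-! ### Holomorphic spans of sections -/

section Span

open Complex Filter

/-- Vanishing 2 × 2 minors express equality of lines without a proportionality factor, so the
condition passes to limits and can be differentiated. -/
theorem mk_eq_mk_iff_minors {u v : Fin 7 → ℂ} (hu : u ≠ 0) (hv : v ≠ 0) :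
    Projectivization.mk ℂ u hu = Projectivization.mk ℂ v hv ↔ ∀ i j, u i * v j = u j * v i := by
  rw [Projectivization.mk_eq_mk_iff']
  constructor
  · rintro ⟨r, rfl⟩ i j
    simp only [Pi.smul_apply, smul_eq_mul]
    ring
  · intro h
    obtain ⟨j, hj⟩ : ∃ j, v j ≠ 0 := by
      by_contra! h0; exact hv (funext h0)
    refine ⟨u j / v j, funext fun i => ?_⟩
    rw [Pi.smul_apply, smul_eq_mul, div_mul_eq_mul_div, div_eq_iff hj, ← h i j]

theorem minors_eq_of_eventually {u v : ℂ → Fin 7 → ℂ} {z₀ : ℂ} (hu : ContinuousAt u z₀)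
    (hv : ContinuousAt v z₀) (h : ∀ᶠ z in 𝓝[≠] z₀, ∀ i j, u z i * v z j = u z j * v z i) (i j) :
    u z₀ i * v z₀ j = u z₀ j * v z₀ i := by
  have hu' := fun i => (continuousAt_pi.mp hu i).continuousWithinAt (s := {z₀}ᶜ)
  have hv' := fun i => (continuousAt_pi.mp hv i).continuousWithinAt (s := {z₀}ᶜ)
  exact tendsto_nhds_unique_of_eventuallyEq ((hu' i).mul (hv' j)) ((hu' j).mul (hv' i))
    (h.mono fun z hz => hz i j)

/-- `H` is holomorphic and nonzero at `z₀` and spans the same line as `g` around `z₀`. -/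
def IsLocalSpan (g : ℂ → Fin 7 → ℂ) (z₀ : ℂ) (H : ℂ → Fin 7 → ℂ) : Prop :=
  AnalyticAt ℂ H z₀ ∧ H z₀ ≠ 0 ∧ ∀ᶠ z in 𝓝[≠] z₀, ∃ r : ℂ, r ≠ 0 ∧ g z = r • H z

variable {g H H' : ℂ → Fin 7 → ℂ} {z₀ : ℂ}

theorem IsLocalSpan.minors (h : IsLocalSpan g z₀ H) (h' : IsLocalSpan g z₀ H') (i j) :
    H z₀ i * H' z₀ j = H z₀ j * H' z₀ i := by
  refine minors_eq_of_eventually h.1.continuousAt h'.1.continuousAt ?_ i j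
  filter_upwards [h.2.2, h'.2.2] with z ⟨r, hr, e⟩ ⟨r', hr', e'⟩ i j
  have e1 := fun i => congrFun (e.symm.trans e') i
  simp only [Pi.smul_apply, smul_eq_mul] at e1
  refine mul_left_cancel₀ hr ?_
  linear_combination H' z j * e1 i - H' z i * e1 j

theorem IsLocalSpan.eventually (h : IsLocalSpan g z₀ H) : ∀ᶠ z in 𝓝 z₀, IsLocalSpan g z H := by
  obtain ⟨h1, h2, h3⟩ := h
  filter_upwards [h1.eventually_analyticAt, h1.continuousAt.eventually_ne h2,
    eventually_eventually_nhds.mpr (eventually_nhdsWithin_iff.mp h3)] with z hz1 hz2 hz3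
  refine ⟨hz1, hz2, ?_⟩
  rcases eq_or_ne z z₀ with rfl | hne
  · exact h3
  · refine eventually_nhdsWithin_of_eventually_nhds ?_
    filter_upwards [hz3, eventually_ne_nhds hne] with w hw hw0 using hw hw0

theorem IsLocalSpan.comp_inv {g' : ℂ → Fin 7 → ℂ} {φ : ℂ → ℂ} (h : IsLocalSpan g z₀⁻¹ H)
    (hz₀ : z₀ ≠ 0) (hφ : ∀ w, w ≠ 0 → φ w ≠ 0 ∧ g' w = φ w • g w⁻¹) :
    IsLocalSpan g' z₀ fun w => H w⁻¹ := by
  have ha : AnalyticAt ℂ (fun w : ℂ => w⁻¹) z₀ := analyticAt_inv hz₀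
  refine ⟨h.1.fun_comp ha, h.2.1, ?_⟩
  have ht : Tendsto (fun w : ℂ => w⁻¹) (𝓝[≠] z₀) (𝓝[≠] z₀⁻¹) :=
    tendsto_nhdsWithin_of_tendsto_nhds_of_eventually_within _
      (ha.continuousAt.tendsto.mono_left nhdsWithin_le_nhds)
      (eventually_nhdsWithin_of_forall fun w hw => fun h0 => hw (inv_injective h0))
  filter_upwards [ht.eventually h.2.2,
    eventually_nhdsWithin_of_eventually_nhds (eventually_ne_nhds hz₀)] with w ⟨r, hr, e⟩ hw
  refine ⟨φ w * r, mul_ne_zero (hφ w hw).1 hr, ?_⟩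
  rw [(hφ w hw).2, e, smul_smul]

/-- The line spanned by a section with zeros of finite order extends holomorphically over the
zeros, if it is holomorphic off the zeros. -/
theorem exists_isLocalSpan (hg : ∀ᶠ z in 𝓝[≠] z₀, DifferentiableAt ℂ g z) {m : ℕ} {C : ℝ}
    (hb : ∀ᶠ z in 𝓝[≠] z₀, ‖z - z₀‖ ^ m * ‖g z‖ ≤ C) (hg0 : ∀ᶠ z in 𝓝[≠] z₀, g z ≠ 0) :
    ∃ H, IsLocalSpan g z₀ H := by
  -- The exponent m would only make G bounded. The extra factor gives limit 0, which is also the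
  -- value at z₀, so the singularity is removable. Dividing by the remaining power of z - z₀ leaves
  -- a nonzero vector at z₀.
  set G : ℂ → Fin 7 → ℂ := fun z => (z - z₀) ^ (m + 1) • g z with hG
  have hne : ∀ᶠ z in 𝓝[≠] z₀, z - z₀ ≠ 0 :=
    eventually_nhdsWithin_of_forall fun z hz => sub_ne_zero.mpr hz
  have hGd : ∀ᶠ z in 𝓝[≠] z₀, DifferentiableAt ℂ G z :=
    hg.mono fun z hz => (((differentiableAt_id).sub_const z₀).pow (m + 1)).smul hz
  have hGc : ContinuousAt G z₀ := by
    have h0 : G z₀ = 0 := by simp [hG]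
    refine continuousAt_iff_punctured_nhds.mpr ?_
    rw [h0]
    refine squeeze_zero_norm' (a := fun z => ‖z - z₀‖ * C) (hb.mono fun z hz => ?_) ?_
    · rw [hG, norm_smul, norm_pow, pow_succ']
      nlinarith [norm_nonneg (z - z₀)]
    · have : Continuous fun z : ℂ => ‖z - z₀‖ * C := by fun_prop
      have h1 := this.tendsto z₀
      simp only [sub_self, norm_zero, zero_mul] at h1
      exact h1.mono_left nhdsWithin_le_nhds
  have hGa := analyticAt_of_differentiable_on_punctured_nhds_of_continuousAt hGd hGc
  obtain ⟨l, H, hHa, hH0, hH⟩ := hGa.exists_eventuallyEq_pow_smul_nonzero_iff.mpr fun h0 => by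
    obtain ⟨z, h1, h2, h3⟩ := ((h0.filter_mono nhdsWithin_le_nhds).and (hne.and hg0)).exists
    exact smul_ne_zero (pow_ne_zero _ h2) h3 h1
  refine ⟨H, hHa, hH0, ?_⟩
  filter_upwards [hH.filter_mono nhdsWithin_le_nhds, hne] with z h1 h2
  refine ⟨((z - z₀) ^ (m + 1))⁻¹ * (z - z₀) ^ l,
    mul_ne_zero (inv_ne_zero (pow_ne_zero _ h2)) (pow_ne_zero _ h2), ?_⟩
  rw [mul_smul, ← h1, hG, smul_smul, inv_mul_cancel₀ (pow_ne_zero _ h2), one_smul]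

end Span

/-! ### The directrix curve -/

section Directrix

open Complex Filter AC

variable {f : RiemannSphere → SixSphere}

theorem eq_inv_of_sphereParam_eq {c : Bool} {z w : ℂ}
    (h : sphereParam (!c) w = sphereParam c z) : w ≠ 0 ∧ z = w⁻¹ := by
  have hw : w ≠ 0 := by
    rintro rfl
    cases c
    · simp [sphereParam] at h
    · by_cases hz : z = 0 <;> simp [sphereParam, hz] at h
      exact hz h.symm
  exact ⟨hw, sphereParam_injective c (by rw [← h, sphereParam_inv c hw])⟩

theorem IsAlmostComplexCurve.h_inv (hf : IsAlmostComplexCurve f) (c : Bool) {w : ℂ} (hw : w ≠ 0) :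
    IsAlmostComplexLift.invFactor w ^ 3 ≠ 0 ∧
      h (localLift f (!c)) w = IsAlmostComplexLift.invFactor w ^ 3 • h (localLift f c) w⁻¹ :=
  ⟨pow_ne_zero _ (IsAlmostComplexLift.invFactor_ne_zero hw),
    (hf.isAlmostComplexLift c).h_transform (fun _ hw => localLift_inv c hw) hw⟩

theorem norm_mul_norm_le_norm_star_dot_self (v : Fin 7 → ℂ) : ‖v‖ * ‖v‖ ≤ ‖star v ⬝ᵥ v‖ := by
  obtain ⟨i, -, hi⟩ := Finset.exists_mem_eq_sup' Finset.univ_nonempty fun i => ‖v i‖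
  have h1 : ‖v‖ ≤ ‖v i‖ := (pi_norm_le_iff_of_nonneg (norm_nonneg _)).mpr fun j => by
    rw [← hi]; exact Finset.le_sup' (fun i => ‖v i‖) (Finset.mem_univ j)
  have h2 : star v ⬝ᵥ v = ((∑ i, ‖v i‖ ^ 2 : ℝ) : ℂ) := star_dot_self_eq_ofReal _
  rw [h2, Complex.norm_of_nonneg (by positivity)]
  have h3 := Finset.single_le_sum (f := fun i => ‖v i‖ ^ 2) (fun i _ => by positivity)
    (Finset.mem_univ i)
  nlinarith [norm_nonneg v]

/-- Turns the finite order of the zeros of h into a bound on the order of the poles of the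
holomorphic lift. -/
theorem norm_holoLift_le (F : ℂ → Fin 7 → ℂ) (z : ℂ) : ‖holoLift F z‖ ≤ ‖h F z‖⁻¹ := by
  rcases eq_or_ne (h F z) 0 with h0 | h0
  · simp [holoLift, h0]
  have h1 : 0 < ‖h F z‖ := norm_pos_iff.mpr h0
  have h2 := norm_mul_norm_le_norm_star_dot_self (h F z)
  have h3 : 0 < ‖n F z‖ := lt_of_lt_of_le (by positivity) h2
  rw [holoLift, norm_smul, norm_inv, ← div_eq_inv_mul, div_le_iff₀ h3, inv_mul_eq_div,
    le_div_iff₀ h1]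
  exact h2

theorem IsAlmostComplexCurve.isLocalSpan_holoLift (hf : IsAlmostComplexCurve f) {c : Bool} {z : ℂ}
    (hz : h (localLift f c) z ≠ 0) :
    IsLocalSpan (h (localLift f c)) z (holoLift (localLift f c)) := by
  have hF := hf.isAlmostComplexLift c
  have he := hF.eventually_h_ne_zero hz
  refine ⟨?_, IsAlmostComplexLift.lift_ne_zero hz, ?_⟩
  · exact analyticAt_iff_eventually_differentiableAt.mpr (he.mono fun w hw =>
      (hF.hasDerivAt_lift hw (hf.sextic_eq_zero c)).differentiableAt)
  · filter_upwards [he.filter_mono nhdsWithin_le_nhds] with w hw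
    have hn := IsAlmostComplexLift.n_ne_zero hw
    exact ⟨n _ w, hn, by rw [holoLift, smul_inv_smul₀ hn]⟩

theorem IsAlmostComplexCurve.exists_isLocalSpan_h (hf : IsAlmostComplexCurve f)
    (hfull : IsLinearlyFull f) (c : Bool) (z₀ : ℂ) :
    ∃ H, IsLocalSpan (h (localLift f c)) z₀ H := by
  have hF := hf.isAlmostComplexLift c
  have he := hf.eventually_h_ne_zero hfull c z₀
  obtain ⟨m, r, hr, hb⟩ := hf.h_lower_bound hfull c z₀
  obtain ⟨H, h1, h2, h3⟩ := exists_isLocalSpan (g := holoLift (localLift f c)) (z₀ := z₀) (m := m)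
    (C := r⁻¹) (he.mono fun z hz => (hF.hasDerivAt_lift hz (hf.sextic_eq_zero c)).differentiableAt)
    (by
      filter_upwards [he, hb.filter_mono nhdsWithin_le_nhds] with z hz hz'
      have h4 := norm_pos_iff.mpr hz
      refine (mul_le_mul_of_nonneg_left (norm_holoLift_le _ z) (by positivity)).trans ?_
      rw [← div_eq_mul_inv, div_le_iff₀ h4, inv_mul_eq_div, le_div_iff₀ hr, mul_comm]
      exact hz')
    (he.mono fun z hz => IsAlmostComplexLift.lift_ne_zero hz)
  refine ⟨H, h1, h2, ?_⟩
  filter_upwards [h3, he] with z ⟨t, ht, e⟩ hz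
  have hn := IsAlmostComplexLift.n_ne_zero hz
  exact ⟨n _ z * t, mul_ne_zero hn ht, by rw [mul_smul, ← e, holoLift, smul_inv_smul₀ hn]⟩

/-- The curve spanned by `h`, extended over the zeros of `h`. -/
theorem IsAlmostComplexCurve.exists_span (hf : IsAlmostComplexCurve f) (hfull : IsLinearlyFull f) :
    ∃ ψ : RiemannSphere → CP6, ∀ c z H, IsLocalSpan (h (localLift f c)) z H →
      ∃ hz : H z ≠ 0, ψ (sphereParam c z) = Projectivization.mk ℂ (H z) hz := by
  have key : ∀ p, ∃ ℓ : CP6, ∀ c z H, sphereParam c z = p → IsLocalSpan (h (localLift f c)) z H →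
      ∃ hz : H z ≠ 0, ℓ = Projectivization.mk ℂ (H z) hz := by
    intro p
    obtain ⟨c₁, z₁, -, rfl⟩ := exists_sphereParam p
    obtain ⟨H₁, hH₁⟩ := hf.exists_isLocalSpan_h hfull c₁ z₁
    refine ⟨Projectivization.mk ℂ (H₁ z₁) hH₁.2.1, fun c z H hp hH => ⟨hH.2.1, ?_⟩⟩
    rw [mk_eq_mk_iff_minors]
    rcases eq_or_ne c c₁ with rfl | hc
    · obtain rfl := sphereParam_injective c hp
      exact hH₁.minors hH
    · obtain rfl : c = !c₁ := by cases c <;> cases c₁ <;> simp_all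
      obtain ⟨hz, rfl⟩ := eq_inv_of_sphereParam_eq hp
      exact (hH₁.comp_inv hz fun w hw => hf.h_inv c₁ hw).minors hH
  choose ψ hψ using key
  exact ⟨ψ, fun c z H hH => hψ _ c z H rfl hH⟩

/-- The finite set of points where `h` vanishes in some coordinate. -/
theorem IsAlmostComplexCurve.exists_finite_singular (hf : IsAlmostComplexCurve f)
    (hfull : IsLinearlyFull f) :
    ∃ W : Set RiemannSphere, W.Finite ∧ ∀ c z, sphereParam c z ∉ W → h (localLift f c) z ≠ 0 := by
  -- The closed unit discs of the two coordinates cover the sphere, and isolated zeros in a compact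
  -- disc are finite in number.
  refine ⟨⋃ c, sphereParam c '' ({z | h (localLift f c) z = 0} ∩ Metric.closedBall 0 1),
    Set.finite_iUnion fun c => (finite_zeros_of_isolated (hf.eventually_h_ne_zero hfull c)
      (isCompact_closedBall _ _)).image _, fun c z hz h0 => hz ?_⟩
  rw [Set.mem_iUnion]
  rcases le_total ‖z‖ 1 with h1 | h1
  · exact ⟨c, z, ⟨h0, by simpa using h1⟩, rfl⟩
  · have hz0 : z ≠ 0 := fun h => by simp [h] at h1; linarith
    refine ⟨!c, z⁻¹, ⟨?_, ?_⟩, ?_⟩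
    · rw [Set.mem_ofPred_eq, (hf.h_inv c (inv_ne_zero hz0)).2, inv_inv, h0, smul_zero]
    · rw [mem_closedBall_zero_iff, norm_inv]; exact inv_le_one_of_one_le₀ h1
    · rw [sphereParam_inv c (inv_ne_zero hz0), inv_inv]

theorem eventually_sphereParam_notMem {W : Set RiemannSphere} (hW : W.Finite) (c : Bool) (z₀ : ℂ) :
    ∀ᶠ z in 𝓝[≠] z₀, sphereParam c z ∉ W := by
  have h1 : (sphereParam c ⁻¹' W).Finite := hW.preimage (sphereParam_injective c).injOn
  exact nhdsNE_le_cofinite _ h1.compl_mem_cofinite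

theorem eventually_nhds_sphereParam_notMem {W : Set RiemannSphere} (hW : W.Finite) {c : Bool}
    {z₀ : ℂ} (hz₀ : sphereParam c z₀ ∉ W) : ∀ᶠ z in 𝓝 z₀, sphereParam c z ∉ W := by
  have h1 : (sphereParam c ⁻¹' W).Finite := hW.preimage (sphereParam_injective c).injOn
  exact h1.isClosed.isOpen_compl.mem_nhds hz₀

theorem IsHolomorphicCurve.eq_of_eq_off_finite {ψ ψ' : RiemannSphere → CP6}
    (hψ : IsHolomorphicCurve ψ) (hψ' : IsHolomorphicCurve ψ') {W : Set RiemannSphere}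
    (hW : W.Finite) (h : ∀ p ∉ W, ψ p = ψ' p) : ψ = ψ' := by
  funext p
  obtain ⟨c, z₀, -, rfl⟩ := exists_sphereParam p
  obtain ⟨H, hH, e⟩ := hψ c z₀
  obtain ⟨H', hH', e'⟩ := hψ' c z₀
  obtain ⟨h1, h2⟩ := e.self_of_nhds
  obtain ⟨h3, h4⟩ := e'.self_of_nhds
  rw [h2, h4, mk_eq_mk_iff_minors]
  refine minors_eq_of_eventually hH.continuousAt hH'.continuousAt ?_
  filter_upwards [e.filter_mono nhdsWithin_le_nhds, e'.filter_mono nhdsWithin_le_nhds,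
    eventually_sphereParam_notMem hW c z₀] with z ⟨h1, h2⟩ ⟨h3, h4⟩ h5
  rw [← mk_eq_mk_iff_minors h1 h3, ← h2, ← h4, h _ h5]

/-- Off a finite set the directrix curve is spanned by `h`. -/
theorem IsDirectrixCurve.exists_eq_mk_h {ψ : RiemannSphere → CP6} (hψ : IsDirectrixCurve f ψ)
    (hf : IsAlmostComplexCurve f) (hfull : IsLinearlyFull f) :
    ∃ W : Set RiemannSphere, W.Finite ∧ ∀ c z, sphereParam c z ∉ W →
      ∃ hz : h (localLift f c) z ≠ 0,
        ψ (sphereParam c z) = Projectivization.mk ℂ (h (localLift f c) z) hz := by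
  obtain ⟨hhol, k, W₁, hW₁, h₁⟩ := hψ
  obtain ⟨W₂, hW₂, h₂⟩ := hf.exists_finite_singular hfull
  have hW := hW₁.union hW₂
  -- A holomorphic element has zero transform, which excludes k < 3 because the elements up to the
  -- third do not vanish at `z`. The fourth element is zero there, which excludes k > 3.
  have hk : k = 3 := by
    obtain ⟨z, hz⟩ := (eventually_sphereParam_notMem hW false 0).exists
    have hF := hf.isAlmostComplexLift false
    have hS := hf.sextic_eq_zero false
    have hz0 := h₂ false z fun h => hz (Or.inr h)
    obtain ⟨h3, h4, -⟩ := h₁ false z fun h => hz (Or.inl h)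
    rcases lt_trichotomy k 3 with hk | hk | hk
    · obtain ⟨H, hH, e⟩ := hhol false z
      obtain ⟨hH0, -⟩ := e.self_of_nhds
      have h5 := dbarTransform_eq_zero_of_holomorphic
        (hF.iterate_differentiableAt hz0 (show k ≤ 2 by omega)) h4 hH hH0 (by
          filter_upwards [e, eventually_nhds_sphereParam_notMem hW hz] with w ⟨hw1, hw2⟩ hw3
          obtain ⟨-, h6, h7⟩ := h₁ false w fun h => hw3 (Or.inl h)
          exact (mk_eq_mk_iff_minors h6 hw1).mp (h7.symm.trans hw2))
      rw [← Function.iterate_succ_apply' dbarTransform] at h5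
      exact absurd h5 (hF.iterate_ne_zero hS hz0 (by omega))
    · exact hk
    · have h5 := hF.iterate_four hS hz0
      rcases (show k = 4 ∨ 4 < k by omega) with rfl | hk
      · exact absurd h5 h4
      · exact absurd h5 (h3 4 hk)
  subst hk
  refine ⟨W₁ ∪ W₂, hW, fun c z hz => ?_⟩
  have hz0 := h₂ c z fun h => hz (Or.inr h)
  obtain ⟨-, h4, h5⟩ := h₁ c z fun h => hz (Or.inl h)
  refine ⟨hz0, h5.trans ((Projectivization.mk_eq_mk_iff' ..).mpr ⟨I / 2, ?_⟩)⟩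
  exact ((hf.isAlmostComplexLift c).iterate_three (hf.sextic_eq_zero c) hz0).symm

theorem mk_holoLift {F : ℂ → Fin 7 → ℂ} {z : ℂ} (hz : h F z ≠ 0) :
    Projectivization.mk ℂ (holoLift F z) (IsAlmostComplexLift.lift_ne_zero hz) =
      Projectivization.mk ℂ (h F z) hz :=
  (Projectivization.mk_eq_mk_iff' ..).mpr ⟨_, rfl⟩

theorem IsAlmostComplexCurve.existsUnique_directrix (hf : IsAlmostComplexCurve f)
    (hfull : IsLinearlyFull f) : ∃! ψ : RiemannSphere → CP6, IsDirectrixCurve f ψ := by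
  obtain ⟨ψ, hψ⟩ := hf.exists_span hfull
  obtain ⟨W, hW, hW0⟩ := hf.exists_finite_singular hfull
  have hψh : ∀ c z, ∀ hz : h (localLift f c) z ≠ 0,
      ψ (sphereParam c z) = Projectivization.mk ℂ (h (localLift f c) z) hz := fun c z hz => by
    obtain ⟨_, h1⟩ := hψ c z _ (hf.isLocalSpan_holoLift hz)
    rw [h1, mk_holoLift hz]
  have hhol : IsHolomorphicCurve ψ := fun c z₀ => by
    obtain ⟨H, hH⟩ := hf.exists_isLocalSpan_h hfull c z₀
    exact ⟨H, hH.1, hH.eventually.mono fun z hz => hψ c z H hz⟩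
  refine ⟨ψ, ⟨hhol, 3, W, hW, fun c z hz => ?_⟩, fun ψ₁ h₁ => ?_⟩
  · have hz0 := hW0 c z hz
    have hF := hf.isAlmostComplexLift c
    have hS := hf.sextic_eq_zero c
    refine ⟨fun j hj => hF.iterate_ne_zero hS hz0 hj.le, hF.iterate_ne_zero hS hz0 le_rfl, ?_⟩
    exact (hψh c z hz0).trans ((Projectivization.mk_eq_mk_iff' ..).mpr
      ⟨I / 2, (hF.iterate_three hS hz0).symm⟩).symm
  · obtain ⟨W₁, hW₁, e₁⟩ := h₁.exists_eq_mk_h hf hfull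
    refine h₁.1.eq_of_eq_off_finite hhol hW₁ fun p hp => ?_
    obtain ⟨c, z, -, rfl⟩ := exists_sphereParam p
    obtain ⟨hz, h2⟩ := e₁ c z hp
    rw [h2, hψh c z hz]

end Directrix

/-! ### Projective equivalence implies G₂^ℂ-equivalence. -/

section Equivalence

open Complex Filter AC

/-- Being annihilated by the cross product with the derivative depends only on the line spanned. -/
theorem cross7_deriv_eq_zero_of_minors {K L : ℂ → Fin 7 → ℂ} {K' L' : Fin 7 → ℂ} {z : ℂ}
    (hK : HasDerivAt K K' z) (hL : HasDerivAt L L' z) (hL0 : L z ≠ 0)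
    (h : ∀ᶠ w in 𝓝 z, ∀ i j, K w i * L w j = K w j * L w i) (hc : cross7 (L z) L' = 0) :
    cross7 (K z) K' = 0 := by
  obtain ⟨j, hj⟩ : ∃ j, L z j ≠ 0 := by
    by_contra! h0; exact hL0 (funext h0)
  have hKi := hasDerivAt_pi.mp hK
  have hLi := hasDerivAt_pi.mp hL
  have h1 : ∀ i, K' i * L z j + K z i * L' j = K' j * L z i + K z j * L' i := fun i =>
    (((hKi i).fun_mul (hLi j)).congr_of_eventuallyEq (h.mono fun w hw => (hw i j).symm)).unique
      ((hKi j).fun_mul (hLi i))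
  have h2 : ∀ i, K z i * L z j = K z j * L z i := fun i => h.self_of_nhds i j
  have h3 : K z = (K z j / L z j) • L z := funext fun i => by
    rw [Pi.smul_apply, smul_eq_mul, div_mul_eq_mul_div, eq_div_iff hj]; exact h2 i
  have h4 : L z j • K' = (K' j - L' j * (K z j / L z j)) • L z + K z j • L' := funext fun i => by
    simp only [Pi.smul_apply, Pi.add_apply, smul_eq_mul]
    have := h1 i
    have h5 := h2 i
    field_simp
    linear_combination L z j * this - L' j * h5
  have h5 : L z j • cross7 (K z) K' = 0 := by
    rw [← cross7_smul_right, h4, h3, cross7_smul_left, cross7_add_right, cross7_smul_right,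
      cross7_smul_right, cross7_self, hc, smul_zero, smul_zero, add_zero, smul_zero]
  exact (smul_eq_zero.mp h5).resolve_left hj

theorem IsSuperhorizontal.exists_smul_map_cross7_of_minors {U : Set ℂ} {F G : ℕ → ℂ → Fin 7 → ℂ}
    (hF : IsSuperhorizontal U F) (hG : IsSuperhorizontal U G) (hne : U.Nonempty)
    (hconn : IsPreconnected U) {A : Matrix (Fin 7) (Fin 7) ℂ} (hA : IsUnit A)
    (h : ∀ z ∈ U, ∀ i j, (A *ᵥ F 0 z) i * G 0 z j = (A *ᵥ F 0 z) j * G 0 z i) :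
    ∃ μ : ℂ, μ ≠ 0 ∧
      ∀ u v, cross7 ((μ • A) *ᵥ u) ((μ • A) *ᵥ v) = (μ • A) *ᵥ cross7 u v :=
  hF.exists_smul_map_cross7 hne hconn hA fun z hz => by
    have h1 := cross7_deriv_eq_zero_of_minors (hasDerivAt_mulVec A (hF.deriv 0 z hz))
      (hG.deriv 0 z hz) (hG.ne_zero hz) (eventually_of_mem (hF.isOpen.mem_nhds hz) h)
      (hG.cross z hz)
    exact h1

theorem IsAlmostComplexLift.isSuperhorizontal {F : ℂ → Fin 7 → ℂ} (hF : IsAlmostComplexLift F)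
    (hS : ∀ z, sextic F z = 0) {U : Set ℂ} (hU : IsOpen U) (h0 : ∀ z ∈ U, h F z ≠ 0) :
    IsSuperhorizontal U fun j => (wirt (-I))^[j] (holoLift F) := by
  have hd : ∀ j, DifferentiableOn ℂ ((wirt (-I))^[j] (holoLift F)) U := by
    intro j
    induction j with
    | zero => exact fun z hz =>
        (hF.hasDerivAt_lift (h0 z hz) hS).differentiableAt.differentiableWithinAt
    | succ j ih =>
      refine (ih.deriv hU).congr fun z hz => ?_
      rw [Function.iterate_succ_apply']
      exact (ih.differentiableAt (hU.mem_nhds hz)).hasDerivAt.wirt_neg_I_eq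
  refine ⟨hU, fun j z hz => ?_, fun z hz => hF.cross_lift (h0 z hz), fun z hz v hv =>
    hF.lift_full (h0 z hz) hS hv⟩
  have h1 := ((hd j).differentiableAt (hU.mem_nhds hz)).hasDerivAt
  rw [Function.iterate_succ_apply', h1.wirt_neg_I_eq]
  exact h1

theorem GL_smul_mk (g : GL (Fin 7) ℂ) {v : Fin 7 → ℂ} (hv : v ≠ 0) :
    ∃ hg : g.1 *ᵥ v ≠ 0, g • Projectivization.mk ℂ v hv = Projectivization.mk ℂ (g.1 *ᵥ v) hg :=
  ⟨(smul_ne_zero_iff_ne g).mpr hv, rfl⟩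

theorem PGL_mk_smul (g : GL (Fin 7) ℂ) (ℓ : CP6) :
    (Matrix.ProjGenLinGroup.mk g : PGL(7, ℂ)) • ℓ = g • ℓ := by
  induction ℓ using Projectivization.ind with
  | h v hv => rfl

theorem exists_mem_G2C_of_smul (A : GL (Fin 7) ℂ) {μ : ℂ} (hμ : μ ≠ 0)
    (hhom : ∀ u v, cross7 ((μ • A.1) *ᵥ u) ((μ • A.1) *ᵥ v) = (μ • A.1) *ᵥ cross7 u v) :
    ∃ g ∈ G2C, ∀ ℓ : CP6, g • ℓ = A • ℓ := by
  let g : GL (Fin 7) ℂ := ⟨μ • A.1, μ⁻¹ • A.2, by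
    rw [smul_mul_smul_comm, mul_inv_cancel₀ hμ, A.3, one_smul], by
    rw [smul_mul_smul_comm, inv_mul_cancel₀ hμ, A.4, one_smul]⟩
  refine ⟨g, fun u v => (hhom u v).symm, fun ℓ => ?_⟩
  induction ℓ using Projectivization.ind with
  | h v hv =>
    obtain ⟨h1, h2⟩ := GL_smul_mk A hv
    obtain ⟨h3, h4⟩ := GL_smul_mk g hv
    rw [h2, h4, Projectivization.mk_eq_mk_iff']
    exact ⟨μ, (Matrix.smul_mulVec μ A.1 v).symm⟩

/-- A projective equivalence of directrix curves is induced by an automorphism of the cross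
product. -/
theorem exists_mem_G2C {f f' : RiemannSphere → SixSphere}
    (hf : IsAlmostComplexCurve f) (hf' : IsAlmostComplexCurve f')
    (hfull : IsLinearlyFull f) (hfull' : IsLinearlyFull f') {ψ ψ' : RiemannSphere → CP6}
    (hψ : IsDirectrixCurve f ψ) (hψ' : IsDirectrixCurve f' ψ') (A : GL (Fin 7) ℂ)
    (hA : ∀ p, ψ' p = A • ψ p) : ∃ g ∈ G2C, ∀ ℓ : CP6, g • ℓ = A • ℓ := by
  obtain ⟨W, hW, e⟩ := hψ.exists_eq_mk_h hf hfull
  obtain ⟨W', hW', e'⟩ := hψ'.exists_eq_mk_h hf' hfull'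
  -- A small disc free of singular points of both curves suffices, since the conclusion concerns
  -- only the matrix A.
  obtain ⟨z₀, hz₀⟩ := (eventually_sphereParam_notMem (hW.union hW') false 0).exists
  obtain ⟨r, hr, hball⟩ := Metric.eventually_nhds_iff_ball.mp
    (eventually_nhds_sphereParam_notMem (hW.union hW') hz₀)
  set U := Metric.ball z₀ r
  have hF := hf.isAlmostComplexLift false
  have hF' := hf'.isAlmostComplexLift false
  have h0 : ∀ z ∈ U, h (localLift f false) z ≠ 0 := fun z hz =>
    (e false z fun h => hball z hz (Or.inl h)).1
  have h0' : ∀ z ∈ U, h (localLift f' false) z ≠ 0 := fun z hz =>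
    (e' false z fun h => hball z hz (Or.inr h)).1
  have hsup := hF.isSuperhorizontal (hf.sextic_eq_zero false) Metric.isOpen_ball h0
  have hsup' := hF'.isSuperhorizontal (hf'.sextic_eq_zero false) Metric.isOpen_ball h0'
  have hminors : ∀ z ∈ U, ∀ i j,
      (A.1 *ᵥ holoLift (localLift f false) z) i * holoLift (localLift f' false) z j =
        (A.1 *ᵥ holoLift (localLift f false) z) j * holoLift (localLift f' false) z i := by
    intro z hz
    obtain ⟨h1, h2⟩ := e false z fun h => hball z hz (Or.inl h)
    obtain ⟨h1', h2'⟩ := e' false z fun h => hball z hz (Or.inr h)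
    rw [← mk_holoLift] at h2 h2'
    obtain ⟨h3, h4⟩ := GL_smul_mk A (IsAlmostComplexLift.lift_ne_zero h1)
    rw [← mk_eq_mk_iff_minors h3 (IsAlmostComplexLift.lift_ne_zero h1'), ← h4, ← h2, ← h2', hA]
  obtain ⟨μ, hμ, hhom⟩ := hsup.exists_smul_map_cross7_of_minors hsup'
    ⟨z₀, Metric.mem_ball_self hr⟩ (convex_ball z₀ r).isPreconnected A.isUnit hminors
  exact exists_mem_G2C_of_smul A hμ hhom

theorem projectivelyEquivalent_of_G2CEquivalent {ψ ψ' : RiemannSphere → CP6}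
    (h : G2CEquivalent ψ ψ') : ProjectivelyEquivalent ψ ψ' := by
  obtain ⟨g, -, hg⟩ := h
  exact ⟨Matrix.ProjGenLinGroup.mk g, fun p => by rw [hg, PGL_mk_smul]⟩

end Equivalence

theorem mainTheorem3 (f f' : RiemannSphere → SixSphere)
    (hf : IsAlmostComplexCurve f) (hf' : IsAlmostComplexCurve f')
    (hfull : IsLinearlyFull f) (hfull' : IsLinearlyFull f') :
    (∃! ψ : RiemannSphere → CP6, IsDirectrixCurve f ψ) ∧
    (∃! ψ' : RiemannSphere → CP6, IsDirectrixCurve f' ψ') ∧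
    ∀ ψ ψ' : RiemannSphere → CP6, IsDirectrixCurve f ψ → IsDirectrixCurve f' ψ' →
      (ProjectivelyEquivalent ψ ψ' ↔ G2CEquivalent ψ ψ') := by
  refine ⟨hf.existsUnique_directrix hfull, hf'.existsUnique_directrix hfull',
    fun ψ ψ' hψ hψ' => ⟨?_, projectivelyEquivalent_of_G2CEquivalent⟩⟩
  rintro ⟨A, hA⟩
  obtain ⟨A, rfl⟩ := Matrix.ProjGenLinGroup.mk_surjective A
  simp only [PGL_mk_smul] at hA
  obtain ⟨g, hg, hgA⟩ := exists_mem_G2C hf hf' hfull hfull' hψ hψ' A hA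
  exact ⟨g, hg, fun p => by rw [hA, hgA]⟩
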